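/- **Conventions.** Let $n>1$ be an integer. Let $\mathfrak C_n=\{0,\dots,n-1\}^{\omega}$ with the product topology be the set of infinite paths in the rooted infinite $n$-ary tree. Nodes are finite words $u$; the cone under $u$ is $u\mathfrak C_n$, and $u$ is an ancestor of $v$ if $u$ is a prefix of $v$. A tree pair $(A,B,\sigma)$ consists of two finite rooted $n$-ary trees and a bijection $\sigma$ from the leaves of $A$ to the leaves of $B$; it represents the homeomorphism $ux\mapsto\sigma(u)x$ ($u$ a leaf of $A$, $x\in\mathfrak C_n$). $V_n$ is the group of all homeomorphisms of $\mathfrak C_n$ so represented. Likewise $G_{n,r}$ is the Higman–Thompson group of homeomorphisms of $r$ disjoint copies of $\mathfrak C_n$ represented by pairs of $r$-rooted forests. Fix a tree pair $(A,B,\sigma)$. A leaf is neutral if it is a leaf of both trees. Iterate $\sigma$ on leaves as long as the image is again a leaf of $A$. A neutral leaf that returns to itself is a periodic neutral leaf; its cycle length is the least number of steps to return. The components of $A-B$ are rooted at the leaves of $B$ that are interior nodes of $A$, and those of $B-A$ at the leaves of $A$ that are interior nodes of $B$. A repeller is a non-neutral leaf of $A$ whose chain of images ends in a non-neutral leaf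 of $B$ that is an ancestor of it; an attractor is a non-neutral leaf of $B$ whose chain of preimages ends in a non-neutral leaf of $A$ that is an ancestor of it. The other leaves of components of $A-B$ are sources, and the other leaves of components of $B-A$ are sinks. The pair is revealing if each component of $A-B$ contains a repeller and each component of $B-A$ contains an attractor. Its flow graph has as vertices the repellers, the attractors and the periodic neutral leaves; it has an edge from a periodic neutral leaf to its image, and an edge (flow line) from a repeller to an attractor for each source in the repeller's component whose chain ends in a sink of the attractor's component. The non-torsion components of the flow graph are the connected components without periodic neutral leaves. If the pair represents $\alpha$, the support of such a component is the closure of the union, over its flow lines, of the orbits under $\langle\alpha\rangle$ of the cones under their sources. Write $C(\alpha)=C_{V_n}(\alpha)$ for the centralizer. For $X\subseteq\mathfrak C_n$ let $C(\alpha)_X$ be the group of elements of $C(\alpha)$ that are the identity outside $X$. **Theorem.** Let $n>1$ and $\alpha\in V_n$. Then $\alpha$ is represented by a revealing pair, and there are integers $s,t\ge 0$, distinct positive integers $m_1,\dots,m_s$, non-negative integers $r_1,\dots,r_s$ and $q_1,\dots,q_t$, finite groups $A_1,\dots,A_t$, actions of $\mathbb Z$ on the $A_j$, and an isomorphism $$\Phi:\;C_{V_n}(\alpha)\;\xrightarrow{\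 \cong\ }\;\Big(\prod_{i=1}^s K_{m_i}\rtimes G_{n,r_i}\Big)\times\Big(\prod_{j=1}^t\big((A_j\rtimes\mathbb Z)\wr P_{q_j}\big)\Big),$$ where $K_{m_i}=\mathrm{Maps}(\mathfrak C_n,\mathbb Z_{m_i})^{r_i}$, with $\mathrm{Maps}$ the group of continuous maps to the discrete group $\mathbb Z_{m_i}=\mathbb Z/m_i\mathbb Z$ under the pointwise operation; $G_{n,r_i}$ acts on $K_{m_i}$, the group of continuous maps from $r_i$ disjoint copies of $\mathfrak C_n$ to $\mathbb Z_{m_i}$, by $g\cdot f=f\circ g^{-1}$; $P_{q}$ is the full symmetric group on $q$ letters and $B\wr P_q=B^q\rtimes P_q$, with $P_q$ permuting the coordinates. Moreover $r_i$ is the minimum, over all conjugates of $\alpha$ in $V_n$ and all revealing pairs representing them, of the number of cycles of length $m_i$ of periodic neutral leaves. Finally, for every revealing pair representing $\alpha$: 1. $\{m_1,\dots,m_s\}$ is the set of cycle lengths of periodic neutral leaves, and the $i$-th coordinate of $\Phi(g)$ in the left-hand product is trivial if and only if $g$ is the identity on the union of the cones under the periodic neutral leaves of cycle length $m_i$. 2.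 Call two non-torsion components of the flow graph isomorphic if some element of $C(\alpha)$ carries the support of the first onto the support of the second. There are exactly $t$ classes $ICC_1,\dots,ICC_t$ of isomorphic non-torsion components (suitably numbered), and $ICC_j$ has exactly $q_j$ elements. 3. For every component in $ICC_j$, with support $X$, there is an isomorphism $C(\alpha)_X\cong A_j\rtimes\mathbb Z$ under which $A_j$ corresponds to the set of elements of finite order of $C(\alpha)_X$. 4. The $j$-th coordinate of $\Phi(g)$ in the right-hand product is trivial if and only if $g$ is the identity on the supports of all components in $ICC_j$. For a suitable numbering of $ICC_j$ by $1,\dots,q_j$ (the same for all $g$), the component of that coordinate in $P_{q_j}$ is the permutation of $ICC_j$ that $g$ induces on these supports. -/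

import Mathlib

namespace HT

/-! ### The Cantor set of infinite paths in the rooted `n`-ary tree -/

/-- The Cantor set `{0, …, n-1}^ω` of infinite descending paths in the rooted `n`-ary tree, with
the product topology. -/
abbrev Cantor (n : ℕ) : Type := ℕ → Fin n

/-- Nodes of the infinite rooted `n`-ary tree, named by finite words. A node `u` is an ancestor
of `v` when `u <+: v`. -/
abbrev Node (n : ℕ) : Type := List (Fin n)

/-- The path with first letter `a`, followed by `x`. -/
def prepend {n : ℕ} (a : Fin n) (x : Cantor n) : Cantor n
  | 0 => a
  | k + 1 => x k

/-- The path `u x`. The Cantor set under the node `u` is the range of `append u`. -/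
def append {n : ℕ} : Node n → Cantor n → Cantor n
  | [], x => x
  | a :: u, x => prepend a (append u x)

/-- Finite rooted `n`-ary trees. -/
inductive NTree (n : ℕ) : Type
  | leaf : NTree n
  | caret : (Fin n → NTree n) → NTree n

/-- The leaves of a finite `n`-ary tree, as nodes of the infinite tree. -/
def NTree.leaves {n : ℕ} : NTree n → Finset (Node n)
  | .leaf => {[]}
  | .caret c => Finset.univ.biUnion fun a => (c a).leaves.image (List.cons a)

/-! ### Tree pairs and forest pairs -/

/-- A tree pair (allowable triple): two finite `n`-ary trees and a bijection of their leaves. -/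
structure TreePair (n : ℕ) where
  dom : NTree n
  ran : NTree n
  perm : {u // u ∈ dom.leaves} ≃ {u // u ∈ ran.leaves}

/-- The tree pair represents `h`: each leaf of the domain tree is carried to the corresponding
leaf of the range tree by replacing the prefix (the order preserving affine map). -/
def TreePair.Represents {n : ℕ} (P : TreePair n) (h : Cantor n ≃ₜ Cantor n) : Prop :=
  ∀ u x, h (append u.1 x) = append (P.perm u).1 x

/-- The leaves of a forest of `r` finite trees. -/
abbrev ForestLeaf {n r : ℕ} (A : Fin r → NTree n) : Type :=
  {p : Fin r × Node n // p.2 ∈ (A p.1).leaves}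

/-- A pair of forests with `r` roots and a bijection of their leaves. -/
structure ForestPair (n r : ℕ) where
  dom : Fin r → NTree n
  ran : Fin r → NTree n
  perm : ForestLeaf dom ≃ ForestLeaf ran

/-- The forest pair represents a homeomorphism of `r` disjoint copies of the Cantor set. -/
def ForestPair.Represents {n r : ℕ} (P : ForestPair n r)
    (h : (Fin r × Cantor n) ≃ₜ (Fin r × Cantor n)) : Prop :=
  ∀ (p : ForestLeaf P.dom) (x : Cantor n),
    h (p.1.1, append p.1.2 x) = ((P.perm p).1.1, append (P.perm p).1.2 x)

/-! ### Closure of the represented homeomorphisms under the group operations -/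

theorem prepend_injective {n : ℕ} {a b : Fin n} {x y : Cantor n}
    (h : prepend a x = prepend b y) : a = b ∧ x = y :=
  ⟨congrFun h 0, funext fun k => congrFun h (k + 1)⟩

theorem prepend_eta {n : ℕ} (x : Cantor n) : prepend (x 0) (fun k => x (k + 1)) = x := by
  funext k; cases k <;> rfl

theorem append_append {n : ℕ} (u v : Node n) (x : Cantor n) :
    append (u ++ v) x = append u (append v x) := by
  induction u with
  | nil => rfl
  | cons a u ih => simp [append, ih]

theorem append_injective {n : ℕ} (u : Node n) : Function.Injective (append u) := by
  induction u with
  | nil => exact fun x y h => h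
  | cons a u ih => exact fun x y h => ih (prepend_injective h).2

theorem prefix_or_prefix {n : ℕ} : ∀ (u v : Node n) (x y : Cantor n),
    append u x = append v y → (∃ t, v = u ++ t) ∨ (∃ t, u = v ++ t)
  | [], v, _, _, _ => Or.inl ⟨v, rfl⟩
  | _ :: _, [], _, _, _ => Or.inr ⟨_, rfl⟩
  | a :: u, b :: v, x, y, h => by
    obtain ⟨rfl, h'⟩ := prepend_injective h
    rcases prefix_or_prefix u v x y h' with ⟨t, rfl⟩ | ⟨t, rfl⟩
    · exact Or.inl ⟨t, rfl⟩
    · exact Or.inr ⟨t, rfl⟩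

theorem exists_leaf {n : ℕ} (T : NTree n) (x : Cantor n) :
    ∃ u ∈ T.leaves, ∃ y, x = append u y := by
  induction T generalizing x with
  | leaf => exact ⟨[], by simp [NTree.leaves], x, rfl⟩
  | caret c ih =>
    obtain ⟨u, hu, y, hy⟩ := ih (x 0) (fun k => x (k + 1))
    refine ⟨x 0 :: u, ?_, y, ?_⟩
    · simp only [NTree.leaves, Finset.mem_biUnion, Finset.mem_image, Finset.mem_univ, true_and]
      exact ⟨x 0, u, hu, rfl⟩
    · rw [append, ← hy, prepend_eta]

theorem leaf_unique {n : ℕ} (T : NTree n) : ∀ u ∈ T.leaves, ∀ v ∈ T.leaves,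
    ∀ x y : Cantor n, append u x = append v y → u = v := by
  induction T with
  | leaf => simp [NTree.leaves]
  | caret c ih =>
    intro u hu v hv x y h
    simp only [NTree.leaves, Finset.mem_biUnion, Finset.mem_image, Finset.mem_univ,
      true_and] at hu hv
    obtain ⟨a, u, hu, rfl⟩ := hu
    obtain ⟨b, v, hv, rfl⟩ := hv
    obtain ⟨rfl, h'⟩ := prepend_injective h
    rw [ih a u hu v hv x y h']

/-- A complete prefix code is the leaf set of a finite tree. -/
theorem exists_tree {n : ℕ} (N : ℕ) (W : Finset (Node n)) [Nonempty (Cantor n)]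
    (hN : ∀ w ∈ W, w.length ≤ N) (hc : ∀ x : Cantor n, ∃ w ∈ W, ∃ y, x = append w y)
    (hu : ∀ u ∈ W, ∀ v ∈ W, ∀ x y : Cantor n, append u x = append v y → u = v) :
    ∃ T : NTree n, T.leaves = W := by
  classical
  induction N generalizing W with
  | zero =>
    refine ⟨.leaf, ?_⟩
    obtain ⟨w, hw, -⟩ := hc (Classical.arbitrary _)
    have h0 : ∀ w ∈ W, w = [] := fun w hw => by simpa using hN w hw
    ext v
    simp only [NTree.leaves, Finset.mem_singleton]
    exact ⟨fun h => h ▸ h0 w hw ▸ hw, h0 v⟩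
  | succ N ih =>
    by_cases h : ([] : Node n) ∈ W
    · refine ⟨.leaf, ?_⟩
      ext v
      simp only [NTree.leaves, Finset.mem_singleton]
      refine ⟨fun e => e ▸ h, fun hv => ?_⟩
      exact (hu [] h v hv (append v (Classical.arbitrary _)) (Classical.arbitrary _) rfl).symm
    · have hx : ∀ a : Fin n, ∃ T : NTree n, ∀ v, v ∈ T.leaves ↔ a :: v ∈ W := by
        intro a
        have hmem : ∀ v, v ∈ (W.filter fun w => w.head? = some a).image List.tail ↔
            a :: v ∈ W := by
          intro v
          simp only [Finset.mem_image, Finset.mem_filter]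
          constructor
          · rintro ⟨w, ⟨hw, h1⟩, rfl⟩
            cases w with
            | nil => simp at h1
            | cons b w => simp at h1; subst h1; exact hw
          · intro hv
            exact ⟨a :: v, ⟨hv, rfl⟩, rfl⟩
        obtain ⟨T, hT⟩ := ih ((W.filter fun w => w.head? = some a).image List.tail)
          (fun w hw => by simpa using hN _ ((hmem w).1 hw))
          (fun x => by
            obtain ⟨w, hw, y, hy⟩ := hc (prepend a x)
            cases w with
            | nil => exact absurd hw h
            | cons b w =>
              obtain ⟨rfl, h'⟩ := prepend_injective hy
              exact ⟨w, (hmem w).2 hw, y, h'⟩)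
          (fun u hu' v hv' x y e => by
            have := hu _ ((hmem u).1 hu') _ ((hmem v).1 hv') x y (by simp [append, e])
            simpa using this)
        exact ⟨T, fun v => by rw [hT, hmem]⟩
      choose c hcc using hx
      refine ⟨.caret c, ?_⟩
      ext v
      simp only [NTree.leaves, Finset.mem_biUnion, Finset.mem_image, Finset.mem_univ, true_and]
      constructor
      · rintro ⟨a, u, hu', rfl⟩
        exact (hcc a u).1 hu'
      · intro hv
        cases v with
        | nil => exact absurd hv h
        | cons a v => exact ⟨a, v, (hcc a v).2 hv, rfl⟩

/-- Every point has a cone neighbourhood on which `h` replaces a prefix. -/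
def LocallyPrefix {n r : ℕ} (h : (Fin r × Cantor n) ≃ₜ (Fin r × Cantor n)) : Prop :=
  ∀ i z, ∃ u y j v, z = append u y ∧ ∀ x, h (i, append u x) = (j, append v x)

theorem LocallyPrefix.exists_forest {n r : ℕ} {h : (Fin r × Cantor n) ≃ₜ (Fin r × Cantor n)}
    (hh : LocallyPrefix h) (i : Fin r) :
    ∃ T : NTree n, ∀ u ∈ T.leaves, ∃ j v, ∀ x, h (i, append u x) = (j, append v x) := by
  classical
  by_contra hbad
  let Good : Node n → Prop := fun w => ∃ T : NTree n, ∀ u ∈ T.leaves,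
    ∃ j v, ∀ x, h (i, append (w ++ u) x) = (j, append v x)
  have step : ∀ w, ¬ Good w → ∃ a : Fin n, ¬ Good (w ++ [a]) := by
    intro w hw
    by_contra hall
    push Not at hall
    choose c hc using hall
    refine hw ⟨.caret c, fun u hu => ?_⟩
    simp only [NTree.leaves, Finset.mem_biUnion, Finset.mem_image, Finset.mem_univ,
      true_and] at hu
    obtain ⟨a, u, hu, rfl⟩ := hu
    simpa using hc a u hu
  have : Nonempty (Fin n) := ⟨(step [] hbad).choose⟩
  choose! f hf using step
  let g : ℕ → Node n := fun k => Nat.rec [] (fun _ w => w ++ [f w]) k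
  have hg : ∀ k, ¬ Good (g k) := by
    intro k
    induction k with
    | zero => exact hbad
    | succ k ih => exact hf _ ih
  let z : Cantor n := fun k => f (g k)
  have hz : ∀ k, z = append (g k) (fun l => z (k + l)) := by
    intro k
    induction k with
    | zero => funext l; simp [g, append]
    | succ k ih =>
      have e : (fun l => z (k + l)) = append [f (g k)] (fun l => z (k + 1 + l)) := by
        funext l
        cases l with
        | zero => rfl
        | succ l => exact congrArg z (show k + (l + 1) = k + 1 + l by omega)
      have e2 : g (k + 1) = g k ++ [f (g k)] := rfl
      rw [e2, append_append, ← e]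
      exact ih
  obtain ⟨u, y, j, v, hzu, huv⟩ := hh i z
  have hlen : ∀ k, (g k).length = k := by
    intro k
    induction k with
    | zero => rfl
    | succ k ih =>
      have e2 : g (k + 1) = g k ++ [f (g k)] := rfl
      rw [e2, List.length_append, ih]; rfl
  have hgu : ∃ t, g u.length = u ++ t := by
    rcases prefix_or_prefix _ _ _ _ ((hz u.length).symm.trans hzu) with ⟨t, ht⟩ | ht
    · have h1 := congrArg List.length ht
      rw [List.length_append, hlen] at h1
      have : t = [] := List.length_eq_zero_iff.1 (by omega)
      subst this
      exact ⟨[], by simpa using ht.symm⟩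
    · exact ht
  obtain ⟨t, ht⟩ := hgu
  refine hg u.length ⟨.leaf, fun w hw => ⟨j, v ++ t, fun x => ?_⟩⟩
  simp only [NTree.leaves, Finset.mem_singleton] at hw
  subst hw
  rw [List.append_nil, ht, append_append, huv, append_append]

theorem represents_iff_locallyPrefix {n r : ℕ} (h : (Fin r × Cantor n) ≃ₜ (Fin r × Cantor n)) :
    (∃ P : ForestPair n r, P.Represents h) ↔ LocallyPrefix h := by
  classical
  constructor
  · rintro ⟨P, hP⟩ i z
    obtain ⟨u, hu, y, hy⟩ := exists_leaf (P.dom i) z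
    exact ⟨u, y, _, _, hy, hP ⟨(i, u), hu⟩⟩
  · intro hh
    by_cases hne : Nonempty (Cantor n)
    · choose A hA using hh.exists_forest
      have hA' : ∀ p : ForestLeaf A, ∃ q : Fin r × Node n,
          ∀ x, h (p.1.1, append p.1.2 x) = (q.1, append q.2 x) := fun p => by
        obtain ⟨j, v, e⟩ := hA p.1.1 p.1.2 p.2
        exact ⟨(j, v), e⟩
      choose w hw using hA'
      have hfin : Finite (ForestLeaf A) := by
        have : (Set.univ : Set (ForestLeaf A)).Finite := by
          refine Set.Finite.of_finite_image (f := fun p : ForestLeaf A => p.1) ?_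
            Subtype.val_injective.injOn
          refine Set.Finite.subset (Finset.univ.biUnion fun i : Fin r =>
            (A i).leaves.image fun u => (i, u)).finite_toSet ?_
          rintro _ ⟨p, -, rfl⟩
          simp only [Finset.coe_biUnion, Set.mem_iUnion, Finset.coe_image, Set.mem_image]
          exact ⟨p.1.1, by simp, p.1.2, p.2, rfl⟩
        exact Set.finite_univ_iff.1 this
      have := Fintype.ofFinite (ForestLeaf A)
      have huniq : ∀ p q : ForestLeaf A, ∀ x y, (w p).1 = (w q).1 →
          append (w p).2 x = append (w q).2 y → p = q := by
        intro p q x y h1 h2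
        have h3 : h (p.1.1, append p.1.2 x) = h (q.1.1, append q.1.2 y) := by
          rw [hw, hw, h1, h2]
        obtain ⟨h4, h5⟩ := Prod.ext_iff.1 (h.injective h3)
        simp only at h4 h5
        obtain ⟨⟨i, u⟩, hu⟩ := p
        obtain ⟨⟨j, v⟩, hv⟩ := q
        simp only at h4 h5 hu hv
        subst h4
        have := leaf_unique _ u hu v hv x y h5
        subst this
        rfl
      have hB : ∀ j, ∃ T : NTree n, ∀ v, v ∈ T.leaves ↔ ∃ p, w p = (j, v) := by
        intro j
        have hm : ∀ v, v ∈ ((Finset.univ : Finset (ForestLeaf A)).filter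
            fun p => (w p).1 = j).image (fun p => (w p).2) ↔ ∃ p, w p = (j, v) := by
          intro v
          simp only [Finset.mem_image, Finset.mem_filter, Finset.mem_univ, true_and]
          exact ⟨fun ⟨p, h1, h2⟩ => ⟨p, Prod.ext h1 h2⟩,
            fun ⟨p, hp⟩ => ⟨p, by rw [hp], by rw [hp]⟩⟩
        obtain ⟨T, hT⟩ := exists_tree _ (((Finset.univ : Finset (ForestLeaf A)).filter
            fun p => (w p).1 = j).image (fun p => (w p).2))
          (fun v hv => Finset.le_sup (f := List.length) hv)
          (fun x => by
            obtain ⟨⟨i, z⟩, hz⟩ := h.surjective (j, x)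
            obtain ⟨u, hu, y, rfl⟩ := exists_leaf (A i) z
            have e := hw ⟨(i, u), hu⟩ y
            simp only at e
            rw [hz] at e
            obtain ⟨e1, e2⟩ := Prod.ext_iff.1 e
            exact ⟨_, (hm _).2 ⟨⟨(i, u), hu⟩, Prod.ext e1.symm rfl⟩, y, e2⟩)
          (fun u hu v hv x y e => by
            obtain ⟨p, hp⟩ := (hm _).1 hu
            obtain ⟨q, hq⟩ := (hm _).1 hv
            have hpq := huniq p q x y (by rw [hp, hq]) (by rw [hp, hq]; exact e)
            subst hpq
            rw [hp] at hq
            exact (Prod.ext_iff.1 hq).2)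
        exact ⟨T, fun v => by rw [hT, hm]⟩
      choose B hB using hB
      let F : ForestLeaf A → ForestLeaf B := fun p => ⟨w p, (hB _ _).2 ⟨p, rfl⟩⟩
      have hF : Function.Bijective F := by
        constructor
        · intro p q e
          have e' : w p = w q := congrArg Subtype.val e
          exact huniq p q (Classical.arbitrary _) (Classical.arbitrary _) (by rw [e'])
            (by rw [e'])
        · rintro ⟨q, hq⟩
          obtain ⟨p, hp⟩ := (hB _ _).1 hq
          exact ⟨p, Subtype.ext hp⟩
      exact ⟨⟨A, B, Equiv.ofBijective F hF⟩, fun p x => hw p x⟩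
    · have : IsEmpty (Cantor n) := not_nonempty_iff.1 hne
      exact ⟨⟨fun _ => .leaf, fun _ => .leaf, Equiv.refl _⟩, fun p x => isEmptyElim x⟩

theorem LocallyPrefix.mul {n r : ℕ} {g h : (Fin r × Cantor n) ≃ₜ (Fin r × Cantor n)}
    (hg : LocallyPrefix g) (hh : LocallyPrefix h) : LocallyPrefix (g * h) := by
  intro i z
  obtain ⟨u, y, j, v, rfl, huv⟩ := hh i z
  obtain ⟨u', y', j', v', hy, huv'⟩ := hg j (append v y)
  rcases prefix_or_prefix _ _ _ _ hy with ⟨t, rfl⟩ | ⟨t, rfl⟩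
  · rw [append_append] at hy
    have := append_injective _ hy
    subst this
    refine ⟨u ++ t, y', j', v', by rw [append_append], fun x => ?_⟩
    rw [Homeomorph.mul_apply, append_append, huv, ← append_append, huv']
  · refine ⟨u, y, j', v' ++ t, rfl, fun x => ?_⟩
    rw [Homeomorph.mul_apply, huv, append_append, huv', append_append]

theorem LocallyPrefix.inv {n r : ℕ} {h : (Fin r × Cantor n) ≃ₜ (Fin r × Cantor n)}
    (hh : LocallyPrefix h) : LocallyPrefix h⁻¹ := by
  intro i z
  obtain ⟨⟨j, y⟩, hy⟩ := h.surjective (i, z)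
  obtain ⟨u, y', i', v, rfl, huv⟩ := hh j y
  rw [huv] at hy
  obtain ⟨h1, h2⟩ := Prod.ext_iff.1 hy
  simp only at h1 h2
  subst h1
  refine ⟨v, y', j, u, h2.symm, fun x => ?_⟩
  rw [← huv]
  exact h.symm_apply_apply _

/-- The Higman–Thompson group `G_{n,r}`: the homeomorphisms of `r` disjoint copies of the Cantor
set that are represented by a pair of `r`-rooted forests. -/
def HigmanThompson (n r : ℕ) : Subgroup ((Fin r × Cantor n) ≃ₜ (Fin r × Cantor n)) where
  carrier := {h | ∃ P : ForestPair n r, P.Represents h}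
  mul_mem' hg hh := (represents_iff_locallyPrefix _).2
    (((represents_iff_locallyPrefix _).1 hg).mul ((represents_iff_locallyPrefix _).1 hh))
  one_mem' := ⟨⟨fun _ => .leaf, fun _ => .leaf, Equiv.refl _⟩, fun _ _ => rfl⟩
  inv_mem' hh := (represents_iff_locallyPrefix _).2 ((represents_iff_locallyPrefix _).1 hh).inv

/-- A homeomorphism of the Cantor set, seen on one copy of the Cantor set. -/
def oneCopy {n : ℕ} (h : Cantor n ≃ₜ Cantor n) : (Fin 1 × Cantor n) ≃ₜ (Fin 1 × Cantor n) :=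
  (Homeomorph.refl (Fin 1)).prodCongr h

theorem represents_iff_oneCopy {n : ℕ} (h : Cantor n ≃ₜ Cantor n) :
    (∃ P : TreePair n, P.Represents h) ↔ oneCopy h ∈ HigmanThompson n 1 := by
  constructor
  · rintro ⟨P, hP⟩
    let e : ∀ T : NTree n, {u // u ∈ T.leaves} ≃ ForestLeaf (fun _ : Fin 1 => T) := fun T =>
      { toFun := fun u => ⟨(0, u.1), u.2⟩
        invFun := fun p => ⟨p.1.2, p.2⟩
        left_inv := fun _ => rfl
        right_inv := fun p => Subtype.ext (Prod.ext (Subsingleton.elim _ _) rfl) }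
    exact ⟨⟨fun _ => P.dom, fun _ => P.ran, ((e _).symm.trans P.perm).trans (e _)⟩,
      fun p x => Prod.ext (Subsingleton.elim _ _) (hP ⟨p.1.2, p.2⟩ x)⟩
  · rintro ⟨P, hP⟩
    let e : ∀ T : Fin 1 → NTree n, ForestLeaf T ≃ {u // u ∈ (T 0).leaves} := fun T =>
      { toFun := fun p => ⟨p.1.2, by
          have h := p.2
          rwa [Subsingleton.elim p.1.1 0] at h⟩
        invFun := fun u => ⟨(0, u.1), u.2⟩
        left_inv := fun p => Subtype.ext (Prod.ext (Subsingleton.elim _ _) rfl)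
        right_inv := fun _ => rfl }
    refine ⟨⟨P.dom 0, P.ran 0, ((e _).symm.trans P.perm).trans (e _)⟩, fun u x => ?_⟩
    exact congrArg Prod.snd (hP ⟨(0, u.1), u.2⟩ x)

/-- The group `V_n` of all homeomorphisms of the Cantor set represented by a tree pair. -/
def V (n : ℕ) : Subgroup (Cantor n ≃ₜ Cantor n) where
  carrier := {h | ∃ P : TreePair n, P.Represents h}
  mul_mem' hg hh := (represents_iff_oneCopy _).2
    (mul_mem ((represents_iff_oneCopy _).1 hg) ((represents_iff_oneCopy _).1 hh))
  one_mem' := ⟨⟨.leaf, .leaf, Equiv.refl _⟩, fun _ _ => rfl⟩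
  inv_mem' hh := (represents_iff_oneCopy _).2 (inv_mem ((represents_iff_oneCopy _).1 hh))

/-! ### Iterated augmentation chains and revealing pairs -/

namespace TreePair

variable {n : ℕ} (P : TreePair n)

/-- `u` is a leaf of the domain tree and is carried to the leaf `v` of the range tree. -/
def Step (u v : Node n) : Prop := ∃ h : u ∈ P.dom.leaves, (P.perm ⟨u, h⟩).1 = v

/-- `w` is the root of a component of (domain tree) − (range tree): a leaf of the range tree that
is an interior node of the domain tree. The leaves of that component are the leaves of the domain
tree below `w`. -/
def IsDomRoot (w : Node n) : Prop :=
  w ∈ P.ran.leaves ∧ ∃ u ∈ P.dom.leaves, w <+: u ∧ w ≠ u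

/-- `w` is the root of a component of (range tree) − (domain tree). -/
def IsRanRoot (w : Node n) : Prop :=
  w ∈ P.dom.leaves ∧ ∃ u ∈ P.ran.leaves, w <+: u ∧ w ≠ u

/-- A repeller: a non-neutral leaf of the domain tree whose chain of images runs through leaves
and ends in a non-neutral leaf of the range tree that is an ancestor of it. -/
def IsRepeller (u : Node n) : Prop :=
  u ∉ P.ran.leaves ∧ ∃ v, Relation.TransGen P.Step u v ∧ v ∉ P.dom.leaves ∧ v <+: u

/-- An attractor: a non-neutral leaf of the range tree whose chain of preimages runs through
leaves and ends in a non-neutral leaf of the domain tree that is an ancestor of it. -/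
def IsAttractor (v : Node n) : Prop :=
  v ∉ P.dom.leaves ∧ ∃ u, Relation.TransGen P.Step u v ∧ u ∉ P.ran.leaves ∧ u <+: v

/-- `P` is a revealing pair: every component of (domain) − (range) contains a repeller and every
component of (range) − (domain) contains an attractor. -/
def IsRevealing : Prop :=
  (∀ w, P.IsDomRoot w → ∃ u, P.IsRepeller u ∧ w <+: u) ∧
    ∀ w, P.IsRanRoot w → ∃ v, P.IsAttractor v ∧ w <+: v

/-- `P` is a revealing pair representing `α`. -/
def IsRevealingFor (α : V n) : Prop := P.IsRevealing ∧ P.Represents α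

/-- A source: a leaf of a component of (domain) − (range) that is not a repeller. -/
def IsSource (u : Node n) : Prop :=
  u ∈ P.dom.leaves ∧ (∃ w, P.IsDomRoot w ∧ w <+: u) ∧ ¬ P.IsRepeller u

/-- A sink: a leaf of a component of (range) − (domain) that is not an attractor. -/
def IsSink (v : Node n) : Prop :=
  v ∈ P.ran.leaves ∧ (∃ w, P.IsRanRoot w ∧ w <+: v) ∧ ¬ P.IsAttractor v

/-! ### Periodic neutral leaves -/

/-- `u` is a periodic neutral leaf lying on a cycle of leaves of length `m`. -/
def IsPeriodicLeaf (m : ℕ) (u : Node n) : Prop :=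
  0 < m ∧ ∃ c : ℕ → Node n, c 0 = u ∧ c m = u ∧ (∀ k, 0 < k → k < m → c k ≠ u) ∧
    ∀ k, P.Step (c k) (c (k + 1))

/-- The cycle lengths of the periodic neutral leaves. -/
def cycleLengths : Set ℕ := {m | ∃ u, P.IsPeriodicLeaf m u}

/-- The number of cycles of length `m` of periodic neutral leaves. -/
noncomputable def numCycles (m : ℕ) : ℕ :=
  Set.ncard {S : Set (Node n) | ∃ u, P.IsPeriodicLeaf m u ∧
    S = {v | Relation.ReflTransGen P.Step u v}}

/-- The subset of the Cantor set underlying the periodic neutral leaves on cycles of length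
`m`. -/
def torsionSupport (m : ℕ) : Set (Cantor n) :=
  {x | ∃ u y, P.IsPeriodicLeaf m u ∧ x = append u y}

/-! ### The flow graph -/

/-- The vertices of the flow graph: repellers, attractors and periodic neutral leaves. -/
def IsFlowVertex (u : Node n) : Prop :=
  P.IsRepeller u ∨ P.IsAttractor u ∨ ∃ m, P.IsPeriodicLeaf m u

/-- A source-sink flow line from the repeller `ρ` to the attractor `a`: a source `u` in the
component of `ρ` whose chain ends in a sink `v` in the component of `a`. -/
def IsFlowLine (u v ρ a : Node n) : Prop :=
  P.IsSource u ∧ P.IsSink v ∧ Relation.TransGen P.Step u v ∧ P.IsRepeller ρ ∧ P.IsAttractor a ∧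
    (∃ w, P.IsDomRoot w ∧ w <+: u ∧ w <+: ρ) ∧ ∃ w, P.IsRanRoot w ∧ w <+: v ∧ w <+: a

/-- The directed edges of the flow graph between distinct vertices: source-sink flow lines, and
edges from a periodic neutral leaf to its image. -/
def FlowEdge (x y : {u // P.IsFlowVertex u}) : Prop :=
  (∃ u v, P.IsFlowLine u v x.1 y.1) ∨ ((∃ m, P.IsPeriodicLeaf m x.1) ∧ P.Step x.1 y.1)

/-- The undirected simple graph underlying the flow graph. Only its connected components are used,
and these do not depend on directions, labels, multiplicities and loops. -/
def flowGraph : SimpleGraph {u // P.IsFlowVertex u} := SimpleGraph.fromRel P.FlowEdge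

/-- The non-torsion components of the flow graph: those without periodic neutral leaves. -/
abbrev NonTorsionComponent : Type :=
  {c : P.flowGraph.ConnectedComponent // ∀ x ∈ c.supp, ¬ ∃ m, P.IsPeriodicLeaf m x.1}

/-- The set underlying a non-torsion component: the closure of the union of the bi-infinite orbits
under `α` of the cones under the sources of the flow lines of the component. -/
def componentSupport (α : V n) (c : P.NonTorsionComponent) : Set (Cantor n) :=
  closure {x | ∃ u v, ∃ ρ ∈ c.1.supp, ∃ a ∈ c.1.supp, P.IsFlowLine u v ρ.1 a.1 ∧
    ∃ (k : ℤ) (y : Cantor n), x = (α ^ k).1 (append u y)}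

end TreePair

/-! ### Centralizers and the factors -/

/-- The centralizer of `α` in `V_n`. -/
abbrev centralizer {n : ℕ} (α : V n) : Subgroup (V n) := Subgroup.centralizer {α}

/-- The elements of the centralizer of `α` that are the identity outside `X`. -/
def restrictedCentralizer {n : ℕ} (α : V n) (X : Set (Cantor n)) : Subgroup (V n) where
  carrier := {g | g ∈ centralizer α ∧ ∀ x, x ∉ X → g.1 x = x}
  mul_mem' := by
    rintro a b ⟨ha, ha'⟩ ⟨hb, hb'⟩
    refine ⟨mul_mem ha hb, fun x hx => ?_⟩
    change a.1 (b.1 x) = x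
    rw [hb' x hx, ha' x hx]
  one_mem' := ⟨one_mem _, fun _ _ => rfl⟩
  inv_mem' := by
    rintro a ⟨ha, ha'⟩
    refine ⟨inv_mem ha, fun x hx => ?_⟩
    change a.1.symm x = x
    rw [Homeomorph.symm_apply_eq, ha' x hx]

/-- The group `Maps(𝔆_n, ℤ_m)^r`, where `Maps` is the group of continuous maps under pointwise
multiplication and `ℤ_m` is the discrete cyclic group, written multiplicatively. -/
abbrev K (n m r : ℕ) : Type := Fin r → C(Cantor n, Multiplicative (ZMod m))

/-- One map on each of `r` copies of the Cantor set is one map on their disjoint union. -/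
def uncurryK {n m r : ℕ} (f : K n m r) :
    C(Fin r × Cantor n, Multiplicative (ZMod m)) where
  toFun p := f p.1 p.2
  continuous_toFun := continuous_prod_of_discrete_left.2 fun i => (f i).continuous

/-- `G_{n,r}` acts on `K`, the group of continuous maps on `r` disjoint copies of the Cantor set,
by `g • f = f ∘ g⁻¹`. -/
def actK (n m r : ℕ) : HigmanThompson n r →* MulAut (K n m r) where
  toFun g :=
    { toFun := fun f i => ⟨fun x => uncurryK f (g.1.symm (i, x)), by fun_prop⟩
      invFun := fun f i => ⟨fun x => uncurryK f (g.1 (i, x)), by fun_prop⟩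
      left_inv := fun f => by ext i x; simp [uncurryK]
      right_inv := fun f => by ext i x; simp [uncurryK]
      map_mul' := fun _ _ => rfl }
  map_one' := rfl
  map_mul' _ _ := rfl

/-- The left-hand factor `K_m ⋊ G_{n,r}`. -/
abbrev TorsionFactor (n m r : ℕ) : Type := K n m r ⋊[actK n m r] HigmanThompson n r

/-- The wreath product `B ≀ P_q = B^q ⋊ P_q` with the full symmetric group `P_q` permuting the `q`
coordinates: `(σ • f) i = f (σ⁻¹ i)`. -/
abbrev Wreath (B : Type) [Group B] (q : ℕ) : Type :=
  (Fin q → B) ⋊[(mulAutArrow : Equiv.Perm (Fin q) →* MulAut (Fin q → B))] Equiv.Perm (Fin q)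

/-- The group `A ⋊ ℤ`, for an action `φ` of `ℤ` on `A`. -/
abbrev ByInt (A : Type) [Group A] (φ : Multiplicative ℤ →* MulAut A) : Type :=
  A ⋊[φ] Multiplicative ℤ

end HT

/-!
The centralizer of `α` is computed from its action on finitely many clopen pieces of the Cantor set
that are defined by `α` alone, without reference to a tree pair.

The torsion part of period `m`, `torsionSet α m`, consists of the points of exact period `m` near
which `α ^ m` is the identity. The atoms, `IsInvAtom α X`, are the minimal nonempty clopen
`α`-invariant sets in the complement of all torsion parts. A revealing pair describes the dynamics of
`α` completely (`TreePair.cover`): a point lies below a periodic neutral leaf, or in the orbit of the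
cone under a source, or in the orbit of the fixed point of a power of `α` that contracts the cone
under the root of a component. The torsion part of period `m` is therefore the set below the periodic
neutral leaves of cycle length `m` (`TreePair.torsionSupport_eq`), and the supports of the
non-torsion components are exactly the atoms (`TreePair.exists_equiv_atoms`). For the latter the main
point is `TreePair.flowSet_subset_of_trapping`: an open invariant set that contains the fixed point
of each contraction whose cone it meets must contain, with one flow line, all flow lines of the
component. It applies to clopen invariant sets, which gives minimality, and to the interior of the
fixed points of an element of the centralizer, which gives the rigidity
`IsInvAtom.smul_eq_of_fixInterior`. Revealing pairs exist by a minimality argument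
(`TreePair.exists_isRevealingFor`).

On the torsion part of period `m`, a choice of one leaf on each of the `r` cycles of length `m`
identifies the space of `α`-orbits with `r` copies of the Cantor set and the torsion part with their
product with `ℤ_m`. The centralizer acts by `K_m ⋊ G_{n,r}`, and all of this group occurs
(`TorsionChart.exists_torsionHom`). Since any revealing pair of any conjugate of `α` can be used, `r`
may be taken minimal (`TreePair.exists_torsionHom`).

On an atom `X`, an element of the centralizer is determined up to powers of `α` by finitely many
data: the image of a repelling periodic point, and the change of depth there modulo that of the
power of `α` fixing it. Thus `⟨α⟩` is a central infinite cyclic subgroup of finite index in the group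
of elements supported on `X`, and such a group is finite-by-`ℤ` by the transfer
(`exists_mulEquiv_byInt`, `IsInvAtom.exists_mulEquiv_byInt`). The centralizer permutes the finitely
many atoms, and its action on an orbit of atoms is a full wreath product (`exists_wreathHom`).

Finally, the torsion parts and the unions of the orbits of atoms form a finite partition into clopen
sets invariant under the centralizer, whose elements can be glued from arbitrary pieces, so that the
centralizer is the product of the groups found (`exists_mulEquiv_prod`).
-/

namespace HT

open Filter Topology Pointwise

/-! ### Cones and prefix replacements -/

section

variable {n : ℕ}

instance : MulAction (V n) (Cantor n) where
  smul g x := g.1 x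
  one_smul _ := rfl
  mul_smul _ _ _ := rfl

theorem continuous_smul (g : V n) : Continuous fun x : Cantor n => g • x := g.1.continuous

instance : ContinuousConstSMul (V n) (Cantor n) := ⟨continuous_smul⟩

theorem ext_smul {g h : V n} (H : ∀ x : Cantor n, g • x = h • x) : g = h :=
  Subtype.ext (Homeomorph.ext H)

/-- The set of all paths through the node `u`. -/
def cone (u : Node n) : Set (Cantor n) := Set.range (append u)

theorem append_mem_cone (u : Node n) (x : Cantor n) : append u x ∈ cone u := ⟨x, rfl⟩

theorem append_apply_add (u : Node n) (x : Cantor n) (i : ℕ) :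
    append u x (u.length + i) = x i := by
  induction u with
  | nil => simp [append]
  | cons a u ih =>
    rw [List.length_cons, show u.length + 1 + i = (u.length + i) + 1 by omega]
    exact ih

theorem append_apply_lt (u : Node n) (x y : Cantor n) (i : ℕ) (hi : i < u.length) :
    append u x i = append u y i := by
  induction u generalizing i with
  | nil => simp at hi
  | cons a u ih =>
    cases i with
    | zero => rfl
    | succ i => exact ih i (by simpa using hi)

theorem mem_cone_iff {u : Node n} {x y : Cantor n} :
    x ∈ cone u ↔ ∀ i < u.length, x i = append u y i := by
  constructor
  · rintro ⟨z, rfl⟩ i hi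
    exact append_apply_lt _ _ _ _ hi
  · intro h
    refine ⟨fun i => x (u.length + i), funext fun i => ?_⟩
    by_cases hi : i < u.length
    · rw [h i hi]; exact append_apply_lt _ _ _ _ hi
    · obtain ⟨k, rfl⟩ := Nat.exists_eq_add_of_le (not_lt.1 hi)
      rw [append_apply_add]

theorem continuous_append (u : Node n) : Continuous (append u : Cantor n → Cantor n) := by
  refine continuous_pi fun i => ?_
  by_cases hi : i < u.length
  · have : ∀ x y : Cantor n, append u x i = append u y i := fun x y =>
      append_apply_lt u x y i hi
    exact continuous_of_const this
  · obtain ⟨k, rfl⟩ := Nat.exists_eq_add_of_le (not_lt.1 hi)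
    simp only [append_apply_add]
    exact continuous_apply k

theorem isClopen_cone (u : Node n) : IsClopen (cone u) := by
  constructor
  · exact (isCompact_range (continuous_append u)).isClosed
  · rcases isEmpty_or_nonempty (Cantor n) with h | ⟨⟨y⟩⟩
    · rw [Set.eq_empty_of_isEmpty (cone u)]; exact isOpen_empty
    · have : cone u = ⋂ i ∈ Finset.range u.length, {x | x i = append u y i} := by
        ext x
        simp [mem_cone_iff (y := y)]
      rw [this]
      refine isOpen_biInter_finset fun i _ => ?_
      have h1 : Continuous fun x : Cantor n => x i := continuous_apply i
      exact (isOpen_discrete {append u y i}).preimage h1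

/-- The node of depth `k` on the path `x`. -/
def pre (x : Cantor n) : ℕ → Node n
  | 0 => []
  | k + 1 => x 0 :: pre (fun i => x (i + 1)) k

theorem length_pre (x : Cantor n) (k : ℕ) : (pre x k).length = k := by
  induction k generalizing x with
  | zero => rfl
  | succ k ih => simp [pre, ih]

theorem append_pre (x : Cantor n) (k : ℕ) : append (pre x k) (fun i => x (i + k)) = x := by
  induction k generalizing x with
  | zero => rfl
  | succ k ih =>
    have := ih (fun i => x (i + 1))
    simp only [pre, append]
    rw [show (fun i => x (i + (k + 1))) = fun i => (fun j => x (j + 1)) (i + k) from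
      funext fun i => congrArg x (by omega), this]
    exact prepend_eta x

theorem mem_cone_pre (x : Cantor n) (k : ℕ) : x ∈ cone (pre x k) := ⟨_, append_pre x k⟩

theorem mem_cone_pre_iff {x y : Cantor n} {k : ℕ} : y ∈ cone (pre x k) ↔ ∀ i < k, y i = x i := by
  rw [mem_cone_iff (y := fun i => x (i + k)), length_pre, append_pre]

theorem exists_cone_subset {O : Set (Cantor n)} (hO : IsOpen O) {x : Cantor n} (hx : x ∈ O) :
    ∃ k, cone (pre x k) ⊆ O := by
  obtain ⟨_, ⟨y, k, rfl⟩, hxy, hs⟩ :=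
    (PiNat.isTopologicalBasis_cylinders (fun _ : ℕ => Fin n)).exists_subset_of_mem_open hx hO
  refine ⟨k, fun z hz => hs ?_⟩
  rw [mem_cone_pre_iff] at hz
  rw [PiNat.mem_cylinder_iff] at hxy ⊢
  exact fun i hi => (hz i hi).trans (hxy i hi)

theorem cone_append_subset (u t : Node n) : cone (u ++ t) ⊆ cone u := by
  rintro _ ⟨x, rfl⟩
  exact ⟨append t x, (append_append u t x).symm⟩

theorem cone_subset_of_prefix {u v : Node n} (h : u <+: v) : cone v ⊆ cone u := by
  obtain ⟨t, rfl⟩ := h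
  exact cone_append_subset u t

theorem prefix_of_append_eq {u v : Node n} {x y : Cantor n} (h : append u x = append v y)
    (hl : u.length ≤ v.length) : u <+: v := by
  rcases prefix_or_prefix u v x y h with ⟨t, rfl⟩ | ⟨t, rfl⟩
  · exact ⟨t, rfl⟩
  · have : t = [] := List.length_eq_zero_iff.1 (by simp at hl; simp [hl])
    simp [this]

theorem prefix_of_mem_cone {u v : Node n} {x : Cantor n} (hu : x ∈ cone u) (hv : x ∈ cone v)
    (hl : u.length ≤ v.length) : u <+: v := by
  obtain ⟨y, rfl⟩ := hu
  obtain ⟨z, hz⟩ := hv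
  exact prefix_of_append_eq hz.symm hl

theorem prefix_total_of_mem_cone {u v : Node n} {x : Cantor n} (hu : x ∈ cone u)
    (hv : x ∈ cone v) : u <+: v ∨ v <+: u := by
  rcases le_total u.length v.length with h | h
  · exact Or.inl (prefix_of_mem_cone hu hv h)
  · exact Or.inr (prefix_of_mem_cone hv hu h)

theorem eq_nil_of_append_eq_self [Nontrivial (Fin n)] {t : Node n}
    (h : ∀ x : Cantor n, append t x = x) : t = [] := by
  cases t with
  | nil => rfl
  | cons a t =>
    obtain ⟨b, hb⟩ := exists_ne a
    exact absurd (congrFun (h fun _ => b) 0).symm hb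

theorem append_left_injective [Nontrivial (Fin n)] {u v : Node n}
    (h : ∀ x : Cantor n, append u x = append v x) : u = v := by
  have : Nonempty (Fin n) := ⟨(exists_pair_ne (Fin n)).choose⟩
  have x : Cantor n := Classical.arbitrary _
  rcases prefix_or_prefix u v x x (h x) with ⟨t, rfl⟩ | ⟨t, rfl⟩
  · have := eq_nil_of_append_eq_self (t := t) fun x =>
      (append_injective u ((h x).trans (append_append u t x))).symm
    simp [this]
  · have := eq_nil_of_append_eq_self (t := t) fun x =>
      append_injective v ((append_append v t x).symm.trans (h x))
    simp [this]

/-- A word that can be removed from the front of a path without changing it determines that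
path. -/
theorem eq_of_append_eq_self {t : Node n} (ht : t ≠ []) {x y : Cantor n}
    (hx : append t x = x) (hy : append t y = y) : x = y := by
  have hl : 0 < t.length := List.length_pos_iff.2 ht
  funext i
  induction i using Nat.strong_induction_on with
  | _ i ih =>
    rw [← hx, ← hy]
    by_cases hi : i < t.length
    · exact append_apply_lt _ _ _ _ hi
    · obtain ⟨k, rfl⟩ := Nat.exists_eq_add_of_le (not_lt.1 hi)
      rw [append_apply_add, append_apply_add]
      exact ih k (by omega)

/-- `g` maps the cone under `u` onto the cone under `v` by replacing the prefix. -/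
def Pre (g : V n) (u v : Node n) : Prop := ∀ x, g • append u x = append v x

theorem Pre.one (u : Node n) : Pre 1 u u := fun _ => rfl

theorem Pre.mul {g h : V n} {u v w : Node n} (hg : Pre g v w) (hh : Pre h u v) :
    Pre (g * h) u w := fun x => by rw [mul_smul, hh x, hg x]

theorem Pre.inv {g : V n} {u v : Node n} (h : Pre g u v) : Pre g⁻¹ v u := fun x => by
  rw [← h x, inv_smul_smul]

theorem Pre.append {g : V n} {u v : Node n} (h : Pre g u v) (t : Node n) :
    Pre g (u ++ t) (v ++ t) := fun x => by rw [append_append, h, append_append]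

theorem Pre.smul_cone {g : V n} {u v : Node n} (h : Pre g u v) : g • cone u = cone v := by
  ext x
  constructor
  · rintro ⟨_, ⟨y, rfl⟩, rfl⟩
    exact ⟨y, (h y).symm⟩
  · rintro ⟨y, rfl⟩
    exact ⟨_, ⟨y, rfl⟩, h y⟩

theorem Pre.smul_mem {g : V n} {u v : Node n} (h : Pre g u v) {x : Cantor n} (hx : x ∈ cone u) :
    g • x ∈ cone v := by
  obtain ⟨y, rfl⟩ := hx
  exact ⟨y, (h y).symm⟩

theorem Pre.right_unique [Nontrivial (Fin n)] {g : V n} {u v w : Node n} (h : Pre g u v)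
    (h' : Pre g u w) : v = w :=
  append_left_injective fun x => (h x).symm.trans (h' x)

theorem exists_pre (g : V n) (x : Cantor n) : ∃ u v, x ∈ cone u ∧ Pre g u v := by
  obtain ⟨P, hP⟩ := g.2
  obtain ⟨u, hu, y, rfl⟩ := exists_leaf P.dom x
  exact ⟨u, (P.perm ⟨u, hu⟩).1, append_mem_cone _ _, hP ⟨u, hu⟩⟩

/-- A map of the Cantor set that replaces a prefix in the neighbourhood of each point. -/
def LocPre (f : Cantor n → Cantor n) : Prop :=
  ∀ z, ∃ u v, z ∈ cone u ∧ ∀ x, f (append u x) = append v x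

theorem LocPre.continuous {f : Cantor n → Cantor n} (hf : LocPre f) : Continuous f := by
  refine continuous_iff_continuousAt.2 fun z => ?_
  obtain ⟨u, v, hz, h⟩ := hf z
  have hc : ContinuousOn f (cone u) := by
    have : ∀ x ∈ cone u, f x = append v fun i => x (u.length + i) := by
      rintro _ ⟨y, rfl⟩
      simp only [append_apply_add]
      exact h y
    refine ContinuousOn.congr (Continuous.continuousOn ?_) this
    exact (continuous_append v).comp (continuous_pi fun i => continuous_apply _)
  exact hc.continuousAt ((isClopen_cone u).isOpen.mem_nhds hz)

/-- A bijection that locally replaces prefixes is an element of `V n`. -/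
theorem exists_V_of_bijective {f : Cantor n → Cantor n} (hb : Function.Bijective f)
    (hf : LocPre f) : ∃ g : V n, ∀ x, g • x = f x := by
  let e := Equiv.ofBijective f hb
  have hinv : LocPre e.symm := by
    intro z
    obtain ⟨x, rfl⟩ := e.surjective z
    obtain ⟨u, v, ⟨y, rfl⟩, h⟩ := hf x
    refine ⟨v, u, ⟨y, (h y).symm⟩, fun x => ?_⟩
    rw [Equiv.symm_apply_eq]
    exact (h x).symm
  let g : Cantor n ≃ₜ Cantor n :=
    { e with
      continuous_toFun := hf.continuous
      continuous_invFun := hinv.continuous }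
  have hg : g ∈ V n := by
    refine (represents_iff_oneCopy g).2 ((represents_iff_locallyPrefix _).2 fun i z => ?_)
    obtain ⟨u, v, ⟨y, rfl⟩, h⟩ := hf z
    exact ⟨u, y, i, v, rfl, fun x => Prod.ext rfl (h x)⟩
  exact ⟨⟨g, hg⟩, fun _ => rfl⟩

/-! ### Displacement of an element at a point -/

/-- The change of depth that `g` makes near `x`: when `g` replaces the prefix `u` of `x` by `v`,
it is `|v| - |u|`. -/
noncomputable def disp (g : V n) (x : Cantor n) : ℤ :=
  (exists_pre g x).choose_spec.choose.length - (exists_pre g x).choose.length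

theorem Pre.disp_eq [Nontrivial (Fin n)] {g : V n} {u v : Node n} (h : Pre g u v) {x : Cantor n}
    (hx : x ∈ cone u) : disp g x = v.length - u.length := by
  have key : ∀ u' v', x ∈ cone u' → Pre g u' v' →
      (v'.length : ℤ) - u'.length = v.length - u.length := by
    intro u' v' hx' h'
    rcases prefix_total_of_mem_cone hx hx' with ⟨t, ht⟩ | ⟨t, ht⟩
    · have := (ht ▸ h.append t).right_unique h'
      rw [← this, ← ht]; simp
    · have := (ht ▸ h'.append t).right_unique h
      rw [← this, ← ht]; simp
  obtain ⟨hx', h'⟩ := (exists_pre g x).choose_spec.choose_spec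
  exact key _ _ hx' h'

theorem disp_mul [Nontrivial (Fin n)] (g h : V n) (x : Cantor n) :
    disp (g * h) x = disp g (h • x) + disp h x := by
  obtain ⟨u, v, hx, hh⟩ := exists_pre h x
  obtain ⟨u', v', hx', hg⟩ := exists_pre g (h • x)
  have hv := hh.smul_mem hx
  rw [hh.disp_eq hx, hg.disp_eq hx']
  rcases prefix_total_of_mem_cone hv hx' with ⟨t, ht⟩ | ⟨t, ht⟩
  · subst ht
    have hxt : x ∈ cone (u ++ t) := by
      rw [← (hh.append t).smul_cone] at hx'
      exact (Set.smul_mem_smul_set_iff).1 hx'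
    rw [(hg.mul (hh.append t)).disp_eq hxt]
    push_cast [List.length_append]; ring
  · rw [← ht] at hh ⊢
    rw [((hg.append t).mul hh).disp_eq hx]
    push_cast [List.length_append]; ring

theorem disp_one [Nontrivial (Fin n)] (x : Cantor n) : disp 1 x = 0 := by
  rw [(Pre.one ([] : Node n)).disp_eq (x := x) ⟨x, rfl⟩]; simp

/-- An element that fixes a point and does not change depths there is the identity near it. -/
theorem exists_pre_self_of_disp_eq_zero [Nontrivial (Fin n)] {g : V n} {x : Cantor n}
    (hx : g • x = x) (hd : disp g x = 0) : ∃ u, x ∈ cone u ∧ Pre g u u := by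
  obtain ⟨u, v, hu, h⟩ := exists_pre g x
  rw [h.disp_eq hu] at hd
  have hv := h.smul_mem hu
  rw [hx] at hv
  have hp := prefix_of_mem_cone hu hv (by omega)
  rw [← hp.eq_of_length (by omega)] at h
  exact ⟨u, hu, h⟩

/-! ### Gluing -/

/-- Elements of `V n` can be glued along a partition into clopen sets whose images again form a
partition. -/
theorem exists_glue {ι : Type*} {D : ι → Set (Cantor n)} (g : ι → V n) (hD : ∀ i, IsOpen (D i))
    (hcov : ∀ x, ∃ i, x ∈ D i) (hdis : ∀ i j x, x ∈ D i → x ∈ D j → i = j)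
    (hcov' : ∀ x, ∃ i, x ∈ g i • D i) (hdis' : ∀ i j x, x ∈ g i • D i → x ∈ g j • D j → i = j) :
    ∃ f : V n, ∀ i, ∀ x ∈ D i, f • x = g i • x := by
  choose c hc using hcov
  have hf : ∀ i, ∀ x ∈ D i, g (c x) • x = g i • x := fun i x hx => by
    rw [hdis _ _ x (hc x) hx]
  obtain ⟨f, hf'⟩ := exists_V_of_bijective (f := fun x => g (c x) • x) ⟨fun x y h => by
      have h' : g (c x) • x = g (c y) • y := h
      have h1 : g (c x) • x ∈ g (c x) • D (c x) := Set.smul_mem_smul_set (hc x)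
      have h2 : g (c x) • x ∈ g (c y) • D (c y) := h' ▸ Set.smul_mem_smul_set (hc y)
      rw [hdis' _ _ _ h1 h2] at h'
      exact smul_left_cancel _ h', fun x => by
      obtain ⟨i, y, hy, rfl⟩ := hcov' x
      exact ⟨y, hf i y hy⟩⟩ (fun z => by
      obtain ⟨u, v, hz, h⟩ := exists_pre (g (c z)) z
      obtain ⟨k, hk⟩ := exists_cone_subset
        (((isClopen_cone u).isOpen).inter (hD (c z))) ⟨hz, hc z⟩
      obtain ⟨t, ht⟩ := prefix_of_mem_cone hz (mem_cone_pre z (k + u.length))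
        (by rw [length_pre]; omega)
      refine ⟨u ++ t, v ++ t, ht ▸ mem_cone_pre z _, fun x => ?_⟩
      rw [← h.append t x]
      refine hf _ _ ?_
      rw [ht]
      refine (hk ?_).2
      have := append_mem_cone (pre z (k + u.length)) x
      rw [mem_cone_pre_iff] at this ⊢
      exact fun i hi => this i (by omega))
  exact ⟨f, fun i x hx => (hf' x).trans (hf i x hx)⟩

end

/-! ### Interior nodes and leaves of trees -/

section

variable {n : ℕ}

namespace NTree

open Classical in
/-- The interior nodes of a tree: the proper ancestors of its leaves. -/
noncomputable def inner (T : NTree n) : Finset (Node n) :=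
  T.leaves.biUnion fun u => u.inits.toFinset.erase u

theorem mem_inner {T : NTree n} {p : Node n} : p ∈ T.inner ↔ ∃ u ∈ T.leaves, p <+: u ∧ p ≠ u := by
  simp [inner, and_comm]

theorem inner_of_prefix {T : NTree n} {p q : Node n} (hq : q ∈ T.inner) (h : p <+: q) :
    p ∈ T.inner := by
  obtain ⟨u, hu, h1, h2⟩ := mem_inner.1 hq
  refine mem_inner.2 ⟨u, hu, h.trans h1, ?_⟩
  rintro rfl
  exact h2 (h1.eq_of_length (le_antisymm h1.length_le h.length_le))

theorem leaf_eq_of_mem_cone {T : NTree n} {u v : Node n} (hu : u ∈ T.leaves) (hv : v ∈ T.leaves)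
    {x : Cantor n} (hxu : x ∈ cone u) (hxv : x ∈ cone v) : u = v := by
  obtain ⟨y, rfl⟩ := hxu
  obtain ⟨z, hz⟩ := hxv
  exact leaf_unique T u hu v hv y z hz.symm

variable [Nontrivial (Fin n)]

instance : Nonempty (Fin n) := ⟨(exists_pair_ne (Fin n)).choose⟩

theorem leaf_eq_of_prefix {T : NTree n} {u v : Node n} (hu : u ∈ T.leaves) (hv : v ∈ T.leaves)
    (h : u <+: v) : u = v := by
  obtain ⟨t, rfl⟩ := h
  exact leaf_unique T u hu _ hv (append t (Classical.arbitrary _)) (Classical.arbitrary _)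
    (append_append _ _ _).symm

theorem inner_or_below_leaf (T : NTree n) (p : Node n) :
    p ∈ T.inner ∨ ∃ u ∈ T.leaves, u <+: p := by
  obtain ⟨u, hu, y, hy⟩ := exists_leaf T (append p (Classical.arbitrary _))
  rcases prefix_total_of_mem_cone (append_mem_cone p _) (hy ▸ append_mem_cone u y) with h | h
  · by_cases e : p = u
    · exact Or.inr ⟨u, hu, e ▸ List.prefix_rfl⟩
    · exact Or.inl (mem_inner.2 ⟨u, hu, h, e⟩)
  · exact Or.inr ⟨u, hu, h⟩

theorem not_inner_of_leaf_prefix {T : NTree n} {u p : Node n} (hu : u ∈ T.leaves) (h : u <+: p) :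
    p ∉ T.inner := by
  intro hp
  obtain ⟨v, hv, h1, h2⟩ := mem_inner.1 hp
  have := leaf_eq_of_prefix hu hv (h.trans h1)
  subst this
  exact h2 (h1.eq_of_length (le_antisymm h1.length_le h.length_le))

theorem mem_leaves_iff {T : NTree n} {u : Node n} :
    u ∈ T.leaves ↔ u ∉ T.inner ∧ ∀ p, p <+: u → p ≠ u → p ∈ T.inner := by
  refine ⟨fun hu => ⟨not_inner_of_leaf_prefix hu List.prefix_rfl, fun p hp hne =>
    mem_inner.2 ⟨u, hu, hp, hne⟩⟩, fun ⟨h1, h2⟩ => ?_⟩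
  obtain ⟨v, hv, hvu⟩ := (inner_or_below_leaf T u).resolve_left h1
  by_cases e : v = u
  · exact e ▸ hv
  · exact absurd (h2 v hvu e) (not_inner_of_leaf_prefix hv List.prefix_rfl)

/-- Attaching a caret at the leaf `u` turns it into an interior node. -/
theorem inner_of_expand [DecidableEq (Node n)] {T T' : NTree n} {u : Node n} (hu : u ∈ T.leaves)
    (h : T'.leaves = T.leaves.erase u ∪ Finset.univ.image fun a => u ++ [a]) :
    T'.inner = insert u T.inner := by
  ext p
  simp only [mem_inner, h, Finset.mem_union, Finset.mem_erase, Finset.mem_image, Finset.mem_univ,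
    true_and, Finset.mem_insert]
  constructor
  · rintro ⟨v, ⟨hne, hv⟩ | ⟨a, rfl⟩, h1, h2⟩
    · exact Or.inr ⟨v, hv, h1, h2⟩
    · rcases List.prefix_concat_iff.1 h1 with e | e
      · exact absurd e h2
      · by_cases hp : p = u
        · exact Or.inl hp
        · exact Or.inr ⟨u, hu, e, hp⟩
  · rintro (rfl | ⟨v, hv, h1, h2⟩)
    · exact ⟨_, Or.inr ⟨Classical.arbitrary _, rfl⟩, List.prefix_append _ _, by simp⟩
    · by_cases e : v = u
      · subst e
        refine ⟨_, Or.inr ⟨Classical.arbitrary _, rfl⟩, h1.trans (List.prefix_append _ _), ?_⟩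
        rintro rfl
        have := h1.length_le
        simp at this
      · exact ⟨v, Or.inl ⟨e, hv⟩, h1, h2⟩

theorem exists_expand [DecidableEq (Node n)] {T : NTree n} {u : Node n} (hu : u ∈ T.leaves) :
    ∃ T' : NTree n, T'.leaves = T.leaves.erase u ∪ Finset.univ.image fun a => u ++ [a] := by
  set W := T.leaves.erase u ∪ Finset.univ.image fun a => u ++ [a] with hW
  have hmem : ∀ w, w ∈ W ↔ (w ≠ u ∧ w ∈ T.leaves) ∨ ∃ a, u ++ [a] = w := by
    intro w
    simp [hW]
  refine exists_tree (W.sup List.length) W (fun w hw => Finset.le_sup (f := List.length) hw)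
    (fun x => ?_) (fun v hv w hw x y e => ?_)
  · obtain ⟨v, hv, y, rfl⟩ := exists_leaf T x
    by_cases e : v = u
    · subst e
      refine ⟨v ++ [y 0], (hmem _).2 (Or.inr ⟨_, rfl⟩), fun i => y (i + 1), ?_⟩
      rw [append_append]
      exact congrArg _ (prepend_eta y).symm
    · exact ⟨v, (hmem _).2 (Or.inl ⟨e, hv⟩), y, rfl⟩
  · rcases (hmem v).1 hv with ⟨hv1, hv2⟩ | ⟨a, rfl⟩ <;>
      rcases (hmem w).1 hw with ⟨hw1, hw2⟩ | ⟨b, rfl⟩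
    · exact leaf_unique T v hv2 w hw2 x y e
    · rw [append_append] at e
      exact absurd (leaf_unique T v hv2 u hu _ _ e) hv1
    · rw [append_append] at e
      exact absurd (leaf_unique T u hu w hw2 _ _ e).symm hw1
    · rw [append_append, append_append] at e
      rw [(prepend_injective (append_injective u e)).1]

end NTree

/-! ### Chains of leaves of a tree pair -/

namespace TreePair

variable {P : TreePair n} {α : V n}

/-- The tree pair with the two trees exchanged, which represents the inverse. -/
def inv (P : TreePair n) : TreePair n := ⟨P.ran, P.dom, P.perm.symm⟩

theorem inv_inv (P : TreePair n) : P.inv.inv = P := rfl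

theorem Represents.inv (h : P.Represents α) : P.inv.Represents (α⁻¹ : V n) := by
  intro u x
  have := h (P.perm.symm u) x
  change α.1.symm _ = _
  rw [Homeomorph.symm_apply_eq]
  refine Eq.trans ?_ this.symm
  exact congrArg (fun w : {w // w ∈ P.ran.leaves} => append w.1 x)
    (P.perm.apply_symm_apply u).symm

theorem Step.dom {u v : Node n} (h : P.Step u v) : u ∈ P.dom.leaves := h.choose

theorem Step.ran {u v : Node n} (h : P.Step u v) : v ∈ P.ran.leaves := by
  obtain ⟨_, rfl⟩ := h
  exact (P.perm _).2

theorem exists_step {u : Node n} (h : u ∈ P.dom.leaves) : ∃ v, P.Step u v := ⟨_, h, rfl⟩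

theorem step_inv {u v : Node n} : P.inv.Step u v ↔ P.Step v u := by
  constructor
  · rintro ⟨h, rfl⟩
    refine ⟨(P.perm.symm ⟨u, h⟩).2, ?_⟩
    exact congrArg Subtype.val (P.perm.apply_symm_apply ⟨u, h⟩)
  · rintro ⟨h, rfl⟩
    refine ⟨(P.perm ⟨v, h⟩).2, ?_⟩
    exact congrArg Subtype.val (P.perm.symm_apply_apply ⟨v, h⟩)

theorem exists_step_to {v : Node n} (h : v ∈ P.ran.leaves) : ∃ u, P.Step u v := by
  obtain ⟨u, hu⟩ := exists_step (P := P.inv) h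
  exact ⟨u, step_inv.1 hu⟩

theorem Step.right_unique {u v w : Node n} (h : P.Step u v) (h' : P.Step u w) : v = w := by
  obtain ⟨_, rfl⟩ := h
  obtain ⟨_, rfl⟩ := h'
  rfl

theorem Step.left_unique {u v w : Node n} (h : P.Step u w) (h' : P.Step v w) : u = v :=
  (step_inv.2 h).right_unique (step_inv.2 h')

theorem Step.pre (hP : P.Represents α) {u v : Node n} (h : P.Step u v) : Pre α u v := by
  obtain ⟨hu, rfl⟩ := h
  exact hP ⟨u, hu⟩

/-- `c` is a chain of `k` steps. -/
def IsChain (P : TreePair n) (k : ℕ) (c : ℕ → Node n) : Prop := ∀ j < k, P.Step (c j) (c (j + 1))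

/-- `v` is reached from `u` in `k` steps. -/
def Reach (P : TreePair n) (k : ℕ) (u v : Node n) : Prop :=
  ∃ c, c 0 = u ∧ c k = v ∧ P.IsChain k c

theorem Reach.zero (u : Node n) : P.Reach 0 u u :=
  ⟨fun _ => u, rfl, rfl, fun j hj => absurd hj (Nat.not_lt_zero j)⟩

theorem reach_zero {u v : Node n} : P.Reach 0 u v ↔ u = v := by
  constructor
  · rintro ⟨c, rfl, rfl, -⟩; rfl
  · rintro rfl; exact Reach.zero u

theorem reach_succ {k : ℕ} {u v : Node n} :
    P.Reach (k + 1) u v ↔ ∃ w, P.Reach k u w ∧ P.Step w v := by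
  constructor
  · rintro ⟨c, rfl, rfl, h⟩
    exact ⟨c k, ⟨c, rfl, rfl, fun j hj => h j (by omega)⟩, h k (by omega)⟩
  · rintro ⟨w, ⟨c, rfl, rfl, h⟩, hs⟩
    refine ⟨fun j => if j ≤ k then c j else v, by simp, by simp, fun j hj => ?_⟩
    rcases Nat.lt_succ_iff_lt_or_eq.1 hj with hj | rfl
    · simpa [show j ≤ k by omega, show j + 1 ≤ k by omega] using h j hj
    · simpa using hs

theorem Reach.single {u v : Node n} (h : P.Step u v) : P.Reach 1 u v :=
  reach_succ.2 ⟨u, Reach.zero u, h⟩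

theorem Reach.trans {k l : ℕ} {u v w : Node n} (h : P.Reach k u v) (h' : P.Reach l v w) :
    P.Reach (k + l) u w := by
  induction l generalizing w with
  | zero => rw [reach_zero] at h'; exact h' ▸ h
  | succ l ih =>
    obtain ⟨x, hx, hs⟩ := reach_succ.1 h'
    exact reach_succ.2 ⟨x, ih hx, hs⟩

theorem reach_succ' {k : ℕ} {u v : Node n} :
    P.Reach (k + 1) u v ↔ ∃ w, P.Step u w ∧ P.Reach k w v := by
  constructor
  · rintro ⟨c, rfl, rfl, h⟩
    exact ⟨c 1, h 0 (by omega), fun j => c (j + 1), rfl, rfl, fun j hj => h _ (by omega)⟩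
  · rintro ⟨w, hs, h⟩
    rw [add_comm]
    exact (Reach.single hs).trans h

theorem reach_inv {k : ℕ} {u v : Node n} : P.inv.Reach k u v ↔ P.Reach k v u := by
  induction k generalizing u v with
  | zero => rw [reach_zero, reach_zero]; exact eq_comm
  | succ k ih =>
    rw [reach_succ, reach_succ']
    simp only [ih, step_inv, and_comm]

theorem transGen_iff {u v : Node n} :
    Relation.TransGen P.Step u v ↔ ∃ k, 0 < k ∧ P.Reach k u v := by
  constructor
  · intro h
    induction h with
    | single h => exact ⟨1, one_pos, Reach.single h⟩
    | tail _ h ih =>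
      obtain ⟨k, -, hr⟩ := ih
      exact ⟨k + 1, k.succ_pos, reach_succ.2 ⟨_, hr, h⟩⟩
  · rintro ⟨k, hk, h⟩
    induction k generalizing v with
    | zero => exact absurd hk (lt_irrefl 0)
    | succ k ih =>
      obtain ⟨w, hw, hs⟩ := reach_succ.1 h
      rcases k.eq_zero_or_pos with rfl | hk'
      · rw [reach_zero] at hw
        exact hw ▸ Relation.TransGen.single hs
      · exact (ih hk' hw).tail hs

theorem Reach.pre (hP : P.Represents α) {k : ℕ} {u v : Node n} (h : P.Reach k u v) :
    Pre (α ^ k) u v := by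
  induction k generalizing v with
  | zero => rw [reach_zero] at h; exact h ▸ Pre.one u
  | succ k ih =>
    obtain ⟨w, hw, hs⟩ := reach_succ.1 h
    rw [pow_succ']
    exact (hs.pre hP).mul (ih hw)

theorem Reach.dom {k : ℕ} (hk : 0 < k) {u v : Node n} (h : P.Reach k u v) : u ∈ P.dom.leaves := by
  obtain ⟨c, rfl, rfl, h⟩ := h
  exact (h 0 hk).dom

theorem Reach.ran {k : ℕ} (hk : 0 < k) {u v : Node n} (h : P.Reach k u v) : v ∈ P.ran.leaves :=
  (reach_inv.2 h).dom hk

theorem Reach.right_unique {k : ℕ} {u v w : Node n} (h : P.Reach k u v) (h' : P.Reach k u w) :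
    v = w := by
  induction k generalizing v w with
  | zero => rw [reach_zero] at h h'; exact h.symm.trans h'
  | succ k ih =>
    obtain ⟨x, hx, hs⟩ := reach_succ.1 h
    obtain ⟨y, hy, hs'⟩ := reach_succ.1 h'
    obtain rfl := ih hx hy
    exact hs.right_unique hs'

theorem Reach.left_unique {k : ℕ} {u v w : Node n} (h : P.Reach k u w) (h' : P.Reach k v w) :
    u = v :=
  (reach_inv.2 h).right_unique (reach_inv.2 h')

/-- Following a chain backwards from `w`, there is at most one place where it can no longer be
continued. -/
theorem Reach.start_unique {k l : ℕ} {u v w : Node n} (h : P.Reach k u w) (h' : P.Reach l v w)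
    (hu : u ∉ P.ran.leaves) (hv : v ∉ P.ran.leaves) : u = v ∧ k = l := by
  have key : ∀ {k l : ℕ} {u v w : Node n}, P.Reach k u w → P.Reach l v w →
      u ∉ P.ran.leaves → k ≤ l → k = l := by
    intro k l u v w h h' hu hkl
    induction k generalizing l w with
    | zero =>
      rw [reach_zero] at h
      subst h
      by_contra hl
      exact hu (h'.ran (by omega))
    | succ k ih =>
      obtain ⟨l, rfl⟩ : ∃ l', l = l' + 1 := ⟨l - 1, by omega⟩
      obtain ⟨x, hx, hs⟩ := reach_succ.1 h
      obtain ⟨y, hy, hs'⟩ := reach_succ.1 h'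
      obtain rfl := hs.left_unique hs'
      rw [ih hx hy (by omega)]
  have hkl : k = l := by
    rcases le_total k l with hkl | hkl
    · exact key h h' hu hkl
    · exact (key h' h hv hkl).symm
  subst hkl
  exact ⟨h.left_unique h', rfl⟩

/-- A leaf of the domain tree is periodic or its chain leaves the domain tree. -/
theorem periodic_or_exists_end {u : Node n} (hu : u ∈ P.dom.leaves) :
    (∃ k, 0 < k ∧ P.Reach k u u) ∨ ∃ k, 0 < k ∧ ∃ v ∉ P.dom.leaves, P.Reach k u v := by
  by_contra hcon
  push Not at hcon
  obtain ⟨h1, h2⟩ := hcon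
  have hall : ∀ k, ∃ v, v ∈ P.dom.leaves ∧ P.Reach k u v := by
    intro k
    induction k with
    | zero => exact ⟨u, hu, Reach.zero u⟩
    | succ k ih =>
      obtain ⟨v, hv, hr⟩ := ih
      obtain ⟨w, hw⟩ := exists_step hv
      have hr' := reach_succ.2 ⟨v, hr, hw⟩
      exact ⟨w, by_contra fun h => h2 (k + 1) k.succ_pos w h hr', hr'⟩
  choose c hc hr using hall
  obtain ⟨i, j, hne, he⟩ := Finite.exists_ne_map_eq_of_infinite
    (fun k => (⟨c k, hc k⟩ : {u // u ∈ P.dom.leaves}))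
  have he : c i = c j := congrArg Subtype.val he
  have key : ∀ {i j}, i < j → c i = c j → False := by
    intro i j hij he
    obtain ⟨k, rfl⟩ := Nat.exists_eq_add_of_lt hij
    have hj : P.Reach (k + 1 + i) u (c i) := by
      rw [he, show k + 1 + i = i + k + 1 by omega]; exact hr _
    obtain ⟨v, hv, hrv⟩ : ∃ v, P.Reach (k + 1) u v ∧ P.Reach i v (c i) := by
      obtain ⟨d, rfl, hd, h⟩ := hj
      refine ⟨d (k + 1), ⟨d, rfl, rfl, fun j hj => h j (by omega)⟩, fun j => d (k + 1 + j), rfl, hd,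
        fun j hj => h _ (by omega)⟩
    exact h1 (k + 1) k.succ_pos ((hr i).left_unique hrv ▸ hv)
  rcases lt_or_gt_of_ne hne with h | h
  · exact key h he
  · exact key h he.symm

theorem periodic_or_exists_start {v : Node n} (hv : v ∈ P.ran.leaves) :
    (∃ k, 0 < k ∧ P.Reach k v v) ∨ ∃ k, 0 < k ∧ ∃ u ∉ P.ran.leaves, P.Reach k u v := by
  rcases periodic_or_exists_end (P := P.inv) hv with ⟨k, hk, h⟩ | ⟨k, hk, u, hu, h⟩
  · exact Or.inl ⟨k, hk, reach_inv.1 h⟩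
  · exact Or.inr ⟨k, hk, u, hu, reach_inv.1 h⟩

theorem isRepeller_inv {u : Node n} : P.inv.IsRepeller u ↔ P.IsAttractor u := by
  simp only [IsRepeller, IsAttractor, transGen_iff, reach_inv]
  rfl

theorem isAttractor_inv {u : Node n} : P.inv.IsAttractor u ↔ P.IsRepeller u := by
  simp only [IsRepeller, IsAttractor, transGen_iff, reach_inv]
  rfl

theorem isRevealing_inv : P.inv.IsRevealing ↔ P.IsRevealing := by
  simp only [IsRevealing, isRepeller_inv, isAttractor_inv]
  exact and_comm

theorem isSource_inv {u : Node n} : P.inv.IsSource u ↔ P.IsSink u := by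
  simp only [IsSource, isRepeller_inv]
  rfl

theorem isSink_inv {u : Node n} : P.inv.IsSink u ↔ P.IsSource u := by
  rw [← isSource_inv, inv_inv]

/-! ### Expansions of tree pairs -/

variable [Nontrivial (Fin n)]

/-- Simple expansion: a caret is attached at a leaf of the domain tree and at its image. -/
theorem exists_expand (hP : P.Represents α) {u v : Node n} (h : P.Step u v) :
    ∃ P' : TreePair n, P'.Represents α ∧ (∀ p, p ∈ P'.dom.inner ↔ p = u ∨ p ∈ P.dom.inner) ∧
      ∀ p, p ∈ P'.ran.inner ↔ p = v ∨ p ∈ P.ran.inner := by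
  classical
  obtain ⟨A, hA⟩ := NTree.exists_expand h.dom
  obtain ⟨B, hB⟩ := NTree.exists_expand h.ran
  have hA' : ∀ w, w ∈ A.leaves ↔ (w ≠ u ∧ w ∈ P.dom.leaves) ∨ ∃ a, u ++ [a] = w := by
    intro w; simp [hA]
  have hB' : ∀ w, w ∈ B.leaves ↔ (w ≠ v ∧ w ∈ P.ran.leaves) ∨ ∃ a, v ++ [a] = w := by
    intro w; simp [hB]
  have hex : ∀ p : {w // w ∈ A.leaves}, ∃ q : {w // w ∈ B.leaves}, Pre α p.1 q.1 := by
    rintro ⟨w, hw⟩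
    rcases (hA' w).1 hw with ⟨hwu, hw'⟩ | ⟨a, rfl⟩
    · obtain ⟨w', hs⟩ := exists_step hw'
      refine ⟨⟨w', (hB' w').2 (Or.inl ⟨?_, hs.ran⟩)⟩, hs.pre hP⟩
      rintro rfl
      exact hwu (hs.left_unique h)
    · exact ⟨⟨v ++ [a], (hB' _).2 (Or.inr ⟨a, rfl⟩)⟩, (h.pre hP).append [a]⟩
  choose F hF using hex
  have hbij : Function.Bijective F := by
    constructor
    · intro p q e
      have h1 := (hF p).inv
      rw [e] at h1
      exact Subtype.ext (h1.right_unique (hF q).inv)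
    · rintro ⟨w, hw⟩
      have hw' : ∃ p : {w // w ∈ A.leaves}, Pre α p.1 w := by
        rcases (hB' w).1 hw with ⟨hwu, hw'⟩ | ⟨a, rfl⟩
        · obtain ⟨w', hs⟩ := exists_step_to hw'
          refine ⟨⟨w', (hA' w').2 (Or.inl ⟨?_, hs.dom⟩)⟩, hs.pre hP⟩
          rintro rfl
          exact hwu (hs.right_unique h)
        · exact ⟨⟨u ++ [a], (hA' _).2 (Or.inr ⟨a, rfl⟩)⟩, (h.pre hP).append [a]⟩
      obtain ⟨p, hp⟩ := hw'
      exact ⟨p, Subtype.ext ((hF p).right_unique hp)⟩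
  refine ⟨⟨A, B, Equiv.ofBijective F hbij⟩, fun p x => hF p x, ?_, ?_⟩
  · intro p
    change p ∈ A.inner ↔ _
    rw [NTree.inner_of_expand h.dom hA, Finset.mem_insert]
  · intro p
    change p ∈ B.inner ↔ _
    rw [NTree.inner_of_expand h.ran hB, Finset.mem_insert]

/-- The domain tree of a pair can be enlarged to any larger tree; the range tree then acquires the
images of the new interior nodes. -/
theorem exists_expand_finset (hP : P.Represents α) (E : Finset (Node n))
    (hE : ∀ p ∈ E, ∀ q, q <+: p → q ≠ p → q ∈ E ∨ q ∈ P.dom.inner) :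
    ∃ P' : TreePair n, P'.Represents α ∧ (∀ p, p ∈ P'.dom.inner ↔ p ∈ P.dom.inner ∨ p ∈ E) ∧
      ∀ q, q ∈ P'.ran.inner ↔ q ∈ P.ran.inner ∨ ∃ p ∈ E, p ∉ P.dom.inner ∧ Pre α p q := by
  classical
  induction hk : E.card generalizing E P with
  | zero =>
    obtain rfl := Finset.card_eq_zero.1 hk
    exact ⟨P, hP, by simp, by simp⟩
  | succ k ih =>
    have hne : E.Nonempty := Finset.card_pos.1 (by omega)
    -- all proper ancestors of a shortest new node are interior, so that it is interior or a leaf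
    obtain ⟨e, he, hmin⟩ := E.exists_min_image List.length hne
    have hpre : ∀ q, q <+: e → q ≠ e → q ∈ P.dom.inner := by
      intro q hq hqe
      refine (hE e he q hq hqe).resolve_left fun hqE => ?_
      exact hqe (hq.eq_of_length (le_antisymm hq.length_le (hmin q hqE)))
    by_cases hei : e ∈ P.dom.inner
    · obtain ⟨P', h1, h2, h3⟩ := ih hP (E.erase e) (fun p hp q hq hqp => by
        rcases hE p (Finset.mem_of_mem_erase hp) q hq hqp with h | h
        · by_cases hqe : q = e
          · exact Or.inr (hqe ▸ hei)
          · exact Or.inl (Finset.mem_erase.2 ⟨hqe, h⟩)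
        · exact Or.inr h) (by rw [Finset.card_erase_of_mem he]; omega)
      refine ⟨P', h1, fun p => ?_, fun q => ?_⟩
      · rw [h2, Finset.mem_erase]
        by_cases hpe : p = e
        · subst hpe; simp [hei]
        · simp [hpe]
      · rw [h3]
        refine or_congr_right ⟨fun ⟨p, hp, h⟩ => ⟨p, Finset.mem_of_mem_erase hp, h⟩,
          fun ⟨p, hp, h⟩ => ⟨p, Finset.mem_erase.2 ⟨?_, hp⟩, h⟩⟩
        rintro rfl
        exact h.1 hei
    · have hleaf : e ∈ P.dom.leaves := NTree.mem_leaves_iff.2 ⟨hei, hpre⟩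
      obtain ⟨v, hv⟩ := exists_step hleaf
      obtain ⟨P₁, hP₁, hd, hr⟩ := exists_expand hP hv
      obtain ⟨P', h1, h2, h3⟩ := ih hP₁ (E.erase e) (fun p hp q hq hqp => by
        rw [hd]
        rcases hE p (Finset.mem_of_mem_erase hp) q hq hqp with h | h
        · by_cases hqe : q = e
          · exact Or.inr (Or.inl hqe)
          · exact Or.inl (Finset.mem_erase.2 ⟨hqe, h⟩)
        · exact Or.inr (Or.inr h)) (by rw [Finset.card_erase_of_mem he]; omega)
      refine ⟨P', h1, fun p => ?_, fun q => ?_⟩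
      · rw [h2, hd, Finset.mem_erase]
        by_cases hpe : p = e
        · subst hpe; simp [he]
        · simp [hpe]
      · rw [h3, hr]
        constructor
        · rintro ((rfl | h) | ⟨p, hp, h, h'⟩)
          · exact Or.inr ⟨e, he, hei, hv.pre hP⟩
          · exact Or.inl h
          · exact Or.inr ⟨p, Finset.mem_of_mem_erase hp, fun h0 => h ((hd p).2 (Or.inr h0)), h'⟩
        · rintro (h | ⟨p, hp, h, h'⟩)
          · exact Or.inl (Or.inr h)
          · by_cases hpe : p = e
            · subst hpe
              exact Or.inl (Or.inl (h'.right_unique (hv.pre hP)))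
            · refine Or.inr ⟨p, Finset.mem_erase.2 ⟨hpe, hp⟩, fun h0 => ?_, h'⟩
              rcases (hd p).1 h0 with h0 | h0
              · exact hpe h0
              · exact h h0

end TreePair

end

/-! ### Existence of revealing pairs -/

section

namespace TreePair

variable {n : ℕ} {P : TreePair n} {α : V n}

theorem isDomRoot_iff {w : Node n} : P.IsDomRoot w ↔ w ∈ P.ran.leaves ∧ w ∈ P.dom.inner := by
  rw [NTree.mem_inner]; rfl

theorem isRanRoot_iff {w : Node n} : P.IsRanRoot w ↔ w ∈ P.dom.leaves ∧ w ∈ P.ran.inner := by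
  rw [NTree.mem_inner]; rfl

/-- The number of interior nodes of one tree that are not interior nodes of the other. -/
noncomputable def diffCard (P : TreePair n) : ℕ := by
  classical exact (symmDiff P.dom.inner P.ran.inner).card

/-- The number of components of the differences of the two trees. -/
noncomputable def rootCard (P : TreePair n) : ℕ := by
  classical exact
    (P.ran.leaves.filter (· ∈ P.dom.inner)).card + (P.dom.leaves.filter (· ∈ P.ran.inner)).card

theorem diffCard_inv (P : TreePair n) : P.inv.diffCard = P.diffCard := by
  unfold diffCard
  rw [symmDiff_comm]; rfl

theorem rootCard_inv (P : TreePair n) : P.inv.rootCard = P.rootCard := by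
  unfold rootCard
  rw [add_comm]; rfl

variable [Nontrivial (Fin n)]

/-- A component of (domain) − (range) without repeller can be removed by rolling: a copy of it is
attached at each leaf of the chain `c 0, …, c k` that ends at its root `c k = w`. The copies at
`c 1, …, c k` then belong to both trees, and only the copy at `c 0` remains in the difference. Since
`c 0` is not below `w`, either it is an interior node of the range tree and the difference of the
trees becomes smaller, or this copy enlarges an existing component and there are fewer
components. -/
theorem exists_smaller (hP : P.Represents α) {w : Node n} (hw : P.IsDomRoot w)
    (hno : ∀ u, P.IsRepeller u → ¬ w <+: u) :
    ∃ P' : TreePair n, P'.Represents α ∧ (P'.diffCard < P.diffCard ∨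
      P'.diffCard ≤ P.diffCard ∧ P'.rootCard < P.rootCard) := by
  classical
  obtain ⟨hwB, hwA⟩ := isDomRoot_iff.1 hw
  have hwd : w ∉ P.dom.leaves := fun h =>
    NTree.not_inner_of_leaf_prefix h List.prefix_rfl hwA
  have hwI : ∀ t, w ++ t ∉ P.ran.inner := fun t =>
    NTree.not_inner_of_leaf_prefix hwB (List.prefix_append _ _)
  obtain ⟨k, hk, u, hu, hr⟩ : ∃ k, 0 < k ∧ ∃ u ∉ P.ran.leaves, P.Reach k u w := by
    rcases periodic_or_exists_start hwB with ⟨k, hk, h⟩ | h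
    · exact absurd (h.dom hk) hwd
    · exact h
  have hwu : ¬ w <+: u := fun h => hno u ⟨hu, w, transGen_iff.2 ⟨k, hk, hr⟩, hwd, h⟩ h
  obtain ⟨c, rfl, rfl, hc⟩ := hr
  have cdom : ∀ j < k, c j ∈ P.dom.leaves := fun j hj => (hc j hj).dom
  have cran : ∀ j < k, c (j + 1) ∈ P.ran.leaves := fun j hj => (hc j hj).ran
  -- the interior nodes of the component, relative to its root
  let C : Finset (Node n) :=
    (P.dom.inner.filter fun p => c k <+: p).image fun p => p.drop (c k).length
  have hC : ∀ t, t ∈ C ↔ c k ++ t ∈ P.dom.inner := by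
    intro t
    simp only [C, Finset.mem_image, Finset.mem_filter]
    constructor
    · rintro ⟨_, ⟨h, t, rfl⟩, rfl⟩
      simpa using h
    · exact fun h => ⟨_, ⟨h, List.prefix_append _ _⟩, by simp⟩
  -- the interior nodes of its copies at the leaves of the chain
  let E : Finset (Node n) := (Finset.range k ×ˢ C).image fun p => c p.1 ++ p.2
  have hE : ∀ p, p ∈ E ↔ ∃ j < k, ∃ t ∈ C, p = c j ++ t := by
    intro p
    simp only [E, Finset.mem_image, Finset.mem_product, Finset.mem_range, Prod.exists]
    constructor
    · rintro ⟨j, t, ⟨hj, ht⟩, rfl⟩; exact ⟨j, hj, t, ht, rfl⟩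
    · rintro ⟨j, hj, t, ht, rfl⟩; exact ⟨j, t, ⟨hj, ht⟩, rfl⟩
  obtain ⟨P', hP', hA, hB⟩ := exists_expand_finset hP E (by
    intro p hp q hq hqp
    obtain ⟨j, hj, t, ht, rfl⟩ := (hE p).1 hp
    rcases NTree.inner_or_below_leaf P.dom q with h | ⟨v, hv, hvq⟩
    · exact Or.inr h
    · have hv' : v = c j := by
        rcases List.prefix_or_prefix_of_prefix (hvq.trans hq) (List.prefix_append (c j) t) with h | h
        · exact NTree.leaf_eq_of_prefix hv (cdom j hj) h
        · exact (NTree.leaf_eq_of_prefix (cdom j hj) hv h).symm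
      subst hv'
      obtain ⟨s, rfl⟩ := hvq
      refine Or.inl ((hE _).2 ⟨j, hj, s, (hC s).2 ?_, rfl⟩)
      exact NTree.inner_of_prefix ((hC t).1 ht)
        ((List.prefix_append_right_inj _).2 ((List.prefix_append_right_inj _).1 hq)))
  have hA' : ∀ p, p ∈ P'.dom.inner ↔ p ∈ P.dom.inner ∨ ∃ j < k, ∃ t ∈ C, p = c j ++ t :=
    fun p => by rw [hA, hE]
  have hB' : ∀ p, p ∈ P'.ran.inner ↔ p ∈ P.ran.inner ∨ ∃ j < k, ∃ t ∈ C, p = c (j + 1) ++ t := by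
    intro q
    rw [hB]
    refine or_congr_right ⟨?_, ?_⟩
    · rintro ⟨p, hp, -, hpq⟩
      obtain ⟨j, hj, t, ht, rfl⟩ := (hE p).1 hp
      exact ⟨j, hj, t, ht, hpq.right_unique (((hc j hj).pre hP).append t)⟩
    · rintro ⟨j, hj, t, ht, rfl⟩
      exact ⟨c j ++ t, (hE _).2 ⟨j, hj, t, ht, rfl⟩,
        NTree.not_inner_of_leaf_prefix (cdom j hj) (List.prefix_append _ _),
        ((hc j hj).pre hP).append t⟩
  have hlast : ∀ t ∈ C, c k ++ t ∈ P'.ran.inner := fun t ht =>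
    (hB' _).2 (Or.inr ⟨k - 1, by omega, t, ht, by rw [Nat.sub_add_cancel hk]⟩)
  have hnil : ([] : Node n) ∈ C := (hC []).2 (by simpa using hwA)
  -- of the copies, only the one at the start of the chain contributes to the new difference
  have hsub : symmDiff P'.dom.inner P'.ran.inner ⊆
      (symmDiff P.dom.inner P.ran.inner \ C.image (c k ++ ·)) ∪
        (C.image (c 0 ++ ·) \ P.ran.inner) := by
    intro p hp
    simp only [Finset.mem_symmDiff, Finset.mem_union, Finset.mem_sdiff, Finset.mem_image] at hp ⊢
    rcases hp with ⟨h1, h2⟩ | ⟨h1, h2⟩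
    · rcases (hA' p).1 h1 with h | ⟨j, hj, t, ht, rfl⟩
      · refine Or.inl ⟨Or.inl ⟨h, fun h' => h2 ((hB' p).2 (Or.inl h'))⟩, ?_⟩
        rintro ⟨t, ht, rfl⟩
        exact h2 (hlast t ht)
      · rcases j with _ | j
        · exact Or.inr ⟨⟨t, ht, rfl⟩, fun h => h2 ((hB' _).2 (Or.inl h))⟩
        · exact absurd ((hB' _).2 (Or.inr ⟨j, by omega, t, ht, rfl⟩)) h2
    · rcases (hB' p).1 h1 with h | ⟨j, hj, t, ht, rfl⟩
      · refine Or.inl ⟨Or.inr ⟨h, fun h' => h2 ((hA' p).2 (Or.inl h'))⟩, ?_⟩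
        rintro ⟨t, ht, rfl⟩
        exact hwI t h
      · rcases Nat.lt_or_ge (j + 1) k with h | h
        · exact absurd ((hA' _).2 (Or.inr ⟨j + 1, h, t, ht, rfl⟩)) h2
        · obtain rfl : j + 1 = k := by omega
          exact absurd ((hA' _).2 (Or.inl ((hC t).1 ht))) h2
  have hCsub : C.image (c k ++ ·) ⊆ symmDiff P.dom.inner P.ran.inner := by
    intro p hp
    obtain ⟨t, ht, rfl⟩ := Finset.mem_image.1 hp
    exact Finset.mem_symmDiff.2 (Or.inl ⟨(hC t).1 ht, hwI t⟩)
  have hcard : ∀ p : Node n, (C.image (p ++ ·)).card = C.card := fun p =>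
    Finset.card_image_of_injective _ (List.append_right_injective p)
  have h1 := (Finset.card_le_card hsub).trans (Finset.card_union_le _ _)
  rw [Finset.card_sdiff_of_subset hCsub, hcard] at h1
  have h2 := Finset.card_le_card hCsub
  rw [hcard] at h2
  have h3 : (C.image (c 0 ++ ·) \ P.ran.inner).card ≤ C.card :=
    (Finset.card_le_card Finset.sdiff_subset).trans (hcard _).le
  have hle : P'.diffCard ≤ P.diffCard := by
    unfold diffCard; omega
  refine ⟨P', hP', ?_⟩
  by_cases hui : c 0 ∈ P.ran.inner
  · left
    have h4 : (C.image (c 0 ++ ·) \ P.ran.inner).card < C.card := by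
      rw [← hcard (c 0)]
      refine Finset.card_lt_card (Finset.ssubset_iff_subset_ne.2 ⟨Finset.sdiff_subset, fun h => ?_⟩)
      have : c 0 ∈ C.image (c 0 ++ ·) := Finset.mem_image.2 ⟨[], hnil, by simp⟩
      rw [← h] at this
      exact (Finset.mem_sdiff.1 this).2 hui
    unfold diffCard; omega
  · refine Or.inr ⟨hle, ?_⟩
    obtain ⟨e, he, heu⟩ := (NTree.inner_or_below_leaf P.ran (c 0)).resolve_left hui
    have heu' : e ≠ c 0 := fun h => hu (h ▸ he)
    -- no component is created: the copy at the start of the chain lies below a leaf `e` of the range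
    -- tree, and the root of the removed component disappears
    have s1 : P'.ran.leaves.filter (· ∈ P'.dom.inner) ⊆
        (P.ran.leaves.filter (· ∈ P.dom.inner)).erase (c k) := by
      intro b hb
      simp only [Finset.mem_filter, NTree.mem_leaves_iff (T := P'.ran)] at hb
      obtain ⟨⟨hb1, hb2⟩, hb3⟩ := hb
      have hbA : b ∈ P.dom.inner := by
        refine ((hA' b).1 hb3).resolve_right ?_
        rintro ⟨j, hj, t, ht, rfl⟩
        rcases j with _ | j
        · have := hb2 e (heu.trans (List.prefix_append _ _)) (by
            rintro rfl
            exact heu' (heu.eq_of_length (le_antisymm heu.length_le (by simp))))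
          rcases (hB' e).1 this with h | ⟨j, hj, s, hs, rfl⟩
          · exact NTree.not_inner_of_leaf_prefix he List.prefix_rfl h
          · rw [← NTree.leaf_eq_of_prefix (cran j hj) he (List.prefix_append _ _)] at heu heu'
            rcases Nat.lt_or_ge (j + 1) k with h | h
            · exact heu' (NTree.leaf_eq_of_prefix (cdom _ h) (cdom 0 hk) heu)
            · obtain rfl : j + 1 = k := by omega
              exact hwu heu
        · exact hb1 ((hB' _).2 (Or.inr ⟨j, by omega, t, ht, rfl⟩))
      refine Finset.mem_erase.2 ⟨?_, Finset.mem_filter.2 ⟨NTree.mem_leaves_iff.2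
        ⟨fun h => hb1 ((hB' b).2 (Or.inl h)), fun p hp hpb => ?_⟩, hbA⟩⟩
      · rintro rfl
        exact hb1 (by simpa using hlast [] hnil)
      · rcases (hB' p).1 (hb2 p hp hpb) with h | ⟨j, hj, t, ht, rfl⟩
        · exact h
        · exfalso
          rcases Nat.lt_or_ge (j + 1) k with h | h
          · exact NTree.not_inner_of_leaf_prefix (cdom _ h)
              ((List.prefix_append _ _).trans hp) hbA
          · obtain rfl : j + 1 = k := by omega
            obtain ⟨s, rfl⟩ := hp
            rw [List.append_assoc] at hbA hb1
            exact hb1 (hlast _ ((hC _).2 hbA))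
    have s2 : P'.dom.leaves.filter (· ∈ P'.ran.inner) ⊆
        P.dom.leaves.filter (· ∈ P.ran.inner) := by
      intro b hb
      simp only [Finset.mem_filter, NTree.mem_leaves_iff (T := P'.dom)] at hb
      obtain ⟨⟨hb1, hb2⟩, hb3⟩ := hb
      have hbB : b ∈ P.ran.inner := by
        refine ((hB' b).1 hb3).resolve_right ?_
        rintro ⟨j, hj, t, ht, rfl⟩
        rcases Nat.lt_or_ge (j + 1) k with h | h
        · exact hb1 ((hA' _).2 (Or.inr ⟨j + 1, h, t, ht, rfl⟩))
        · obtain rfl : j + 1 = k := by omega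
          exact hb1 ((hA' _).2 (Or.inl ((hC t).1 ht)))
      refine Finset.mem_filter.2 ⟨NTree.mem_leaves_iff.2
        ⟨fun h => hb1 ((hA' b).2 (Or.inl h)), fun p hp hpb => ?_⟩, hbB⟩
      rcases (hA' p).1 (hb2 p hp hpb) with h | ⟨j, hj, t, ht, rfl⟩
      · exact h
      · exfalso
        rcases j with _ | j
        · exact hui (NTree.inner_of_prefix hbB ((List.prefix_append _ _).trans hp))
        · exact NTree.not_inner_of_leaf_prefix (cran j (by omega))
            ((List.prefix_append _ _).trans hp) hbB
    have hroot : c k ∈ P.ran.leaves.filter (· ∈ P.dom.inner) := Finset.mem_filter.2 ⟨hwB, hwA⟩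
    have h4 := Finset.card_le_card s1
    rw [Finset.card_erase_of_mem hroot] at h4
    have h5 := Finset.card_le_card s2
    have h6 := Finset.card_pos.2 ⟨_, hroot⟩
    unfold rootCard; omega

/-- A pair representing `α` with the smallest difference of the two trees, and among these with the
fewest components, is revealing. -/
theorem exists_isRevealingFor (α : V n) : ∃ P : TreePair n, P.IsRevealingFor α := by
  let S : Set (ℕ ×ₗ ℕ) := {x | ∃ P : TreePair n, P.Represents α ∧ x = toLex (P.diffCard, P.rootCard)}
  obtain ⟨P₀, hP₀⟩ := α.2
  obtain ⟨-, ⟨P, hP, rfl⟩, hmin⟩ :=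
    (wellFounded_lt (α := ℕ ×ₗ ℕ)).has_min S ⟨_, P₀, hP₀, rfl⟩
  have hmin' : ∀ P' : TreePair n, P'.Represents α → ¬ (P'.diffCard < P.diffCard ∨
      P'.diffCard ≤ P.diffCard ∧ P'.rootCard < P.rootCard) := by
    intro P' hP' h
    refine hmin _ ⟨P', hP', rfl⟩ (Prod.Lex.toLex_lt_toLex.2 ?_)
    rcases h with h | ⟨h, h'⟩
    · exact Or.inl h
    · rcases h.lt_or_eq with h | h
      · exact Or.inl h
      · exact Or.inr ⟨h, h'⟩
  refine ⟨P, ⟨fun w hw => ?_, fun w hw => ?_⟩, hP⟩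
  · by_contra hno
    push Not at hno
    obtain ⟨P', hP', h⟩ := exists_smaller hP hw hno
    exact hmin' P' hP' h
  · by_contra hno
    push Not at hno
    obtain ⟨P', hP', h⟩ := exists_smaller hP.inv (w := w) hw
      (fun u hu => hno u (isRepeller_inv.1 hu))
    refine hmin' P'.inv (by simpa using hP'.inv) ?_
    rwa [diffCard_inv, rootCard_inv, ← diffCard_inv P, ← rootCard_inv P]

end TreePair

end

/-! ### Contractions of cones -/

section

variable {n : ℕ}

/-- The power `Γ ⋯ Γ` of a word. -/
def wordPow (Γ : Node n) : ℕ → Node n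
  | 0 => []
  | j + 1 => wordPow Γ j ++ Γ

theorem le_length_wordPow {Γ : Node n} (hΓ : Γ ≠ []) (j : ℕ) : j ≤ (wordPow Γ j).length := by
  induction j with
  | zero => exact Nat.zero_le _
  | succ j ih =>
    have := List.length_pos_iff.2 hΓ
    simp only [wordPow, List.length_append]; omega

/-- `f` maps the cone under `w` onto the cone under its descendant `w Γ` by replacing the
prefix. -/
def Contracts (f : V n) (w Γ : Node n) : Prop := Γ ≠ [] ∧ Pre f w (w ++ Γ)

variable [Nontrivial (Fin n)]

/-- The periodic path `Γ Γ Γ ⋯`. -/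
noncomputable def perPath (Γ : Node n) : Cantor n := fun i =>
  Γ.getD (i % Γ.length) (Classical.arbitrary _)

theorem append_perPath (Γ : Node n) : append Γ (perPath Γ) = perPath Γ := by
  have hlt : ∀ (u : Node n) (x : Cantor n) (i : ℕ), i < u.length →
      append u x i = u.getD i (Classical.arbitrary _) := by
    intro u x
    induction u with
    | nil => intro i hi; simp at hi
    | cons a u ih =>
      intro i hi
      cases i with
      | zero => rfl
      | succ i =>
        rw [List.getD_cons_succ]
        exact ih i (by simpa using hi)
  funext i
  by_cases hi : i < Γ.length
  · rw [hlt _ _ _ hi]; simp [perPath, Nat.mod_eq_of_lt hi]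
  · obtain ⟨k, rfl⟩ := Nat.exists_eq_add_of_le (not_lt.1 hi)
    rw [append_apply_add]; simp [perPath]

/-- The fixed point `w Γ Γ Γ ⋯` of a contraction of the cone under `w` onto the cone under
`w Γ`. -/
noncomputable def limPt (w Γ : Node n) : Cantor n := append w (perPath Γ)

namespace Contracts

variable {f : V n} {w Γ : Node n}

theorem smul_limPt (h : Contracts f w Γ) : f • limPt w Γ = limPt w Γ := by
  rw [limPt, h.2, append_append, append_perPath]

omit [Nontrivial (Fin n)] in
theorem pow_pre (h : Contracts f w Γ) (j : ℕ) : Pre (f ^ j) w (w ++ wordPow Γ j) := by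
  induction j with
  | zero => rw [wordPow, List.append_nil, pow_zero]; exact Pre.one w
  | succ j ih =>
    rw [pow_succ']
    have := h.2.append (wordPow Γ j)
    have e : ∀ j, Γ ++ wordPow Γ j = wordPow Γ (j + 1) := by
      intro j
      induction j with
      | zero => simp [wordPow]
      | succ j ih => rw [wordPow, ← List.append_assoc, ih]; rfl
    rw [List.append_assoc, e] at this
    exact this.mul ih

theorem pow_smul_limPt (h : Contracts f w Γ) (j : ℕ) : f ^ j • limPt w Γ = limPt w Γ := by
  induction j with
  | zero => rw [pow_zero, one_smul]
  | succ j ih => rw [pow_succ, mul_smul, h.smul_limPt, ih]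

theorem limPt_mem (h : Contracts f w Γ) (j : ℕ) : limPt w Γ ∈ cone (w ++ wordPow Γ j) := by
  rw [← h.pow_smul_limPt j]
  exact (h.pow_pre j).smul_mem (append_mem_cone _ _)

theorem limPt_mem_cone_append (h : Contracts f w Γ) : limPt w Γ ∈ cone (w ++ Γ) := by
  simpa [wordPow] using h.limPt_mem 1

theorem cone_subset_of_isOpen (h : Contracts f w Γ) {O : Set (Cantor n)} (hO : IsOpen O)
    (hp : limPt w Γ ∈ O) : ∃ j, ∀ i, j ≤ i → cone (w ++ wordPow Γ i) ⊆ O := by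
  obtain ⟨k, hk⟩ := exists_cone_subset hO hp
  refine ⟨k, fun i hi => (cone_subset_of_prefix ?_).trans hk⟩
  refine prefix_of_mem_cone (mem_cone_pre _ _) (h.limPt_mem i) ?_
  have := le_length_wordPow h.1 i
  rw [length_pre, List.length_append]; omega

theorem tendsto (h : Contracts f w Γ) {x : Cantor n} (hx : x ∈ cone w) :
    Tendsto (fun j : ℕ => f ^ j • x) atTop (𝓝 (limPt w Γ)) := by
  refine tendsto_nhds.2 fun O hO hp => ?_
  obtain ⟨j, hj⟩ := h.cone_subset_of_isOpen hO hp
  exact eventually_atTop.2 ⟨j, fun i hi => hj i hi ((h.pow_pre i).smul_mem hx)⟩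

/-- A point of the cone other than the fixed point comes from the fundamental domain. -/
theorem exists_pow_smul (h : Contracts f w Γ) {x : Cantor n} (hx : x ∈ cone w)
    (hne : x ≠ limPt w Γ) : ∃ j : ℕ, ∃ y, y ∈ cone w ∧ y ∉ cone (w ++ Γ) ∧ x = f ^ j • y := by
  have hex : ∃ j, x ∉ cone (w ++ wordPow Γ (j + 1)) := by
    by_contra hall
    push Not at hall
    obtain ⟨j, hj⟩ := h.cone_subset_of_isOpen (isOpen_compl_singleton (x := x))
      (fun e => hne (by simpa using e.symm))
    exact hj (j + 1) (by omega) (hall j) rfl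
  classical
  have hj : x ∈ cone (w ++ wordPow Γ (Nat.find hex)) := by
    rcases hf : Nat.find hex with _ | j
    · simpa [wordPow] using hx
    · by_contra hcon
      exact Nat.find_min hex (m := j) (by omega) hcon
  have hj' := Nat.find_spec hex
  set j := Nat.find hex
  obtain ⟨y, hy⟩ : x ∈ f ^ j • cone w := by rwa [(h.pow_pre j).smul_cone]
  refine ⟨j, y, hy.1, fun hyc => hj' ?_, hy.2.symm⟩
  have := (h.pow_pre j).append Γ
  rw [List.append_assoc] at this
  rw [← hy.2]
  exact this.smul_mem hyc

theorem pow_smul_ne (h : Contracts f w Γ) {x : Cantor n} (hx : x ∈ cone w)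
    (hne : x ≠ limPt w Γ) {m : ℕ} (hm : 0 < m) : f ^ m • x ≠ x := by
  intro hfix
  obtain ⟨j, y, hy, hy', rfl⟩ := h.exists_pow_smul hx hne
  have : f ^ m • y = y := by
    rw [← mul_smul, ← pow_add, add_comm, pow_add, mul_smul] at hfix
    exact smul_left_cancel _ hfix
  obtain ⟨m, rfl⟩ : ∃ k, m = k + 1 := ⟨m - 1, by omega⟩
  rw [pow_succ', mul_smul] at this
  have h2 : f ^ m • y ∈ cone w := cone_append_subset _ _ ((h.pow_pre m).smul_mem hy)
  exact hy' (this ▸ h.2.smul_mem h2)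

theorem exists_ne_limPt (h : Contracts f w Γ) {O : Set (Cantor n)} (hO : IsOpen O)
    (hp : limPt w Γ ∈ O) : ∃ x ∈ O, x ∈ cone w ∧ x ≠ limPt w Γ := by
  obtain ⟨j, hj⟩ := h.cone_subset_of_isOpen hO hp
  obtain ⟨a, b, hab⟩ := exists_pair_ne (Fin n)
  have hne : append (w ++ wordPow Γ j) (fun _ => a) ≠ append (w ++ wordPow Γ j) (fun _ => b) :=
    fun e => hab (congrFun (append_injective _ e) 0)
  by_cases e : append (w ++ wordPow Γ j) (fun _ => a) = limPt w Γ
  · exact ⟨_, hj j le_rfl (append_mem_cone _ (fun _ => b)),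
      cone_append_subset _ _ (append_mem_cone _ _), e ▸ hne.symm⟩
  · exact ⟨_, hj j le_rfl (append_mem_cone _ (fun _ => a)),
      cone_append_subset _ _ (append_mem_cone _ _), e⟩

theorem smul_ne {α : V n} {e : ℤ} (h : Contracts (α ^ e) w Γ) {x : Cantor n} (hx : x ∈ cone w)
    (hne : x ≠ limPt w Γ) {m : ℕ} (hm : 0 < m) : α ^ m • x ≠ x := by
  intro hfix
  refine h.pow_smul_ne hx hne hm ?_
  have h1 : (α ^ e) ^ m = (α ^ m) ^ e := by
    rw [← zpow_natCast, ← zpow_mul, mul_comm, zpow_mul, zpow_natCast]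
  rw [h1]
  exact (zpow_mem (show α ^ m ∈ MulAction.stabilizer (V n) x from hfix) e :)

theorem exists_fundamental (h : Contracts f w Γ) : ∃ x, x ∈ cone w ∧ x ∉ cone (w ++ Γ) := by
  obtain ⟨x, -, hx, hne⟩ := h.exists_ne_limPt isOpen_univ trivial
  obtain ⟨-, y, hy, hy', -⟩ := h.exists_pow_smul hx hne
  exact ⟨y, hy, hy'⟩

end Contracts

/-! ### Invariant sets that contain a contracted cone as soon as they meet it -/

/-- An open `α`-invariant set that contains the fixed point of each contraction by a power of `α`
whose cone it meets. -/
structure Trapping (α : V n) (Y : Set (Cantor n)) : Prop where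
  isOpen : IsOpen Y
  smul_mem_iff : ∀ x, α • x ∈ Y ↔ x ∈ Y
  limPt_mem : ∀ w Γ (e : ℤ), Contracts (α ^ e) w Γ → ∀ x ∈ cone w, x ∈ Y → limPt w Γ ∈ Y

omit [Nontrivial (Fin n)] in
theorem zpow_smul_mem_iff {α : V n} {Y : Set (Cantor n)} (h : ∀ x, α • x ∈ Y ↔ x ∈ Y) (k : ℤ)
    (x : Cantor n) : α ^ k • x ∈ Y ↔ x ∈ Y := by
  induction k with
  | zero => rw [zpow_zero, one_smul]
  | succ k ih => rw [add_comm, zpow_add, mul_smul, zpow_one, h, ih]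
  | pred k ih =>
    rw [sub_eq_neg_add, zpow_add, mul_smul, zpow_neg_one, ← h, smul_inv_smul, ih]

namespace Trapping

variable {α : V n} {Y : Set (Cantor n)}

theorem zpow_smul_mem_iff (h : Trapping α Y) (k : ℤ) (x : Cantor n) : α ^ k • x ∈ Y ↔ x ∈ Y :=
  HT.zpow_smul_mem_iff h.smul_mem_iff k x

theorem cone_subset (h : Trapping α Y) {w Γ : Node n} {e : ℤ} (hc : Contracts (α ^ e) w Γ)
    {x : Cantor n} (hx : x ∈ cone w) (hxY : x ∈ Y) : cone w ⊆ Y := by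
  obtain ⟨j, hj⟩ := hc.cone_subset_of_isOpen h.isOpen (h.limPt_mem w Γ e hc x hx hxY)
  intro y hy
  have := hj j le_rfl ((hc.pow_pre j).smul_mem hy)
  rwa [← zpow_natCast, ← zpow_mul, h.zpow_smul_mem_iff] at this

theorem of_isClopen (hY : IsClopen Y) (h : ∀ x, α • x ∈ Y ↔ x ∈ Y) : Trapping α Y where
  isOpen := hY.isOpen
  smul_mem_iff := h
  limPt_mem w Γ e hc x hx hxY := hY.isClosed.mem_of_tendsto (hc.tendsto hx)
    (Eventually.of_forall fun j => by
      rw [← zpow_natCast, ← zpow_mul]; exact (HT.zpow_smul_mem_iff h _ _).2 hxY)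

end Trapping

/-- The set of points near which `g` is the identity. -/
def fixInterior (g : V n) : Set (Cantor n) := {x | ∀ᶠ y in 𝓝 x, g • y = y}

omit [Nontrivial (Fin n)] in
theorem eventually_smul {g : V n} {x : Cantor n} {p : Cantor n → Prop} :
    (∀ᶠ y in 𝓝 (g • x), p y) ↔ ∀ᶠ y in 𝓝 x, p (g • y) := by
  have := (Homeomorph.smul g).map_nhds_eq x
  rw [← Homeomorph.smul_apply, ← this]
  rfl

/-- Fixed points of an element of the centralizer of `α` that accumulate at the fixed point of a
contraction by a power of `α` fill a neighbourhood of it, since a nontrivial prefix replacement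
fixes at most one point. -/
theorem trapping_fixInterior {α g : V n} (hg : Commute g α) : Trapping α (fixInterior g) where
  isOpen := isOpen_setOfPred_eventually_nhds
  smul_mem_iff x := by
    change (∀ᶠ y in 𝓝 (α • x), g • y = y) ↔ ∀ᶠ y in 𝓝 x, g • y = y
    rw [eventually_smul]
    simp only [← mul_smul, hg.eq]
    simp only [mul_smul, smul_left_cancel_iff]
  limPt_mem w Γ e hc x hx hxY := by
    by_cases hne : x = limPt w Γ
    · exact hne ▸ hxY
    have hx0 : g • x = x := hxY.self_of_nhds
    have hfix : ∀ j : ℕ, g • (α ^ e) ^ j • x = (α ^ e) ^ j • x := fun j => by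
      rw [← mul_smul, ((hg.zpow_right e).pow_right j).eq, mul_smul, hx0]
    have ht := hc.tendsto hx
    have hp : g • limPt w Γ = limPt w Γ := by
      refine tendsto_nhds_unique ?_ ht
      have := ((continuous_smul g).tendsto (limPt w Γ)).comp ht
      exact this.congr hfix
    obtain ⟨u, v, hu, huv⟩ := exists_pre g (limPt w Γ)
    have hv := huv.smul_mem hu
    rw [hp] at hv
    obtain ⟨q, hq⟩ := hu
    obtain ⟨j, y, hy⟩ := (ht.eventually_mem ((isClopen_cone u).isOpen.mem_nhds ⟨q, hq⟩)).exists
    have h1 : append v y = append u y := by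
      rw [← huv, hy, hfix]
    have h2 : append v q = append u q := by
      rw [← huv, hq, hp]
    have hyq : y ≠ q := by
      rintro rfl
      rw [hq] at hy
      exact hne (smul_left_cancel _ (hy.symm.trans (hc.pow_smul_limPt j).symm))
    have huv' : u = v := by
      rcases prefix_or_prefix _ _ _ _ h1 with ⟨t, rfl⟩ | ⟨t, rfl⟩
      · rw [append_append] at h1 h2
        by_contra hne
        exact hyq (eq_of_append_eq_self (t := t) (fun h => hne (by simp [h]))
          (append_injective _ h1).symm (append_injective _ h2).symm)
      · rw [append_append] at h1 h2
        by_contra hne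
        exact hyq (eq_of_append_eq_self (t := t) (fun h => hne (by simp [h]))
          (append_injective _ h1) (append_injective _ h2))
    subst huv'
    refine Filter.mem_of_superset ((isClopen_cone u).isOpen.mem_nhds ⟨q, hq⟩) ?_
    rintro _ ⟨z, rfl⟩
    exact huv z

/-! ### The torsion part -/

/-- The points of period `m` near which the `m`-th power of `α` is the identity. -/
def torsionSet (α : V n) (m : ℕ) : Set (Cantor n) :=
  {x | 0 < m ∧ x ∈ fixInterior (α ^ m) ∧ ∀ k, 0 < k → k < m → α ^ k • x ≠ x}

omit [Nontrivial (Fin n)] in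
theorem smul_mem_torsionSet_conj {α γ : V n} {m : ℕ} {x : Cantor n} :
    γ • x ∈ torsionSet (γ * α * γ⁻¹) m ↔ x ∈ torsionSet α m := by
  have h : ∀ (k : ℕ) (y : Cantor n), (γ * α * γ⁻¹) ^ k • γ • y = γ • y ↔ α ^ k • y = y := by
    intro k y
    rw [conj_pow, mul_smul, inv_smul_smul, mul_smul, smul_left_cancel_iff]
  have h' : γ • x ∈ fixInterior ((γ * α * γ⁻¹) ^ m) ↔ x ∈ fixInterior (α ^ m) := by
    change (∀ᶠ y in 𝓝 (γ • x), (γ * α * γ⁻¹) ^ m • y = y) ↔ ∀ᶠ y in 𝓝 x, α ^ m • y = y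
    rw [eventually_smul]
    simp only [h]
  simp only [torsionSet, Set.mem_ofPred_eq, h', ne_eq, h]

omit [Nontrivial (Fin n)] in
theorem smul_mem_torsionSet {α g : V n} (hg : Commute g α) {m : ℕ} {x : Cantor n} :
    g • x ∈ torsionSet α m ↔ x ∈ torsionSet α m := by
  have := smul_mem_torsionSet_conj (α := α) (γ := g) (m := m) (x := x)
  rwa [hg.eq, mul_inv_cancel_right] at this

omit [Nontrivial (Fin n)] in
theorem torsionSet_unique {α : V n} {l m : ℕ} {x : Cantor n} (hl : x ∈ torsionSet α l)
    (hm : x ∈ torsionSet α m) : l = m := by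
  rcases lt_trichotomy l m with h | h | h
  · exact absurd hl.2.1.self_of_nhds (hm.2.2 l hl.1 h)
  · exact h
  · exact absurd hm.2.1.self_of_nhds (hl.2.2 m hm.1 h)

end

/-! ### Periodic neutral leaves and the torsion part -/

section

namespace TreePair

variable {n : ℕ} {P : TreePair n} {α : V n}

theorem IsPeriodicLeaf.reach {m : ℕ} {u : Node n} (h : P.IsPeriodicLeaf m u) : P.Reach m u u := by
  obtain ⟨-, c, h0, hm, -, hs⟩ := h
  exact ⟨c, h0, hm, fun j _ => hs j⟩

theorem exists_isPeriodicLeaf_iff {u : Node n} :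
    (∃ m, P.IsPeriodicLeaf m u) ↔ ∃ k, 0 < k ∧ P.Reach k u u := by
  refine ⟨fun ⟨m, h⟩ => ⟨m, h.1, h.reach⟩, fun hex => ?_⟩
  classical
  have hmin : ∀ k, 0 < k → k < Nat.find hex → ¬ P.Reach k u u := fun k hk hlt hr =>
    Nat.find_min hex hlt ⟨hk, hr⟩
  obtain ⟨hm, c, h0, hcm, hs⟩ := Nat.find_spec hex
  set m := Nat.find hex
  refine ⟨m, hm, fun k => c (k % m), ?_, ?_, fun k hk hkm e => ?_, fun k => ?_⟩
  · simpa using h0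
  · simpa using h0
  · simp only [Nat.mod_eq_of_lt hkm] at e
    exact hmin k hk hkm ⟨c, h0, e, fun j hj => hs j (by omega)⟩
  · have hlt := Nat.mod_lt k hm
    change P.Step (c (k % m)) (c ((k + 1) % m))
    have h1 := hs (k % m) hlt
    rcases Nat.lt_or_ge (k % m + 1) m with h | h
    · rwa [show (k + 1) % m = k % m + 1 by rw [← Nat.mod_add_mod, Nat.mod_eq_of_lt h]]
    · have e : k % m + 1 = m := by omega
      rw [show (k + 1) % m = 0 by rw [← Nat.mod_add_mod, e, Nat.mod_self]]
      rwa [e, hcm, ← h0] at h1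

theorem IsPeriodicLeaf.mem_dom {m : ℕ} {u : Node n} (h : P.IsPeriodicLeaf m u) :
    u ∈ P.dom.leaves := h.reach.dom h.1

theorem IsPeriodicLeaf.mem_ran {m : ℕ} {u : Node n} (h : P.IsPeriodicLeaf m u) :
    u ∈ P.ran.leaves := h.reach.ran h.1

theorem isOpen_torsionSupport (P : TreePair n) (m : ℕ) : IsOpen (P.torsionSupport m) := by
  have : P.torsionSupport m = ⋃ u ∈ {u | P.IsPeriodicLeaf m u}, cone u := by
    ext x
    simp only [torsionSupport, Set.mem_ofPred_eq, Set.mem_iUnion, cone, Set.mem_range]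
    exact ⟨fun ⟨u, y, h, e⟩ => ⟨u, h, y, e.symm⟩, fun ⟨u, h, y, e⟩ => ⟨u, y, h, e.symm⟩⟩
  rw [this]
  exact isOpen_biUnion fun u _ => (isClopen_cone u).isOpen

/-- The leaves on the cycle of a periodic neutral leaf are distinct, so its points have the cycle
length as exact period. -/
theorem torsionSupport_subset (hP : P.Represents α) (m : ℕ) :
    P.torsionSupport m ⊆ torsionSet α m := by
  rintro _ ⟨u, y, h, rfl⟩
  obtain ⟨hm, c, h0, hcm, hne, hs⟩ := h
  have hr : ∀ k, P.Reach k u (c k) := fun k => ⟨c, h0, rfl, fun j _ => hs j⟩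
  have hmm : Pre (α ^ m) u u := by simpa [hcm] using (hr m).pre hP
  refine ⟨hm, Filter.mem_of_superset
    ((isClopen_cone u).isOpen.mem_nhds (append_mem_cone u y)) ?_, fun k hk hkm e => ?_⟩
  · rintro _ ⟨z, rfl⟩
    exact hmm z
  · rw [(hr k).pre hP] at e
    refine hne k hk hkm ?_
    rw [← h0] at e ⊢
    exact leaf_unique P.dom _ (hs k).dom _ (hs 0).dom _ _ e

/-! ### Dynamics of a revealing pair -/

variable [Nontrivial (Fin n)]

theorem eq_of_prefix_of_prefix {T : NTree n} {u v p : Node n} (hu : u ∈ T.leaves)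
    (hv : v ∈ T.leaves) (hup : u <+: p) (hvp : v <+: p) : u = v := by
  rcases List.prefix_or_prefix_of_prefix hup hvp with h | h
  · exact NTree.leaf_eq_of_prefix hu hv h
  · exact (NTree.leaf_eq_of_prefix hv hu h).symm

theorem IsDomRoot.not_mem_dom {w : Node n} (h : P.IsDomRoot w) : w ∉ P.dom.leaves := fun h' =>
  NTree.not_inner_of_leaf_prefix h' List.prefix_rfl (isDomRoot_iff.1 h).2

theorem IsDomRoot.unique {w w' u : Node n} (h : P.IsDomRoot w) (h' : P.IsDomRoot w')
    (hu : w <+: u) (hu' : w' <+: u) : w = w' :=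
  eq_of_prefix_of_prefix h.1 h'.1 hu hu'

theorem IsRanRoot.unique {w w' u : Node n} (h : P.IsRanRoot w) (h' : P.IsRanRoot w')
    (hu : w <+: u) (hu' : w' <+: u) : w = w' :=
  eq_of_prefix_of_prefix h.1 h'.1 hu hu'

theorem IsDomRoot.not_mem_ran_of_prefix {w u : Node n} (h : P.IsDomRoot w) (hw : w <+: u)
    (hu : u ∈ P.dom.leaves) : u ∉ P.ran.leaves := fun h' => by
  obtain rfl := NTree.leaf_eq_of_prefix h.1 h' hw
  exact h.not_mem_dom hu

omit [Nontrivial (Fin n)] in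
theorem IsRepeller.mem_dom {u : Node n} (h : P.IsRepeller u) : u ∈ P.dom.leaves := by
  obtain ⟨-, v, hv, -⟩ := h
  obtain ⟨k, hk, hr⟩ := transGen_iff.1 hv
  exact hr.dom hk

omit [Nontrivial (Fin n)] in
/-- The chain of a repeller ends at the root of its component. -/
theorem IsRepeller.exists_root {u : Node n} (h : P.IsRepeller u) :
    ∃ w Γ k, P.IsDomRoot w ∧ u = w ++ Γ ∧ Γ ≠ [] ∧ 0 < k ∧ P.Reach k u w := by
  obtain ⟨-, v, hv, hvd, hvu⟩ := h
  obtain ⟨k, hk, hr⟩ := transGen_iff.1 hv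
  have hne : v ≠ u := by
    rintro rfl
    exact hvd (hr.dom hk)
  obtain ⟨Γ, rfl⟩ := hvu
  exact ⟨v, Γ, k, ⟨hr.ran hk, _, hr.dom hk, List.prefix_append _ _, hne⟩, rfl,
    fun e => hne (by simp [e]), hk, hr⟩

theorem IsRepeller.reach_root {u w : Node n} (h : P.IsRepeller u) (hw : P.IsDomRoot w)
    (hwu : w <+: u) : ∃ Γ k, u = w ++ Γ ∧ Γ ≠ [] ∧ 0 < k ∧ P.Reach k u w := by
  obtain ⟨w', Γ, k, h1, h2, h3⟩ := h.exists_root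
  obtain rfl := hw.unique h1 hwu (h2 ▸ List.prefix_append _ _)
  exact ⟨Γ, k, h2, h3⟩

/-- A component has at most one repeller. -/
theorem IsRepeller.unique {u u' w : Node n} (h : P.IsRepeller u) (h' : P.IsRepeller u')
    (hw : P.IsDomRoot w) (hwu : w <+: u) (hwu' : w <+: u') : u = u' := by
  obtain ⟨Γ, k, -, -, -, hr⟩ := h.reach_root hw hwu
  obtain ⟨Γ', k', -, -, -, hr'⟩ := h'.reach_root hw hwu'
  exact (hr.start_unique hr' h.1 h'.1).1

theorem IsAttractor.unique {u u' w : Node n} (h : P.IsAttractor u) (h' : P.IsAttractor u')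
    (hw : P.IsRanRoot w) (hwu : w <+: u) (hwu' : w <+: u') : u = u' :=
  (isRepeller_inv.2 h).unique (isRepeller_inv.2 h') (w := w) hw hwu hwu'

theorem IsSource.not_mem_ran {u : Node n} (h : P.IsSource u) : u ∉ P.ran.leaves := by
  obtain ⟨hu, ⟨w, hw, hwu⟩, -⟩ := h
  exact hw.not_mem_ran_of_prefix hwu hu

/-- The chain of a source of a revealing pair ends in a sink. -/
theorem IsSource.exists_sink (hR : P.IsRevealing) {u : Node n} (h : P.IsSource u) :
    ∃ v k, 0 < k ∧ P.Reach k u v ∧ P.IsSink v := by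
  have hur := h.not_mem_ran
  obtain ⟨hu, ⟨w, hw, hwu⟩, hnr⟩ := h
  obtain ⟨k, hk, v, hv, hr⟩ : ∃ k, 0 < k ∧ ∃ v ∉ P.dom.leaves, P.Reach k u v := by
    rcases periodic_or_exists_end hu with ⟨k, hk, h⟩ | h
    · exact absurd (h.ran hk) hur
    · exact h
  have hvr := hr.ran hk
  refine ⟨v, k, hk, hr, hvr, ?_, ?_⟩
  · rcases NTree.inner_or_below_leaf P.dom v with hin | ⟨d, hd, hdv⟩
    · have hv' := isDomRoot_iff.2 ⟨hvr, hin⟩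
      obtain ⟨ρ, hρ, hvρ⟩ := hR.1 v hv'
      obtain ⟨Γ, l, -, -, -, hl⟩ := hρ.reach_root hv' hvρ
      exact absurd ((hr.start_unique hl hur hρ.1).1 ▸ hρ) hnr
    · refine ⟨d, isRanRoot_iff.2 ⟨hd, NTree.mem_inner.2 ⟨v, hvr, hdv, ?_⟩⟩, hdv⟩
      rintro rfl
      exact hv hd
  · rintro ⟨-, s, hs, hsr, hsv⟩
    obtain ⟨l, hl, hrl⟩ := transGen_iff.1 hs
    obtain rfl := (hr.start_unique hrl hur hsr).1
    obtain rfl := NTree.leaf_eq_of_prefix hw.1 hvr (hwu.trans hsv)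
    obtain rfl : w = u := hwu.eq_of_length (le_antisymm hwu.length_le hsv.length_le)
    exact hur hw.1

theorem IsSink.exists_source (hR : P.IsRevealing) {v : Node n} (h : P.IsSink v) :
    ∃ u k, 0 < k ∧ P.Reach k u v ∧ P.IsSource u := by
  obtain ⟨u, k, hk, hr, hu⟩ := (isSource_inv.2 h).exists_sink (isRevealing_inv.2 hR)
  exact ⟨u, k, hk, reach_inv.1 hr, isSink_inv.1 hu⟩

theorem IsSource.exists_isFlowLine (hR : P.IsRevealing) {u : Node n} (h : P.IsSource u) :
    ∃ v ρ a, P.IsFlowLine u v ρ a := by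
  obtain ⟨v, k, hk, hr, hv⟩ := h.exists_sink hR
  obtain ⟨w, hw, hwu⟩ := h.2.1
  obtain ⟨w', hw', hwv⟩ := hv.2.1
  obtain ⟨ρ, hρ, hwρ⟩ := hR.1 w hw
  obtain ⟨a, ha, hwa⟩ := hR.2 w' hw'
  exact ⟨v, ρ, a, h, hv, transGen_iff.2 ⟨k, hk, hr⟩, hρ, ha, ⟨w, hw, hwu, hwρ⟩, w', hw', hwv, hwa⟩

theorem IsSink.exists_isFlowLine (hR : P.IsRevealing) {v : Node n} (h : P.IsSink v) :
    ∃ u ρ a, P.IsFlowLine u v ρ a := by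
  obtain ⟨u, k, hk, hr, hu⟩ := h.exists_source hR
  obtain ⟨w, hw, hwu⟩ := hu.2.1
  obtain ⟨w', hw', hwv⟩ := h.2.1
  obtain ⟨ρ, hρ, hwρ⟩ := hR.1 w hw
  obtain ⟨a, ha, hwa⟩ := hR.2 w' hw'
  exact ⟨u, ρ, a, hu, h, transGen_iff.2 ⟨k, hk, hr⟩, hρ, ha, ⟨w, hw, hwu, hwρ⟩, w', hw', hwv, hwa⟩

theorem IsFlowLine.eq_repeller {u v ρ a ρ' w : Node n} (h : P.IsFlowLine u v ρ a)
    (hw : P.IsDomRoot w) (hwu : w <+: u) (hρ' : P.IsRepeller ρ') (hwρ' : w <+: ρ') : ρ = ρ' := by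
  obtain ⟨-, -, -, hρ, -, ⟨w', hw', h1, h2⟩, -⟩ := h
  obtain rfl := hw'.unique hw h1 hwu
  exact hρ.unique hρ' hw' h2 hwρ'

theorem IsFlowLine.eq_attractor {u v ρ a a' w : Node n} (h : P.IsFlowLine u v ρ a)
    (hw : P.IsRanRoot w) (hwv : w <+: v) (ha' : P.IsAttractor a') (hwa' : w <+: a') : a = a' := by
  obtain ⟨-, -, -, -, ha, -, w', hw', h1, h2⟩ := h
  obtain rfl := hw'.unique hw h1 hwv
  exact ha.unique ha' hw' h2 hwa'

/-- Near the repeller or attractor `w Γ` with root `w`, the power `α ^ e` contracts the cone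
under `w` onto the cone under `w Γ`. -/
def RootContracts (P : TreePair n) (α : V n) (w Γ : Node n) (e : ℤ) : Prop :=
  Contracts (α ^ e) w Γ ∧
    ((P.IsDomRoot w ∧ P.IsRepeller (w ++ Γ)) ∨ (P.IsRanRoot w ∧ P.IsAttractor (w ++ Γ)))

omit [Nontrivial (Fin n)] in
theorem RootContracts.inv {w Γ : Node n} {e : ℤ} (h : P.inv.RootContracts α⁻¹ w Γ e) :
    P.RootContracts α w Γ (-e) := by
  refine ⟨by simpa [zpow_neg] using h.1, h.2.symm.imp ?_ ?_⟩
  · rintro ⟨h1, h2⟩; exact ⟨h1, isAttractor_inv.1 h2⟩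
  · rintro ⟨h1, h2⟩; exact ⟨h1, isRepeller_inv.1 h2⟩

theorem IsRepeller.rootContracts (hP : P.Represents α) {w ρ : Node n} (hw : P.IsDomRoot w)
    (h : P.IsRepeller ρ) (hwρ : w <+: ρ) :
    ∃ Γ, ∃ k : ℕ, ρ = w ++ Γ ∧ 0 < k ∧ P.Reach k ρ w ∧ P.RootContracts α w Γ (-k) := by
  obtain ⟨Γ, k, rfl, h2, hk, hr⟩ := h.reach_root hw hwρ
  refine ⟨Γ, k, rfl, hk, hr, ⟨h2, ?_⟩, Or.inl ⟨hw, h⟩⟩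
  rw [zpow_neg, zpow_natCast]
  exact (hr.pre hP).inv

theorem IsAttractor.rootContracts (hP : P.Represents α) {w a : Node n} (hw : P.IsRanRoot w)
    (h : P.IsAttractor a) (hwa : w <+: a) : ∃ Γ e, a = w ++ Γ ∧ P.RootContracts α w Γ e := by
  obtain ⟨Γ, k, h1, -, -, h2⟩ :=
    (isRepeller_inv.2 h).rootContracts (P := P.inv) (w := w) hP.inv hw hwa
  exact ⟨Γ, _, h1, h2.inv⟩

/-- A point below a root of a component and not below its repeller lies below a source. -/
theorem exists_source_of_mem_cone {w Γ : Node n} (hw : P.IsDomRoot w)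
    (hρ : P.IsRepeller (w ++ Γ)) {x : Cantor n} (hx : x ∈ cone w) (hx' : x ∉ cone (w ++ Γ)) :
    ∃ u, P.IsSource u ∧ w <+: u ∧ x ∈ cone u := by
  obtain ⟨u, hu, y, rfl⟩ := exists_leaf P.dom x
  have hwu : w <+: u := by
    rcases prefix_total_of_mem_cone hx (append_mem_cone u y) with h | h
    · exact h
    · exact absurd (isDomRoot_iff.1 hw).2 (NTree.not_inner_of_leaf_prefix hu h)
  refine ⟨u, ⟨hu, ⟨w, hw, hwu⟩, fun hr => hx' ?_⟩, hwu, append_mem_cone _ _⟩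
  rw [hρ.unique hr hw (List.prefix_append _ _) hwu]
  exact append_mem_cone _ _

/-- A point below a root of a component of (domain) − (range) is the repelling point or lies in
the orbit of the cone under a source of that component. -/
theorem eq_limPt_or_source {w Γ : Node n} {e : ℤ}
    (h : Contracts (α ^ e) w Γ) (hw : P.IsDomRoot w) (hρ : P.IsRepeller (w ++ Γ)) {x : Cantor n}
    (hx : x ∈ cone w) : x = limPt w Γ ∨
      ∃ u, P.IsSource u ∧ w <+: u ∧ ∃ (k : ℤ), ∃ y ∈ cone u, x = α ^ k • y := by
  by_cases hne : x = limPt w Γ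
  · exact Or.inl hne
  obtain ⟨j, y, hy, hy', rfl⟩ := h.exists_pow_smul hx hne
  obtain ⟨u, hu, hwu, hyu⟩ := exists_source_of_mem_cone hw hρ hy hy'
  exact Or.inr ⟨u, hu, hwu, e * j, y, hyu, by rw [zpow_mul, zpow_natCast]⟩

/-- The trichotomy for the dynamics of a revealing pair: each point lies below a periodic neutral
leaf, or in the orbit of the cone under a source, or in the orbit of a repelling or attracting
point. -/
theorem cover (hP : P.IsRevealingFor α) (x : Cantor n) :
    (∃ m, x ∈ P.torsionSupport m) ∨
    (∃ u, P.IsSource u ∧ ∃ (k : ℤ), ∃ y ∈ cone u, x = α ^ k • y) ∨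
    ∃ w Γ e, P.RootContracts α w Γ e ∧ ∃ k : ℤ, x = α ^ k • limPt w Γ := by
  obtain ⟨u, hu, y, rfl⟩ := exists_leaf P.dom x
  rcases periodic_or_exists_end hu with hper | ⟨k, hk, v, hv, hr⟩
  · obtain ⟨m, hm⟩ := exists_isPeriodicLeaf_iff.2 hper
    exact Or.inl ⟨m, u, y, hm, rfl⟩
  right
  have hx : append u y = α ^ (-(k : ℤ)) • append v y := by
    rw [← hr.pre hP.2 y, zpow_neg, zpow_natCast, inv_smul_smul]
  rw [hx]
  rcases NTree.inner_or_below_leaf P.dom v with hin | ⟨d, hd, hdv⟩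
  · have hv' := isDomRoot_iff.2 ⟨hr.ran hk, hin⟩
    obtain ⟨ρ, hρ, hvρ⟩ := hP.1.1 v hv'
    obtain ⟨Γ, l, rfl, -, -, hc⟩ := hρ.rootContracts hP.2 hv' hvρ
    rcases eq_limPt_or_source hc.1 hv' hρ (append_mem_cone v y) with h | ⟨u, hu, -, i, z, hz, h⟩
    · exact Or.inr ⟨v, Γ, _, hc, _, by rw [h]⟩
    · exact Or.inl ⟨u, hu, -(k : ℤ) + i, z, hz, by rw [h, zpow_add, mul_smul]⟩
  · have hd' : P.IsRanRoot d := isRanRoot_iff.2 ⟨hd, NTree.mem_inner.2 ⟨v, hr.ran hk, hdv, by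
      rintro rfl
      exact hv hd⟩⟩
    obtain ⟨a, ha, hda⟩ := hP.1.2 d hd'
    obtain ⟨Γ, e, rfl, hc⟩ := ha.rootContracts hP.2 hd' hda
    have hc' : Contracts (α⁻¹ ^ (-e)) d Γ := by simpa using hc.1
    rcases eq_limPt_or_source (P := P.inv) hc' hd' (isRepeller_inv.2 ha)
      (cone_subset_of_prefix hdv (append_mem_cone v y)) with h | ⟨s, hs, -, i, z, ⟨z, rfl⟩, h⟩
    · exact Or.inr ⟨d, Γ, _, hc, _, by rw [h]⟩
    · obtain ⟨t, l, -, hl, ht⟩ := (isSource_inv.1 hs).exists_source hP.1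
      refine Or.inl ⟨t, ht, -(k : ℤ) + (-i + l), append t z, append_mem_cone _ _, ?_⟩
      rw [h, zpow_add, zpow_add, mul_smul, mul_smul, zpow_natCast, hl.pre hP.2, inv_zpow']

theorem IsSource.smul_ne (hP : P.IsRevealingFor α) {u : Node n} (hu : P.IsSource u)
    {x : Cantor n} (hx : x ∈ cone u) {m : ℕ} (hm : 0 < m) : α ^ m • x ≠ x := by
  obtain ⟨w, hw, hwu⟩ := hu.2.1
  obtain ⟨ρ, hρ, hwρ⟩ := hP.1.1 w hw
  obtain ⟨Γ, l, rfl, -, -, hc⟩ := hρ.rootContracts hP.2 hw hwρ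
  refine hc.1.smul_ne (cone_subset_of_prefix hwu hx) ?_ hm
  rintro rfl
  exact hu.2.2 (NTree.leaf_eq_of_mem_cone hu.1 hρ.mem_dom hx hc.1.limPt_mem_cone_append ▸ hρ)

theorem IsSource.not_mem_torsionSet (hP : P.IsRevealingFor α) {u : Node n} (hu : P.IsSource u)
    {x : Cantor n} (hx : x ∈ cone u) (m : ℕ) : x ∉ torsionSet α m := fun h =>
  hu.smul_ne hP hx h.1 h.2.1.self_of_nhds

end TreePair

theorem Contracts.limPt_not_mem_torsionSet {n : ℕ} [Nontrivial (Fin n)] {α : V n} {w Γ : Node n}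
    {e : ℤ} (h : Contracts (α ^ e) w Γ) (m : ℕ) : limPt w Γ ∉ torsionSet α m := fun ht => by
  have hopen : IsOpen (fixInterior (α ^ m)) := isOpen_setOfPred_eventually_nhds
  obtain ⟨x, hx, hxw, hne⟩ := h.exists_ne_limPt hopen ht.2.1
  exact h.smul_ne hxw hne ht.1 hx.self_of_nhds

namespace TreePair

variable {n : ℕ} [Nontrivial (Fin n)] {P : TreePair n} {α : V n}

/-- The set underlying the periodic neutral leaves of cycle length `m` depends only on `α`. -/
theorem torsionSupport_eq (hP : P.IsRevealingFor α) (m : ℕ) :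
    P.torsionSupport m = torsionSet α m := by
  refine (torsionSupport_subset hP.2 m).antisymm fun x hx => ?_
  rcases cover hP x with ⟨l, h⟩ | ⟨u, hu, k, y, hy, rfl⟩ | ⟨w, Γ, e, h, k, rfl⟩
  · rwa [torsionSet_unique hx (torsionSupport_subset hP.2 l h)]
  · rw [smul_mem_torsionSet (Commute.zpow_left rfl k)] at hx
    exact absurd hx (hu.not_mem_torsionSet hP hy m)
  · rw [smul_mem_torsionSet (Commute.zpow_left rfl k)] at hx
    exact absurd hx (h.1.limPt_not_mem_torsionSet m)

theorem mem_cycleLengths_iff (hP : P.IsRevealingFor α) {m : ℕ} :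
    m ∈ P.cycleLengths ↔ (torsionSet α m).Nonempty := by
  rw [← torsionSupport_eq hP]
  constructor
  · rintro ⟨u, hu⟩; exact ⟨append u (Classical.arbitrary _), u, _, hu, rfl⟩
  · rintro ⟨_, u, _, hu, rfl⟩; exact ⟨u, hu⟩

/-! ### The supports of the non-torsion components -/

/-- The union of the orbits under `α` of the cones under the sources of a component. -/
def flowSet (α : V n) (c : P.NonTorsionComponent) : Set (Cantor n) :=
  {x | ∃ u v, ∃ ρ ∈ c.1.supp, ∃ a ∈ c.1.supp, P.IsFlowLine u v ρ.1 a.1 ∧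
    ∃ (k : ℤ) (y : Cantor n), x = (α ^ k).1 (append u y)}

omit [Nontrivial (Fin n)] in
theorem IsFlowLine.mem_supp_iff {u v : Node n} {ρ a : {u // P.IsFlowVertex u}}
    (h : P.IsFlowLine u v ρ.1 a.1) (c : P.flowGraph.ConnectedComponent) :
    ρ ∈ c.supp ↔ a ∈ c.supp := by
  have hne : ρ ≠ a := by
    rintro rfl
    exact h.2.2.2.2.1.1 h.2.2.2.1.mem_dom
  have : P.flowGraph.Adj ρ a := (SimpleGraph.fromRel_adj _ _ _).2 ⟨hne, Or.inl (Or.inl ⟨u, v, h⟩)⟩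
  rw [SimpleGraph.ConnectedComponent.mem_supp_iff, SimpleGraph.ConnectedComponent.mem_supp_iff,
    SimpleGraph.ConnectedComponent.connectedComponentMk_eq_of_adj this]

omit [Nontrivial (Fin n)] in
theorem mem_flowSet_iff {c : P.NonTorsionComponent} {x : Cantor n} :
    x ∈ flowSet α c ↔ ∃ u v, ∃ ρ ∈ c.1.supp, ∃ a, P.IsFlowLine u v ρ.1 a ∧
      ∃ (k : ℤ), ∃ y ∈ cone u, x = α ^ k • y := by
  constructor
  · rintro ⟨u, v, ρ, hρ, a, -, h, k, y, rfl⟩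
    exact ⟨u, v, ρ, hρ, a, h, k, _, append_mem_cone u y, rfl⟩
  · rintro ⟨u, v, ρ, hρ, a, h, k, _, ⟨y, rfl⟩, rfl⟩
    exact ⟨u, v, ρ, hρ, ⟨a, Or.inr (Or.inl h.2.2.2.2.1)⟩, (IsFlowLine.mem_supp_iff h c.1).1 hρ, h,
      k, y, rfl⟩

omit [Nontrivial (Fin n)] in
theorem smul_mem_flowSet_iff {c : P.NonTorsionComponent} (x : Cantor n) :
    α • x ∈ flowSet α c ↔ x ∈ flowSet α c := by
  simp only [mem_flowSet_iff]
  constructor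
  · rintro ⟨u, v, ρ, hρ, a, h, k, y, hy, e⟩
    refine ⟨u, v, ρ, hρ, a, h, -1 + k, y, hy, ?_⟩
    rw [zpow_add, mul_smul, ← e, zpow_neg_one, inv_smul_smul]
  · rintro ⟨u, v, ρ, hρ, a, h, k, y, hy, rfl⟩
    exact ⟨u, v, ρ, hρ, a, h, 1 + k, y, hy, by rw [zpow_add, mul_smul, zpow_one]⟩

omit [Nontrivial (Fin n)] in
theorem isOpen_flowSet (c : P.NonTorsionComponent) : IsOpen (flowSet α c) := by
  refine isOpen_iff_mem_nhds.2 fun x hx => ?_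
  obtain ⟨u, v, ρ, hρ, a, h, k, y, hy, rfl⟩ := mem_flowSet_iff.1 hx
  have : ∀ᶠ z in 𝓝 y, α ^ k • z ∈ flowSet α c :=
    Filter.mem_of_superset ((isClopen_cone u).isOpen.mem_nhds hy) fun z hz =>
      mem_flowSet_iff.2 ⟨u, v, ρ, hρ, a, h, k, z, hz, rfl⟩
  exact eventually_smul.2 this

omit [Nontrivial (Fin n)] in
theorem reachable_induction {Q : {u // P.IsFlowVertex u} → Prop}
    (hQ : ∀ x y, P.FlowEdge x y → (Q x ↔ Q y)) {x y : {u // P.IsFlowVertex u}}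
    (h : P.flowGraph.Reachable x y) : Q x ↔ Q y := by
  obtain ⟨p⟩ := h
  induction p with
  | nil => rfl
  | cons h _ ih =>
    refine Iff.trans ?_ ih
    rcases ((SimpleGraph.fromRel_adj _ _ _).1 h).2 with h | h
    · exact hQ _ _ h
    · exact (hQ _ _ h).symm

omit [Nontrivial (Fin n)] in
theorem isPeriodicLeaf_iff_of_edge {x y : {u // P.IsFlowVertex u}} (h : P.FlowEdge x y) :
    (∃ m, P.IsPeriodicLeaf m x.1) ↔ ∃ m, P.IsPeriodicLeaf m y.1 := by
  rcases h with ⟨u, v, h⟩ | ⟨h, hs⟩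
  · refine iff_of_false ?_ ?_
    · rintro ⟨m, hm⟩; exact h.2.2.2.1.1 hm.mem_ran
    · rintro ⟨m, hm⟩; exact h.2.2.2.2.1.1 hm.mem_dom
  · refine iff_of_true h ?_
    rw [exists_isPeriodicLeaf_iff] at h ⊢
    obtain ⟨k, hk, hr⟩ := h
    obtain ⟨k, rfl⟩ : ∃ l, k = l + 1 := ⟨k - 1, by omega⟩
    obtain ⟨w, hw, hwr⟩ := reach_succ'.1 hr
    obtain rfl := hw.right_unique hs
    exact ⟨k + 1, hk, reach_succ.2 ⟨_, hwr, hs⟩⟩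

omit [Nontrivial (Fin n)] in
theorem exists_component {x : {u // P.IsFlowVertex u}} (hx : ¬ ∃ m, P.IsPeriodicLeaf m x.1) :
    ∃ c : P.NonTorsionComponent, x ∈ c.1.supp := by
  refine ⟨⟨P.flowGraph.connectedComponentMk x, fun y hy => ?_⟩, rfl⟩
  have hr := SimpleGraph.ConnectedComponent.exact hy
  rwa [reachable_induction (fun _ _ => isPeriodicLeaf_iff_of_edge) hr]

omit [Nontrivial (Fin n)] in
theorem IsFlowLine.exists_component {u v ρ a : Node n} (h : P.IsFlowLine u v ρ a) :
    ∃ c : P.NonTorsionComponent, ∃ (hρ : P.IsFlowVertex ρ) (ha : P.IsFlowVertex a),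
      ⟨ρ, hρ⟩ ∈ c.1.supp ∧ ⟨a, ha⟩ ∈ c.1.supp := by
  have hρ : P.IsFlowVertex ρ := Or.inl h.2.2.2.1
  have ha : P.IsFlowVertex a := Or.inr (Or.inl h.2.2.2.2.1)
  obtain ⟨c, hc⟩ := TreePair.exists_component (P := P) (x := ⟨ρ, hρ⟩) (by
    rintro ⟨m, hm⟩
    exact h.2.2.2.1.1 hm.mem_ran)
  exact ⟨c, hρ, ha, hc, (IsFlowLine.mem_supp_iff (ρ := ⟨ρ, hρ⟩) (a := ⟨a, ha⟩) h c.1).1 hc⟩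

/-- Below the root of the component of a repeller or attractor, all points but the fixed one lie
in the flow set. -/
theorem RootContracts.exists_component (hP : P.IsRevealingFor α) {w Γ : Node n} {e : ℤ}
    (h : P.RootContracts α w Γ e) :
    ∃ c : P.NonTorsionComponent, ∀ x ∈ cone w, x ≠ limPt w Γ → x ∈ flowSet α c := by
  obtain ⟨hc, ⟨hw, hρ⟩ | ⟨hw, ha⟩⟩ := h
  · obtain ⟨c, hcρ⟩ := TreePair.exists_component (P := P) (x := ⟨w ++ Γ, Or.inl hρ⟩) (by
      rintro ⟨m, hm⟩
      exact hρ.1 hm.mem_ran)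
    refine ⟨c, fun x hx hne => ?_⟩
    obtain ⟨u, hu, hwu, k, y, hy, rfl⟩ := (eq_limPt_or_source hc hw hρ hx).resolve_left hne
    obtain ⟨v, ρ, a, hl⟩ := hu.exists_isFlowLine hP.1
    obtain rfl := hl.eq_repeller hw hwu hρ (List.prefix_append _ _)
    exact mem_flowSet_iff.2 ⟨u, v, _, hcρ, a, hl, k, y, hy, rfl⟩
  · obtain ⟨c, hca⟩ := TreePair.exists_component (P := P) (x := ⟨w ++ Γ, Or.inr (Or.inl ha)⟩) (by
      rintro ⟨m, hm⟩
      exact ha.1 hm.mem_dom)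
    refine ⟨c, fun x hx hne => ?_⟩
    have hc' : Contracts (α⁻¹ ^ (-e)) w Γ := by simpa using hc
    obtain ⟨v, hv, hwv, k, _, ⟨y, rfl⟩, rfl⟩ :=
      (eq_limPt_or_source (P := P.inv) hc' hw (isRepeller_inv.2 ha) hx).resolve_left hne
    obtain ⟨u, ρ, a, hl⟩ := (isSource_inv.1 hv).exists_isFlowLine hP.1
    obtain rfl := hl.eq_attractor hw hwv ha (List.prefix_append _ _)
    obtain ⟨l, -, hr⟩ := transGen_iff.1 hl.2.2.1
    refine mem_flowSet_iff.2 ⟨u, v, ⟨ρ, Or.inl hl.2.2.2.1⟩, ?_, _, hl, -k + l, append u y,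
      append_mem_cone _ _, ?_⟩
    · exact (IsFlowLine.mem_supp_iff (ρ := ⟨ρ, Or.inl hl.2.2.2.1⟩) (a := ⟨_, _⟩) hl c.1).2 hca
    · rw [zpow_add, mul_smul, zpow_natCast, hr.pre hP.2, inv_zpow']

theorem flowSet_nonempty (hP : P.IsRevealingFor α) (c : P.NonTorsionComponent) :
    (flowSet α c).Nonempty := by
  obtain ⟨⟨z, hz⟩, hzc⟩ := c.1.nonempty_supp
  rcases hz with hρ | ha | hper
  · obtain ⟨w, Γ, k, hw, rfl, -⟩ := hρ.exists_root
    obtain ⟨Γ', l, h1, -, -, hc⟩ := hρ.rootContracts hP.2 hw (List.prefix_append _ _)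
    obtain rfl := List.append_cancel_left h1
    obtain ⟨x, hx, hx'⟩ := hc.1.exists_fundamental
    obtain ⟨u, hu, hwu, hxu⟩ := exists_source_of_mem_cone hw hρ hx hx'
    obtain ⟨v, ρ, a, hl⟩ := hu.exists_isFlowLine hP.1
    obtain rfl := hl.eq_repeller hw hwu hρ (List.prefix_append _ _)
    exact ⟨x, mem_flowSet_iff.2 ⟨u, v, _, hzc, a, hl, 0, x, hxu, by rw [zpow_zero, one_smul]⟩⟩
  · obtain ⟨w, Γ, k, hw, rfl, -⟩ := (isRepeller_inv.2 ha).exists_root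
    obtain ⟨Γ', l, h1, hc⟩ := ha.rootContracts hP.2 hw (List.prefix_append _ _)
    obtain rfl := List.append_cancel_left h1
    obtain ⟨x, hx, hx'⟩ := hc.1.exists_fundamental
    obtain ⟨v, hv, hwv, hxv⟩ := exists_source_of_mem_cone hw (isRepeller_inv.2 ha) hx hx'
    obtain ⟨u, ρ, a, hl⟩ := (isSource_inv.1 hv).exists_isFlowLine hP.1
    obtain rfl := hl.eq_attractor hw hwv ha (List.prefix_append _ _)
    refine ⟨append u x, mem_flowSet_iff.2 ⟨u, v, ⟨ρ, Or.inl hl.2.2.2.1⟩, ?_, _, hl, 0, _,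
      append_mem_cone _ _, by rw [zpow_zero, one_smul]⟩⟩
    exact (IsFlowLine.mem_supp_iff (ρ := ⟨ρ, Or.inl hl.2.2.2.1⟩) (a := ⟨_, _⟩) hl c.1).2 hzc
  · exact absurd hper (c.2 _ hzc)

/-- A trapping set that meets the orbit of one flow line of a component contains all of them. -/
theorem flowSet_subset_of_trapping (hP : P.IsRevealingFor α) {Y : Set (Cantor n)}
    (hY : Trapping α Y) (c : P.NonTorsionComponent) (h : (flowSet α c ∩ Y).Nonempty) :
    flowSet α c ⊆ Y := by
  have hrep : ∀ {w ρ s : Node n}, P.IsDomRoot w → P.IsRepeller ρ → w <+: ρ → w <+: s →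
      ∀ x ∈ cone s, x ∈ Y → cone w ⊆ Y := by
    intro w ρ s hw hρ hwρ hws x hx hxY
    obtain ⟨Γ, l, -, -, -, hc⟩ := hρ.rootContracts hP.2 hw hwρ
    exact hY.cone_subset hc.1 (cone_subset_of_prefix hws hx) hxY
  have hatt : ∀ {w a s : Node n}, P.IsRanRoot w → P.IsAttractor a → w <+: a → w <+: s →
      ∀ x ∈ cone s, x ∈ Y → cone w ⊆ Y := by
    intro w a s hw ha hwa hws x hx hxY
    obtain ⟨Γ, l, -, hc⟩ := ha.rootContracts hP.2 hw hwa
    exact hY.cone_subset hc.1 (cone_subset_of_prefix hws hx) hxY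
  have hreach : ∀ {k u v}, P.Reach k u v → (cone u ⊆ Y ↔ cone v ⊆ Y) := by
    intro k u v hr
    have := hr.pre hP.2
    rw [← zpow_natCast] at this
    constructor
    · rintro h _ ⟨z, rfl⟩
      rw [← this z, hY.zpow_smul_mem_iff]
      exact h (append_mem_cone _ _)
    · rintro h _ ⟨z, rfl⟩
      rw [← hY.zpow_smul_mem_iff k, this z]
      exact h (append_mem_cone _ _)
  have h0 : ∀ s : Node n, append s (Classical.arbitrary _) ∈ cone s := fun s => append_mem_cone s _
  have hsrc : ∀ {u v ρ a}, P.IsFlowLine u v ρ a → (cone u ⊆ Y ↔ cone ρ ⊆ Y) := by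
    rintro u v ρ a ⟨-, -, -, hρ, -, ⟨w, hw, h1, h2⟩, -⟩
    exact ⟨fun h => (cone_subset_of_prefix h2).trans (hrep hw hρ h2 h1 _ (h0 u) (h (h0 u))),
      fun h => (cone_subset_of_prefix h1).trans (hrep hw hρ h2 h2 _ (h0 ρ) (h (h0 ρ)))⟩
  have hsnk : ∀ {u v ρ a}, P.IsFlowLine u v ρ a → (cone v ⊆ Y ↔ cone a ⊆ Y) := by
    rintro u v ρ a ⟨-, -, -, -, ha, -, w, hw, h1, h2⟩
    exact ⟨fun h => (cone_subset_of_prefix h2).trans (hatt hw ha h2 h1 _ (h0 v) (h (h0 v))),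
      fun h => (cone_subset_of_prefix h1).trans (hatt hw ha h2 h2 _ (h0 a) (h (h0 a)))⟩
  have hedge : ∀ x y, P.FlowEdge x y → (cone x.1 ⊆ Y ↔ cone y.1 ⊆ Y) := by
    rintro x y (⟨u, v, hl⟩ | ⟨-, hs⟩)
    · obtain ⟨k, -, hr⟩ := transGen_iff.1 hl.2.2.1
      rw [← hsrc hl, ← hsnk hl, hreach hr]
    · exact hreach (Reach.single hs)
  obtain ⟨x, hx, hxY⟩ := h
  obtain ⟨u, v, ρ, hρ, a, hl, k, y, hy, rfl⟩ := mem_flowSet_iff.1 hx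
  rw [hY.zpow_smul_mem_iff] at hxY
  have hρY : cone ρ.1 ⊆ Y := by
    obtain ⟨-, -, -, hρ, -, ⟨w, hw, h1, h2⟩, -⟩ := hl
    exact (cone_subset_of_prefix h2).trans (hrep hw hρ h2 h1 _ hy hxY)
  intro x' hx'
  obtain ⟨u', v', ρ', hρ', a', hl', k', y', hy', rfl⟩ := mem_flowSet_iff.1 hx'
  rw [hY.zpow_smul_mem_iff]
  refine (hsrc hl').2 ?_ hy'
  have hr := SimpleGraph.ConnectedComponent.exact (hρ.trans hρ'.symm)
  exact (reachable_induction hedge hr).1 hρY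

/-- The repelling points of two different components of (domain) − (range) lie in different
orbits: the orbit of the repelling point stays below the neutral leaves on the chain of the
repeller. -/
theorem eq_of_zpow_smul_limPt {k : ℕ} (hP : P.Represents α) {w Γ w' Γ' : Node n}
    (h : Contracts (α ^ (-k : ℤ)) w Γ) (hk : 0 < k) (hr : P.Reach k (w ++ Γ) w)
    (hΓ' : P.IsRepeller (w' ++ Γ')) {e' : ℤ} (h' : Contracts (α ^ e') w' Γ') {i : ℤ}
    (hi : α ^ i • limPt w Γ = limPt w' Γ') : w ++ Γ = w' ++ Γ' := by
  obtain ⟨c, h0, hck, hc⟩ := hr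
  have hfix : ∀ j : ℤ, α ^ ((k : ℤ) * j) • limPt w Γ = limPt w Γ := by
    intro j
    have h1 : α ^ (-k : ℤ) ∈ MulAction.stabilizer (V n) (limPt w Γ) := h.smul_limPt
    have h2 := zpow_mem h1 (-j)
    rw [← zpow_mul, neg_mul_neg] at h2
    exact h2
  have hlt : (i % k).toNat < k := by
    have := Int.emod_lt_of_pos i (Int.natCast_pos.2 hk)
    have := Int.emod_nonneg i (Int.natCast_pos.2 hk).ne'
    omega
  -- `limPt w Γ` has a period dividing `k`, so only the remainder of `i` modulo `k` matters
  have hmem : limPt w' Γ' ∈ cone (c (i % k).toNat) := by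
    have he : i = ((i % k).toNat : ℤ) + k * (i / k) := by
      rw [Int.toNat_of_nonneg (Int.emod_nonneg i (Int.natCast_pos.2 hk).ne'),
        Int.emod_add_mul_ediv]
    have hpt : α ^ (i % k).toNat • limPt w Γ = limPt w' Γ' := by
      conv_rhs => rw [← hi, he, zpow_add, mul_smul, hfix, zpow_natCast]
    rw [← hpt]
    have hr : P.Reach (i % k).toNat (c 0) (c (i % k).toNat) :=
      ⟨c, rfl, rfl, fun j hj => hc j (by omega)⟩
    exact (hr.pre hP).smul_mem (h0 ▸ h.limPt_mem_cone_append)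
  have heq := NTree.leaf_eq_of_mem_cone (hc _ hlt).dom hΓ'.mem_dom hmem h'.limPt_mem_cone_append
  rcases hj : (i % k).toNat with _ | j
  · rw [hj, h0] at heq; exact heq
  · rw [hj] at heq hlt
    exact absurd (heq ▸ (hc j (by omega)).ran) hΓ'.1

/-- The sets of orbits of flow lines of different components are disjoint, since the backward
orbit of a point determines the repeller. -/
theorem eq_of_flowSet_inter (hP : P.IsRevealingFor α) {c c' : P.NonTorsionComponent}
    {x : Cantor n} (hx : x ∈ flowSet α c) (hx' : x ∈ flowSet α c') : c = c' := by
  obtain ⟨u, v, ρ, hρ, a, hl, i, y, hy, rfl⟩ := mem_flowSet_iff.1 hx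
  obtain ⟨u', v', ρ', hρ', a', hl', i', y', hy', he⟩ := mem_flowSet_iff.1 hx'
  obtain ⟨-, -, -, hρr, -, ⟨w, hw, h1, h2⟩, -⟩ := hl
  obtain ⟨-, -, -, hρr', -, ⟨w', hw', h1', h2'⟩, -⟩ := hl'
  obtain ⟨Γ, k, hΓ, hk, hr, hc⟩ := hρr.rootContracts hP.2 hw h2
  obtain ⟨Γ', k', hΓ', hk', hr', hc'⟩ := hρr'.rootContracts hP.2 hw' h2'
  have hy'' : y' = α ^ (-i' + i) • y := by
    rw [zpow_add, mul_smul, he, ← mul_smul, ← zpow_add, neg_add_cancel, zpow_zero, one_smul]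
  set j := -i' + i
  -- `α ^ (-k)` and `α ^ (-k')` have the common power `α ^ (-k k')`, so that the backward orbits of `y`
  -- and `y'` along it converge to the two repelling points
  have t1 := (hc.1.tendsto (cone_subset_of_prefix h1 hy)).comp
    (tendsto_id.const_mul_atTop' hk' : Tendsto (fun a : ℕ => k' * a) atTop atTop)
  have t2 := (hc'.1.tendsto (cone_subset_of_prefix h1' hy')).comp
    (tendsto_id.const_mul_atTop' hk : Tendsto (fun a : ℕ => k * a) atTop atTop)
  have t3 := ((continuous_smul (α ^ j)).tendsto _).comp t1
  have hlim : α ^ j • limPt w Γ = limPt w' Γ' := by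
    refine tendsto_nhds_unique t3 (t2.congr fun b => ?_)
    simp only [Function.comp_apply]
    rw [hy'', ← zpow_natCast, ← zpow_natCast, ← zpow_mul, ← zpow_mul, ← mul_smul, ← mul_smul,
      ← zpow_add, ← zpow_add]
    congr 2
    push_cast; ring
  have hρρ' : ρ = ρ' := Subtype.ext <| hΓ.trans <|
    (eq_of_zpow_smul_limPt hP.2 hc.1 hk (hΓ ▸ hr) (hΓ' ▸ hρr') hc'.1 hlim).trans hΓ'.symm
  subst hρρ'
  exact Subtype.ext (hρ.symm.trans hρ')

end TreePair

end

section

namespace TreePair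

variable {n : ℕ} {P : TreePair n} {α : V n}

theorem componentSupport_eq (c : P.NonTorsionComponent) :
    P.componentSupport α c = closure (flowSet α c) := rfl

theorem smul_mem_componentSupport_iff (c : P.NonTorsionComponent) (x : Cantor n) :
    α • x ∈ P.componentSupport α c ↔ x ∈ P.componentSupport α c := by
  have h : α • flowSet α c = flowSet α c := by
    ext x
    rw [Set.mem_smul_set_iff_inv_smul_mem, ← smul_mem_flowSet_iff, smul_inv_smul]
  rw [componentSupport_eq]
  conv_lhs => rw [← h, closure_smul]
  exact Set.smul_mem_smul_set_iff

variable [Nontrivial (Fin n)]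

theorem componentSupport_disjoint_torsionSet (hP : P.IsRevealingFor α)
    {c : P.NonTorsionComponent} {x : Cantor n} (hx : x ∈ P.componentSupport α c) (m : ℕ) :
    x ∉ torsionSet α m := by
  rw [← torsionSupport_eq hP]
  intro hm
  obtain ⟨y, hym, hy⟩ := mem_closure_iff.1 hx _ (P.isOpen_torsionSupport m) hm
  rw [torsionSupport_eq hP] at hym
  obtain ⟨u, v, ρ, hρ, a, hl, i, z, hz, rfl⟩ := mem_flowSet_iff.1 hy
  rw [smul_mem_torsionSet (Commute.zpow_left rfl i)] at hym
  exact hl.1.not_mem_torsionSet hP hz m hym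

theorem RootContracts.exists_cone_subset (hP : P.IsRevealingFor α) {w Γ : Node n} {e : ℤ}
    (h : P.RootContracts α w Γ e) :
    ∃ c : P.NonTorsionComponent, cone w ⊆ P.componentSupport α c ∧
      ∀ x ∈ cone w, x ≠ limPt w Γ → x ∈ flowSet α c := by
  obtain ⟨c, hc⟩ := h.exists_component hP
  refine ⟨c, fun x hx => ?_, hc⟩
  by_cases hne : x = limPt w Γ
  · subst hne
    refine mem_closure_iff.2 fun O hO hxO => ?_
    obtain ⟨y, hy, hyw, hne⟩ := h.1.exists_ne_limPt hO hxO
    exact ⟨y, hy, hc y hyw hne⟩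
  · exact subset_closure (hc x hx hne)

theorem IsSource.exists_mem_flowSet (hP : P.IsRevealingFor α) {u : Node n} (hu : P.IsSource u)
    (k : ℤ) {y : Cantor n} (hy : y ∈ cone u) :
    ∃ c : P.NonTorsionComponent, α ^ k • y ∈ flowSet α c := by
  obtain ⟨v, ρ, a, hl⟩ := hu.exists_isFlowLine hP.1
  obtain ⟨c, hρ, ha, h1, h2⟩ := hl.exists_component
  exact ⟨c, mem_flowSet_iff.2 ⟨u, v, ⟨ρ, hρ⟩, h1, a, hl, k, y, hy, rfl⟩⟩

theorem exists_mem_componentSupport (hP : P.IsRevealingFor α) {x : Cantor n}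
    (hx : ∀ m, x ∉ torsionSet α m) : ∃ c : P.NonTorsionComponent, x ∈ P.componentSupport α c := by
  rcases cover hP x with ⟨l, h⟩ | ⟨u, hu, k, y, hy, rfl⟩ | ⟨w, Γ, e, h, k, rfl⟩
  · exact absurd (torsionSupport_eq hP l ▸ h) (hx l)
  · obtain ⟨c, hc⟩ := hu.exists_mem_flowSet hP k hy
    exact ⟨c, subset_closure hc⟩
  · obtain ⟨c, hc, -⟩ := h.exists_cone_subset hP
    exact ⟨c, (zpow_smul_mem_iff (smul_mem_componentSupport_iff c) k _).2
      (hc (append_mem_cone _ _))⟩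

/-- The support of a component is a neighbourhood of each limit point of its flow lines, because
near a repelling or attracting point all other points lie on flow lines of one component. -/
theorem isClopen_componentSupport (hP : P.IsRevealingFor α) (c : P.NonTorsionComponent) :
    IsClopen (P.componentSupport α c) := by
  refine ⟨isClosed_closure, isOpen_iff_mem_nhds.2 fun x hx => ?_⟩
  rcases cover hP x with ⟨l, h⟩ | ⟨u, hu, k, y, hy, rfl⟩ | ⟨w, Γ, e, h, k, rfl⟩
  · exact absurd (torsionSupport_eq hP l ▸ h) (componentSupport_disjoint_torsionSet hP hx l)
  · obtain ⟨c', hc'⟩ := hu.exists_mem_flowSet hP k hy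
    obtain ⟨z, hz, hz'⟩ := mem_closure_iff.1 hx _ (isOpen_flowSet c') hc'
    obtain rfl := eq_of_flowSet_inter hP hz' hz
    exact Filter.mem_of_superset ((isOpen_flowSet c).mem_nhds hc') subset_closure
  · obtain ⟨c', hc', hc''⟩ := h.exists_cone_subset hP
    have hinv := zpow_smul_mem_iff (smul_mem_componentSupport_iff (α := α) c) k
    rw [hinv] at hx
    obtain ⟨z, hzw, hz⟩ := mem_closure_iff.1 hx _ (isClopen_cone w).isOpen (append_mem_cone w _)
    obtain rfl : c = c' := by
      by_cases hne : z = limPt w Γ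
      · subst hne
        obtain ⟨y, hy, hyw, hne⟩ := h.1.exists_ne_limPt (isOpen_flowSet c) hz
        exact eq_of_flowSet_inter hP hy (hc'' y hyw hne)
      · exact eq_of_flowSet_inter hP hz (hc'' z hzw hne)
    have : ∀ᶠ y in 𝓝 (limPt w Γ), α ^ k • y ∈ P.componentSupport α c :=
      Filter.mem_of_superset ((isClopen_cone w).isOpen.mem_nhds (append_mem_cone w _))
        fun y hy => (hinv y).2 (hc' hy)
    exact eventually_smul.2 this

end TreePair

/-! ### Atoms: the supports described in terms of `α` alone -/

/-- A minimal nonempty clopen `α`-invariant subset of the complement of the torsion part. -/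
structure IsInvAtom {n : ℕ} (α : V n) (X : Set (Cantor n)) : Prop where
  nonempty : X.Nonempty
  isClopen : IsClopen X
  smul_mem_iff : ∀ x, α • x ∈ X ↔ x ∈ X
  not_torsion : ∀ x ∈ X, ∀ m, x ∉ torsionSet α m
  minimal : ∀ Y ⊆ X, Y.Nonempty → IsClopen Y → (∀ x, α • x ∈ Y ↔ x ∈ Y) → Y = X

namespace IsInvAtom

variable {n : ℕ} {α g : V n} {X X' : Set (Cantor n)}

theorem eq_of_mem (h : IsInvAtom α X) (h' : IsInvAtom α X') {x : Cantor n} (hx : x ∈ X)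
    (hx' : x ∈ X') : X = X' := by
  have hc := h.isClopen.inter h'.isClopen
  have hi : ∀ x, α • x ∈ X ∩ X' ↔ x ∈ X ∩ X' := fun x =>
    and_congr (h.smul_mem_iff x) (h'.smul_mem_iff x)
  rw [← h.minimal _ Set.inter_subset_left ⟨x, hx, hx'⟩ hc hi,
    h'.minimal _ Set.inter_subset_right ⟨x, hx, hx'⟩ hc hi]

theorem smul (h : IsInvAtom α X) (hg : Commute g α) : IsInvAtom α (g • X) := by
  have hclopen : ∀ (g : V n) {Y : Set (Cantor n)}, IsClopen Y → IsClopen (g • Y) := fun g Y hY =>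
    ⟨hY.isClosed.smul g, hY.isOpen.smul g⟩
  have hinv : ∀ {g : V n}, Commute g α → ∀ {Y : Set (Cantor n)}, (∀ x, α • x ∈ Y ↔ x ∈ Y) →
      ∀ x, α • x ∈ g • Y ↔ x ∈ g • Y := by
    intro g hg Y hY x
    rw [Set.mem_smul_set_iff_inv_smul_mem, Set.mem_smul_set_iff_inv_smul_mem, ← mul_smul,
      hg.inv_left.eq, mul_smul, hY]
  refine ⟨h.nonempty.smul_set, hclopen g h.isClopen, hinv hg h.smul_mem_iff, ?_, ?_⟩
  · rintro _ ⟨x, hx, rfl⟩ m hm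
    exact h.not_torsion x hx m ((smul_mem_torsionSet hg).1 hm)
  · intro Y hY hne hYc hYi
    have := h.minimal (g⁻¹ • Y) (Set.smul_set_subset_iff_subset_inv_smul_set.2 (by
      rwa [_root_.inv_inv])) hne.smul_set (hclopen _ hYc) (hinv hg.inv_left hYi)
    rw [← this, smul_inv_smul]

variable [Nontrivial (Fin n)]

/-- The support of a component is minimal since a clopen invariant set that meets one of its flow
lines contains all of them. -/
theorem of_componentSupport {P : TreePair n} (hP : P.IsRevealingFor α)
    (c : P.NonTorsionComponent) : IsInvAtom α (P.componentSupport α c) where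
  nonempty := (TreePair.flowSet_nonempty hP c).closure
  isClopen := TreePair.isClopen_componentSupport hP c
  smul_mem_iff := TreePair.smul_mem_componentSupport_iff c
  not_torsion _ hx m := TreePair.componentSupport_disjoint_torsionSet hP hx m
  minimal Y hY hne hYc hYi := by
    refine hY.antisymm (closure_minimal ?_ hYc.isClosed)
    obtain ⟨y, hy⟩ := hne
    obtain ⟨z, hz, hz'⟩ := mem_closure_iff.1 (hY hy) _ hYc.isOpen hy
    exact TreePair.flowSet_subset_of_trapping hP (Trapping.of_isClopen hYc hYi) c ⟨z, hz', hz⟩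

theorem exists_component {P : TreePair n} (hP : P.IsRevealingFor α) (h : IsInvAtom α X) :
    ∃ c : P.NonTorsionComponent, P.componentSupport α c = X := by
  obtain ⟨x, hx⟩ := h.nonempty
  obtain ⟨c, hc⟩ := TreePair.exists_mem_componentSupport hP (h.not_torsion x hx)
  exact ⟨c, (of_componentSupport hP c).eq_of_mem h hc hx⟩

theorem componentSupport_injective {P : TreePair n} (hP : P.IsRevealingFor α) :
    Function.Injective (P.componentSupport α) := by
  intro c c' h
  obtain ⟨x, hx⟩ := TreePair.flowSet_nonempty hP c
  have hx' : x ∈ closure (TreePair.flowSet α c') := by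
    rw [← TreePair.componentSupport_eq, ← h]
    exact subset_closure hx
  obtain ⟨z, hz, hz'⟩ := mem_closure_iff.1 hx' _ (TreePair.isOpen_flowSet c) hx
  exact TreePair.eq_of_flowSet_inter hP hz hz'

theorem exists_mem {x : Cantor n} (hx : ∀ m, x ∉ torsionSet α m) :
    ∃ X, IsInvAtom α X ∧ x ∈ X := by
  obtain ⟨P, hP⟩ := TreePair.exists_isRevealingFor α
  obtain ⟨c, hc⟩ := TreePair.exists_mem_componentSupport hP hx
  exact ⟨_, of_componentSupport hP c, hc⟩

theorem finite (α : V n) : {X | IsInvAtom α X}.Finite := by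
  obtain ⟨P, hP⟩ := TreePair.exists_isRevealingFor α
  have hfin : Finite {u // P.IsFlowVertex u} := by
    refine Set.Finite.to_subtype (s := {u | P.IsFlowVertex u}) (Set.Finite.subset
      (P.dom.leaves.finite_toSet.union P.ran.leaves.finite_toSet) ?_)
    rintro u (h | h | ⟨m, h⟩)
    · exact Or.inl h.mem_dom
    · exact Or.inr (TreePair.isRepeller_inv.2 h).mem_dom
    · exact Or.inl h.mem_dom
  have hfin' : Finite P.flowGraph.ConnectedComponent := Quot.finite _
  refine (Set.finite_range (P.componentSupport α)).subset fun X hX => ?_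
  exact hX.exists_component hP

/-- An element of the centralizer that is the identity on a nonempty open subset of an atom is
the identity on the atom. -/
theorem smul_eq_of_fixInterior (h : IsInvAtom α X) (hg : Commute g α) {x : Cantor n} (hx : x ∈ X)
    (hgx : x ∈ fixInterior g) : ∀ y ∈ X, g • y = y := by
  obtain ⟨P, hP⟩ := TreePair.exists_isRevealingFor α
  obtain ⟨c, rfl⟩ := h.exists_component hP
  have ht := trapping_fixInterior hg
  obtain ⟨z, hz, hz'⟩ := mem_closure_iff.1 hx _ ht.isOpen hgx
  have hsub := TreePair.flowSet_subset_of_trapping hP ht c ⟨z, hz', hz⟩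
  have hcl : IsClosed {y : Cantor n | g • y = y} := isClosed_eq (continuous_smul g) continuous_id
  intro y hy
  exact closure_minimal (fun y hy => (hsub hy).self_of_nhds) hcl hy

/-- An atom contains a point with infinite orbit. -/
theorem exists_aperiodic (h : IsInvAtom α X) : ∃ x ∈ X, ∀ m : ℕ, 0 < m → α ^ m • x ≠ x := by
  obtain ⟨P, hP⟩ := TreePair.exists_isRevealingFor α
  obtain ⟨c, rfl⟩ := h.exists_component hP
  obtain ⟨x, hx⟩ := TreePair.flowSet_nonempty hP c
  obtain ⟨u, v, ρ, hρ, a, hl, k, y, hy, rfl⟩ := TreePair.mem_flowSet_iff.1 hx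
  refine ⟨y, (zpow_smul_mem_iff h.smul_mem_iff k y).1 (subset_closure hx), fun m hm =>
    hl.1.smul_ne hP hy hm⟩

end IsInvAtom

theorem Contracts.zpow_ne_zero {n : ℕ} [Nontrivial (Fin n)] {α : V n} {w Γ : Node n} {e : ℤ}
    (h : Contracts (α ^ e) w Γ) : e ≠ 0 := by
  rintro rfl
  have := (Pre.one w).right_unique (zpow_zero α ▸ h.2)
  exact h.1 (by simpa using this)

namespace IsInvAtom

variable {n : ℕ} [Nontrivial (Fin n)] {α g : V n} {X : Set (Cantor n)}

/-- An atom contains a point fixed by a nontrivial power of `α` that changes depths at it. -/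
theorem exists_limPt (h : IsInvAtom α X) :
    ∃ p ∈ X, ∃ e : ℤ, e ≠ 0 ∧ α ^ e • p = p ∧ disp (α ^ e) p ≠ 0 := by
  obtain ⟨P, hP⟩ := TreePair.exists_isRevealingFor α
  obtain ⟨c, rfl⟩ := h.exists_component hP
  obtain ⟨x, hx⟩ := TreePair.flowSet_nonempty hP c
  obtain ⟨u, v, ρ, hρ, a, hl, k, y, hy, rfl⟩ := TreePair.mem_flowSet_iff.1 hx
  obtain ⟨-, -, -, hρr, -, ⟨w, hw, h1, h2⟩, -⟩ := hl
  obtain ⟨Γ, l, -, -, -, hc⟩ := hρr.rootContracts hP.2 hw h2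
  have hyX : y ∈ P.componentSupport α c :=
    (zpow_smul_mem_iff h.smul_mem_iff k y).1 (subset_closure hx)
  refine ⟨limPt w Γ, (Trapping.of_isClopen h.isClopen h.smul_mem_iff).limPt_mem w Γ _ hc.1 y
    (cone_subset_of_prefix h1 hy) hyX, _, hc.1.zpow_ne_zero, hc.1.smul_limPt, ?_⟩
  rw [hc.1.2.disp_eq (x := limPt w Γ) (append_mem_cone _ _)]
  have := List.length_pos_iff.2 hc.1.1
  rw [List.length_append]; push_cast; omega

end IsInvAtom

/-- Outside the torsion part there are finitely many points with finite orbit. -/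
theorem finite_periodic {n : ℕ} [Nontrivial (Fin n)] (α : V n) :
    {x : Cantor n | (∀ m, x ∉ torsionSet α m) ∧ ∃ e : ℤ, e ≠ 0 ∧ α ^ e • x = x}.Finite := by
  obtain ⟨P, hP⟩ := TreePair.exists_isRevealingFor α
  let L : Set (Node n) := ↑P.dom.leaves ∪ ↑P.ran.leaves
  have hL : L.Finite := P.dom.leaves.finite_toSet.union P.ran.leaves.finite_toSet
  -- the repelling and attracting points
  let S : Set (Cantor n) := {p | ∃ w Γ e, P.RootContracts α w Γ e ∧ p = limPt w Γ}
  have hS : S.Finite := by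
    refine ((hL.prod hL).image fun p => limPt p.1 (p.2.drop p.1.length)).subset ?_
    rintro _ ⟨w, Γ, e, h, rfl⟩
    refine ⟨(w, w ++ Γ), ?_, by simp⟩
    rcases h.2 with ⟨h1, h2⟩ | ⟨h1, h2⟩
    · exact ⟨Or.inr h1.1, Or.inl h2.mem_dom⟩
    · exact ⟨Or.inl h1.1, Or.inr (TreePair.isRepeller_inv.2 h2).mem_dom⟩
  refine (hS.biUnion (t := fun p => Set.range fun k : ℤ => α ^ k • p) ?_).subset ?_
  · rintro _ ⟨w, Γ, e, h, rfl⟩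
    have he := h.1.zpow_ne_zero
    refine ((Set.finite_Ico (0 : ℤ) |e|).image fun k => α ^ k • limPt w Γ).subset ?_
    rintro _ ⟨k, rfl⟩
    refine ⟨k % e, ⟨Int.emod_nonneg k he, Int.emod_lt_abs k he⟩, ?_⟩
    have h1 : α ^ e ∈ MulAction.stabilizer (V n) (limPt w Γ) := h.1.smul_limPt
    have h2 : (α ^ e) ^ (k / e) • limPt w Γ = limPt w Γ := zpow_mem h1 (k / e)
    change α ^ (k % e) • limPt w Γ = α ^ k • limPt w Γ
    conv_rhs => rw [← Int.emod_add_mul_ediv k e, zpow_add, mul_smul, zpow_mul, h2]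
  · rintro x ⟨hx, i, hi, hix⟩
    rcases TreePair.cover hP x with ⟨l, h⟩ | ⟨u, hu, k, y, hy, rfl⟩ | ⟨w, Γ, e, h, k, rfl⟩
    · exact absurd (TreePair.torsionSupport_eq hP l ▸ h) (hx l)
    · exfalso
      have h1 : α ^ i • y = y := by
        rw [← mul_smul, ← zpow_add, add_comm, zpow_add, mul_smul] at hix
        exact smul_left_cancel _ hix
      have h2 : α ^ i.natAbs • y = y := by
        have h3 : α ^ i ∈ MulAction.stabilizer (V n) y := h1
        rw [← zpow_natCast]
        rcases Int.natAbs_eq i with h | h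
        · rw [← h]; exact h1
        · rw [show (i.natAbs : ℤ) = -i by omega, zpow_neg]
          exact inv_mem h3
      exact hu.smul_ne hP hy (Int.natAbs_pos.2 hi) h2
    · exact Set.mem_biUnion (show limPt w Γ ∈ S from ⟨w, Γ, e, h, rfl⟩) ⟨k, rfl⟩

end

/-! ### Groups with a central infinite cyclic subgroup of finite index -/

section

/-- A group with a central element of infinite order that generates a subgroup of finite index is
a semidirect product of its finite set of torsion elements with `ℤ`: some power map is a
homomorphism into that subgroup, by the transfer to the centre. -/
theorem exists_mulEquiv_byInt {G : Type} [Group G] (a : G) (hc : ∀ g, Commute g a)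
    (ha : ∀ m : ℕ, 0 < m → a ^ m ≠ 1) [hfi : (Subgroup.zpowers a).FiniteIndex] :
    ∃ (A : Type) (_ : Group A) (_ : Finite A) (φ : Multiplicative ℤ →* MulAut A)
      (e : G ≃* ByInt A φ), ∀ g, IsOfFinOrder g ↔ (e g).right = 1 := by
  have hle : Subgroup.zpowers a ≤ Subgroup.center G := by
    rw [Subgroup.zpowers_le, Subgroup.mem_center_iff]
    exact fun g => (hc g).eq
  have hcfi : (Subgroup.center G).FiniteIndex := Subgroup.finiteIndex_of_le hle
  have hnorm : (Subgroup.zpowers a).Normal := ⟨fun x hx g => by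
    rwa [(Subgroup.mem_center_iff.1 (hle hx) g : g * x = x * g), mul_inv_cancel_right]⟩
  have ha' : ∀ i : ℤ, a ^ i = 1 → i = 0 := by
    intro i hi
    by_contra hne
    refine ha i.natAbs (Int.natAbs_pos.2 hne) ?_
    rcases Int.natAbs_eq i with h | h
    · rw [← zpow_natCast, ← h, hi]
    · rw [← zpow_natCast, show (i.natAbs : ℤ) = -i by omega, zpow_neg, hi, inv_one]
  set d := (Subgroup.center G).index
  set k := (Subgroup.zpowers a).index
  have hd : ∀ g : G, ((MonoidHom.transferCenterPow G g : Subgroup.center G) : G) = g ^ d :=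
    fun g => MonoidHom.transferCenterPow_apply g
  -- `g ↦ g ^ d` is the transfer to the centre, and the `k`-th power then lands in `⟨a⟩`
  let f : G →* G :=
    { toFun := fun g => g ^ (d * k)
      map_one' := one_pow _
      map_mul' := fun g h => by
        have h1 : (g * h) ^ d = g ^ d * h ^ d := by
          rw [← hd, ← hd, ← hd, map_mul]; rfl
        have h2 : Commute (g ^ d) (h ^ d) := by
          have := (MonoidHom.transferCenterPow G g).2
          rw [hd] at this
          exact (Subgroup.mem_center_iff.1 this _).symm
        rw [pow_mul, h1, h2.mul_pow, pow_mul, pow_mul] }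
  have hf : ∀ g, f g = g ^ (d * k) := fun _ => rfl
  have hN : 0 < d * k := Nat.mul_pos (Nat.pos_of_ne_zero hcfi.index_ne_zero)
    (Nat.pos_of_ne_zero hfi.index_ne_zero)
  have hfa : ∀ g, f g ∈ Subgroup.zpowers a := fun g => by
    rw [hf, mul_comm, pow_mul]
    exact pow_mem (Subgroup.pow_index_mem _ g) d
  have htor : ∀ g, IsOfFinOrder g ↔ f g = 1 := by
    intro g
    refine ⟨fun hg => ?_, fun hg => isOfFinOrder_iff_pow_eq_one.2 ⟨_, hN, hg⟩⟩
    obtain ⟨i, hi⟩ := Subgroup.mem_zpowers_iff.1 (hfa g)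
    obtain ⟨m, hm, hgm⟩ := isOfFinOrder_iff_pow_eq_one.1 (f.isOfFinOrder hg)
    rw [← hi, ← zpow_natCast, ← zpow_mul] at hgm
    have := ha' _ hgm
    rcases mul_eq_zero.1 this with h | h
    · rw [← hi, h, zpow_zero]
    · omega
  have hfin : Finite f.ker := by
    have : Finite (G ⧸ Subgroup.zpowers a) := Subgroup.finite_quotient_of_finiteIndex
    refine Finite.of_injective (fun x : f.ker => (x.1 : G ⧸ Subgroup.zpowers a)) ?_
    intro x y hxy
    obtain ⟨i, hi⟩ := Subgroup.mem_zpowers_iff.1 (QuotientGroup.eq.1 hxy)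
    have h1 : f (x.1⁻¹ * y.1) = 1 := (x⁻¹ * y).2
    rw [← hi, hf, ← zpow_natCast, ← zpow_mul] at h1
    rcases mul_eq_zero.1 (ha' _ h1) with h | h
    · rw [h, zpow_zero] at hi
      exact Subtype.ext (inv_mul_eq_one.1 hi.symm)
    · omega
  -- the quotient by the kernel is infinite cyclic, so that the extension splits
  have hcyc : IsCyclic f.range := by
    have hr : f.range ≤ Subgroup.zpowers a := by
      rintro _ ⟨g, rfl⟩
      exact hfa g
    exact isCyclic_of_injective (Subgroup.inclusion hr) (Subgroup.inclusion_injective hr)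
  obtain ⟨⟨_, t, rfl⟩, ht⟩ := hcyc.exists_generator
  have ht' : ∀ g, ∃ i : ℤ, f t ^ i = f g := by
    intro g
    obtain ⟨i, hi⟩ := Subgroup.mem_zpowers_iff.1 (ht ⟨f g, g, rfl⟩)
    exact ⟨i, congrArg Subtype.val hi⟩
  have hinf : ∀ i : ℤ, f t ^ i = 1 → i = 0 := by
    intro i hi
    obtain ⟨j, hj⟩ := ht' a
    have : a ^ (((d * k : ℕ) : ℤ) * i) = 1 := by
      rw [zpow_mul, zpow_natCast, ← hf, ← hj, ← zpow_mul, mul_comm, zpow_mul, hi, one_zpow]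
    rcases mul_eq_zero.1 (ha' _ this) with h | h
    · omega
    · exact h
  let ψ : Multiplicative ℤ →* G := zpowersHom G t
  have hψ : ∀ i, ψ i = t ^ i.toAdd := fun i => zpowersHom_apply _ _ _
  let φ : Multiplicative ℤ →* MulAut f.ker := MulAut.conjNormal.comp ψ
  let L : ByInt f.ker φ →* G := SemidirectProduct.lift f.ker.subtype ψ (fun i => by
    ext x
    simp [φ, MulAut.conjNormal_apply])
  have hL : ∀ x, L x = x.left.1 * t ^ x.right.toAdd := fun x => by
    rw [← hψ]; rfl
  have hfL : ∀ x, f (L x) = f t ^ x.right.toAdd := fun x => by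
    have := x.left.2
    rw [MonoidHom.mem_ker] at this
    rw [hL, map_mul, this, one_mul, map_zpow]
  have hbij : Function.Bijective L := by
    constructor
    · refine (injective_iff_map_eq_one L).2 fun x hx => ?_
      have h1 := hfL x
      rw [hx, map_one] at h1
      have h2 : x.right = 1 := hinf _ h1.symm
      refine SemidirectProduct.ext (Subtype.ext ?_) h2
      rw [hL, h2] at hx
      simpa using hx
    · intro g
      obtain ⟨i, hi⟩ := ht' g
      refine ⟨⟨⟨g * t ^ (-i), ?_⟩, Multiplicative.ofAdd i⟩, ?_⟩
      · rw [MonoidHom.mem_ker, map_mul, map_zpow, ← hi, ← zpow_add, add_neg_cancel, zpow_zero]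
      · rw [hL]; simp
  refine ⟨f.ker, inferInstance, hfin, φ, (MulEquiv.ofBijective L hbij).symm, fun g => ?_⟩
  obtain ⟨x, rfl⟩ := hbij.2 g
  have : (MulEquiv.ofBijective L hbij).symm (L x) = x :=
    (MulEquiv.ofBijective L hbij).symm_apply_apply x
  rw [this, htor, hfL]
  exact ⟨hinf _, fun h => by rw [h]; simp⟩

/-! ### Elements of the centralizer supported on an atom -/

variable {n : ℕ} {α : V n} {X : Set (Cantor n)}

theorem mem_centralizer_iff {g : V n} : g ∈ centralizer α ↔ Commute g α := by
  rw [Subgroup.mem_centralizer_singleton_iff]; rfl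

theorem commute_of_centralizer (g : centralizer α) : Commute g.1 α := mem_centralizer_iff.1 g.2

theorem restrictedCentralizer_ext {f g : restrictedCentralizer α X}
    (h : ∀ x ∈ X, f.1 • x = g.1 • x) : f = g := by
  refine Subtype.ext (ext_smul fun x => ?_)
  by_cases hx : x ∈ X
  · exact h x hx
  · exact (f.2.2 x hx).trans (g.2.2 x hx).symm

theorem mem_of_smul_eq {g : V n} {Y Z : Set (Cantor n)} (h : g • Y = Z) (x : Cantor n) :
    g • x ∈ Z ↔ x ∈ Y := by
  rw [← h, Set.smul_mem_smul_set_iff]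

/-- An element of the centralizer that preserves a clopen invariant set can be restricted to
it. -/
theorem exists_restrict (hX : IsClopen X) (hα : ∀ x, α • x ∈ X ↔ x ∈ X) {g : V n}
    (hg : Commute g α) (hgX : g • X = X) :
    ∃ f : restrictedCentralizer α X, ∀ x ∈ X, f.1 • x = g • x := by
  have hgX' : g • Xᶜ = Xᶜ := by rw [Set.smul_set_compl, hgX]
  obtain ⟨f, hf⟩ := exists_glue (D := fun b : Bool => bif b then X else Xᶜ)
    (fun b => bif b then g else 1) (by
      rintro (_ | _)
      · exact hX.compl.isOpen
      · exact hX.isOpen)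
    (fun x => by
      by_cases hx : x ∈ X
      · exact ⟨true, hx⟩
      · exact ⟨false, hx⟩)
    (by
      rintro (_ | _) (_ | _) x hx hy
      · rfl
      · exact absurd hy hx
      · exact absurd hx hy
      · rfl)
    (fun x => by
      by_cases hx : x ∈ X
      · exact ⟨true, by simpa [hgX] using hx⟩
      · exact ⟨false, by simpa using hx⟩)
    (by
      rintro (_ | _) (_ | _) x hx hy
      · rfl
      · simp only [cond_true, cond_false, one_smul, hgX] at hx hy
        exact absurd hy hx
      · simp only [cond_true, cond_false, one_smul, hgX] at hx hy
        exact absurd hx hy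
      · rfl)
  have h1 : ∀ x ∈ X, f • x = g • x := hf true
  have h2 : ∀ x, x ∉ X → f • x = x := fun x hx => (hf false x hx).trans (one_smul _ x)
  refine ⟨⟨f, mem_centralizer_iff.2 (ext_smul fun x => ?_), h2⟩, h1⟩
  rw [mul_smul, mul_smul]
  by_cases hx : x ∈ X
  · rw [h1 _ ((hα x).2 hx), h1 x hx, ← mul_smul, hg.eq, mul_smul]
  · rw [h2 _ (fun h => hx ((hα x).1 h)), h2 x hx]

theorem disp_inv [Nontrivial (Fin n)] (g : V n) (x : Cantor n) :
    disp g⁻¹ (g • x) = - disp g x := by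
  have := disp_mul g⁻¹ g x
  rw [inv_mul_cancel, disp_one] at this
  omega

/-- At a fixed point the displacement is additive under powers. -/
theorem disp_zpow [Nontrivial (Fin n)] {g : V n} {x : Cantor n} (h : g • x = x) (k : ℤ) :
    disp (g ^ k) x = k * disp g x := by
  have hs : ∀ k : ℤ, g ^ k • x = x := fun k =>
    zpow_mem (show g ∈ MulAction.stabilizer (V n) x from h) k
  induction k with
  | zero => rw [zpow_zero, disp_one, zero_mul]
  | succ k ih => rw [zpow_add, disp_mul, zpow_one, h, ih]; ring
  | pred k ih =>
    have := disp_inv g x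
    rw [h] at this
    rw [sub_eq_add_neg, zpow_add, disp_mul, zpow_neg_one, inv_smul_eq_iff.2 h.symm, ih, this]
    ring

/-- The elements of the centralizer supported on an atom form a finite-by-cyclic group: up to
powers of `α`, such an element is determined by the image of a repelling periodic point and the
displacement there. -/
theorem IsInvAtom.exists_mulEquiv_byInt [Nontrivial (Fin n)] (h : IsInvAtom α X) :
    ∃ (A : Type) (_ : Group A) (_ : Finite A) (φ : Multiplicative ℤ →* MulAut A)
      (e : restrictedCentralizer α X ≃* ByInt A φ), ∀ g, IsOfFinOrder g ↔ (e g).right = 1 := by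
  have hαX : α • X = X := by
    ext x
    rw [Set.mem_smul_set_iff_inv_smul_mem, ← h.smul_mem_iff, smul_inv_smul]
  obtain ⟨a, ha⟩ := exists_restrict h.isClopen h.smul_mem_iff (Commute.refl α) hαX
  have hgX : ∀ (g : restrictedCentralizer α X), ∀ x ∈ X, g.1 • x ∈ X := by
    intro g x hx
    by_contra hcon
    have := g.2.2 _ hcon
    exact hcon (by rwa [smul_left_cancel g.1 this])
  have hcomm : ∀ g : restrictedCentralizer α X, Commute g.1 α := fun g =>
    mem_centralizer_iff.1 g.2.1
  have hpow : ∀ m : ℤ, ∀ x ∈ X, (a ^ m).1 • x = α ^ m • x := by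
    have hiff := fun m : ℤ => zpow_smul_mem_iff h.smul_mem_iff m
    intro m
    induction m with
    | zero => intro x _; rw [zpow_zero, zpow_zero]; rfl
    | succ k ih =>
      intro x hx
      rw [zpow_add, zpow_add, zpow_one, zpow_one, mul_smul, Subgroup.coe_mul, mul_smul, ha x hx,
        ih _ ((h.smul_mem_iff x).2 hx)]
    | pred k ih =>
      intro x hx
      have h1 : α⁻¹ • x ∈ X := by simpa using (hiff (-1) x).2 hx
      have h2 : a⁻¹.1 • x = α⁻¹ • x := by
        rw [Subgroup.coe_inv, inv_smul_eq_iff, ha _ h1, smul_inv_smul]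
      rw [sub_eq_add_neg, zpow_add, zpow_add, zpow_neg_one, zpow_neg_one, mul_smul,
        Subgroup.coe_mul, mul_smul, h2, ih _ h1]
  have hac : ∀ g, Commute g a := by
    intro g
    refine restrictedCentralizer_ext fun x hx => ?_
    rw [Subgroup.coe_mul, Subgroup.coe_mul, mul_smul, mul_smul, ha x hx, ha _ (hgX g x hx),
      ← mul_smul, ← mul_smul, (hcomm g).eq]
  have hainf : ∀ m : ℕ, 0 < m → a ^ m ≠ 1 := by
    intro m hm hone
    obtain ⟨x, hx, hne⟩ := h.exists_aperiodic
    have := hpow m x hx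
    rw [zpow_natCast, zpow_natCast, hone] at this
    exact hne m hm this.symm
  obtain ⟨p, hp, e, he, hfix, hd⟩ := h.exists_limPt
  let S := {x : Cantor n | (∀ m, x ∉ torsionSet α m) ∧ ∃ e : ℤ, e ≠ 0 ∧ α ^ e • x = x}
  have hS : Finite S := (finite_periodic α).to_subtype
  have hgS : ∀ g : restrictedCentralizer α X, g.1 • p ∈ S := fun g =>
    ⟨h.not_torsion _ (hgX g p hp), e, he, by
      rw [← mul_smul, ← ((hcomm g).zpow_right e).eq, mul_smul, hfix]⟩
  have hD : NeZero (disp (α ^ e) p).natAbs := ⟨Int.natAbs_ne_zero.2 hd⟩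
  -- the image of `p` determines `g` near `p` up to the displacement, and `α ^ e` changes the latter by
  -- a fixed nonzero amount
  let F : restrictedCentralizer α X → S × ZMod (disp (α ^ e) p).natAbs := fun g =>
    (⟨g.1 • p, hgS g⟩, (disp g.1 p : ℤ))
  have hF : ∀ g g', F g = F g' → g⁻¹ * g' ∈ Subgroup.zpowers a := by
    intro g g' hgg
    have h1 : g.1 • p = g'.1 • p := congrArg Subtype.val (Prod.ext_iff.1 hgg).1
    have h2 : ((disp g.1 p : ℤ) : ZMod (disp (α ^ e) p).natAbs) = (disp g'.1 p : ℤ) :=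
      (Prod.ext_iff.1 hgg).2
    rw [ZMod.intCast_eq_intCast_iff_dvd_sub, Int.natAbs_dvd] at h2
    obtain ⟨k, hk⟩ := h2
    have hc : Commute (g.1⁻¹ * g'.1 * (α ^ e) ^ (-k)) α :=
      ((hcomm g).inv_left.mul_left (hcomm g')).mul_left
        (((Commute.refl α).zpow_left e).zpow_left _)
    have hs : (α ^ e) ^ (-k) • p = p :=
      zpow_mem (show α ^ e ∈ MulAction.stabilizer (V n) p from hfix) (-k)
    have hfix' : (g.1⁻¹ * g'.1 * (α ^ e) ^ (-k)) • p = p := by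
      rw [mul_smul, mul_smul, hs, ← h1, inv_smul_smul]
    have hdisp : disp (g.1⁻¹ * g'.1 * (α ^ e) ^ (-k)) p = 0 := by
      rw [disp_mul, hs, disp_mul, ← h1, disp_inv, disp_zpow hfix]
      linarith
    obtain ⟨u, hu, hpre⟩ := exists_pre_self_of_disp_eq_zero hfix' hdisp
    have hint : p ∈ fixInterior (g.1⁻¹ * g'.1 * (α ^ e) ^ (-k)) := by
      refine Filter.mem_of_superset ((isClopen_cone u).isOpen.mem_nhds hu) ?_
      rintro _ ⟨z, rfl⟩
      exact hpre z
    have hid := h.smul_eq_of_fixInterior hc hp hint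
    refine Subgroup.mem_zpowers_iff.2 ⟨e * k, restrictedCentralizer_ext fun x hx => ?_⟩
    rw [hpow _ x hx]
    have h3 := hid _ ((zpow_smul_mem_iff h.smul_mem_iff (e * k) x).2 hx)
    rw [mul_smul, zpow_neg, zpow_mul, inv_smul_smul] at h3
    rw [zpow_mul, ← h3]; rfl
  have hfin : Finite (restrictedCentralizer α X ⧸ Subgroup.zpowers a) := by
    refine Finite.of_injective (fun x => F (Quotient.out x)) fun x y hxy => ?_
    rw [← QuotientGroup.out_eq' x, ← QuotientGroup.out_eq' y]
    exact QuotientGroup.eq.2 (hF _ _ hxy)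
  have hfi : (Subgroup.zpowers a).FiniteIndex := Subgroup.finiteIndex_of_finite_quotient
  exact HT.exists_mulEquiv_byInt a hac hainf

/-- Conjugation by an element of the centralizer. -/
theorem exists_conj_restrictedCentralizer {f : V n} (hf : Commute f α) {X' : Set (Cantor n)}
    (h : f • X = X') :
    Nonempty (restrictedCentralizer α X ≃* restrictedCentralizer α X') := by
  have key : ∀ {f : V n} {X X' : Set (Cantor n)}, Commute f α → f • X = X' →
      ∀ g ∈ restrictedCentralizer α X, f * g * f⁻¹ ∈ restrictedCentralizer α X' := by
    intro f X X' hf h g hg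
    refine ⟨mem_centralizer_iff.2 ((hf.mul_left (mem_centralizer_iff.1 hg.1)).mul_left
      hf.inv_left), fun x hx => ?_⟩
    have : f⁻¹ • x ∉ X := fun h' => hx (h ▸ Set.mem_smul_set_iff_inv_smul_mem.2 h')
    have h1 : g • f⁻¹ • x = f⁻¹ • x := hg.2 _ this
    change (f * g * f⁻¹) • x = x
    rw [mul_smul, mul_smul, h1, smul_inv_smul]
  have h' : f⁻¹ • X' = X := by rw [← h, inv_smul_smul]
  exact ⟨{
    toFun := fun g => ⟨f * g.1 * f⁻¹, key hf h g.1 g.2⟩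
    invFun := fun g => ⟨f⁻¹ * g.1 * f, by simpa using key hf.inv_left h' g.1 g.2⟩
    left_inv := fun g => Subtype.ext (by simp [mul_assoc])
    right_inv := fun g => Subtype.ext (by simp [mul_assoc])
    map_mul' := fun g g' => Subtype.ext (by simp [mul_assoc]) }⟩

end

/-! ### The wreath product acting on a class of isomorphic supports -/

section

variable {n : ℕ} {α : V n}

/-- Restriction to `X` of the elements of the centralizer that preserve `X`. -/
theorem exists_restrictHom {X : Set (Cantor n)} (hX : IsClopen X)
    (hα : ∀ x, α • x ∈ X ↔ x ∈ X) :
    ∃ ρ : MulAction.stabilizer (centralizer α) X →* restrictedCentralizer α X,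
      ∀ g, ∀ x ∈ X, (ρ g).1 • x = g.1.1 • x := by
  have hg : ∀ g : MulAction.stabilizer (centralizer α) X, g.1.1 • X = X := fun g => g.2
  choose ρ hρ using fun g : MulAction.stabilizer (centralizer α) X =>
    exists_restrict hX hα (commute_of_centralizer g.1) (hg g)
  refine ⟨⟨⟨ρ, ?_⟩, ?_⟩, hρ⟩
  · exact restrictedCentralizer_ext fun x hx => hρ 1 x hx
  · intro g h
    refine restrictedCentralizer_ext fun x hx => (hρ _ x hx).trans ?_
    change (g.1.1 * h.1.1) • x = ((ρ g).1 * (ρ h).1) • x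
    rw [mul_smul, mul_smul, hρ h x hx, hρ g _ ((mem_of_smul_eq (hg h) x).2 hx)]

/-- The centralizer maps onto the wreath product of the restricted centralizer of one of `q`
supports, which it permutes transitively, with the symmetric group. With `f i` carrying a base
support `X₀` onto `X i`, the `j`-th coordinate of the image of `g` is the restriction to `X₀` of
`(f j)⁻¹ g (f i)`, where `g` carries `X i` to `X j`. -/
theorem exists_wreathHom {B : Type} [Group B] {q : ℕ} (σ : centralizer α →* Equiv.Perm (Fin q))
    {X : Fin q → Set (Cantor n)} {X₀ : Set (Cantor n)} (hX₀ : X₀.Nonempty)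
    (hcl : IsClopen X₀) (hinv : ∀ x, α • x ∈ X₀ ↔ x ∈ X₀)
    (hdis : ∀ i j x, x ∈ X i → x ∈ X j → i = j)
    (hσ : ∀ (g : centralizer α) i, g.1 • X i = X (σ g i))
    (f : Fin q → centralizer α) (hf : ∀ i, (f i).1 • X₀ = X i)
    (e : restrictedCentralizer α X₀ ≃* B) :
    ∃ Θ : centralizer α →* Wreath B q, (∀ g, (Θ g).right = σ g) ∧
      (∀ g, Θ g = 1 ↔ ∀ i, ∀ x ∈ X i, g.1 • x = x) ∧ Function.Surjective Θ := by
  classical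
  obtain ⟨ρ, hρ⟩ := exists_restrictHom hcl hinv
  have hne : ∀ i, (X i).Nonempty := fun i => hf i ▸ hX₀.smul_set
  have hXcl : ∀ i, IsClopen (X i) := fun i => by
    rw [← hf i]; exact ⟨hcl.isClosed.smul _, hcl.isOpen.smul _⟩
  have hXinj : ∀ i j, X i = X j → i = j := fun i j h => by
    obtain ⟨x, hx⟩ := hne i
    exact hdis i j x hx (h ▸ hx)
  have hfinv : ∀ i, (f i).1⁻¹ • X i = X₀ := fun i => by rw [← hf i, inv_smul_smul]
  have hσinv : ∀ (g : centralizer α) j, σ g ((σ g)⁻¹ j) = j := fun g j =>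
    (σ g).apply_symm_apply j
  let c : centralizer α → Fin q → centralizer α := fun g j => (f j)⁻¹ * g * f ((σ g)⁻¹ j)
  have hc : ∀ g j, c g j ∈ MulAction.stabilizer (centralizer α) X₀ := by
    intro g j
    change ((f j).1⁻¹ * g.1 * (f ((σ g)⁻¹ j)).1) • X₀ = X₀
    rw [mul_smul, mul_smul, hf, hσ, hσinv, hfinv]
  let L : centralizer α → Fin q → B := fun g j => e (ρ ⟨c g j, hc g j⟩)
  have hL : ∀ g h j, L (g * h) j = L g j * L h ((σ g)⁻¹ j) := by
    intro g h j
    change e (ρ _) = e (ρ _) * e (ρ _)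
    rw [← e.map_mul, ← ρ.map_mul]
    refine congrArg (fun z => e (ρ z)) (Subtype.ext ?_)
    change (f j)⁻¹ * (g * h) * f ((σ (g * h))⁻¹ j) = ((f j)⁻¹ * g * f ((σ g)⁻¹ j)) *
      ((f ((σ g)⁻¹ j))⁻¹ * h * f ((σ h)⁻¹ ((σ g)⁻¹ j)))
    rw [map_mul, mul_inv_rev, Equiv.Perm.mul_apply]
    group
  let Θ : centralizer α →* Wreath B q := MonoidHom.mk' (fun g => ⟨L g, σ g⟩) fun g h =>
    SemidirectProduct.ext (funext fun j => hL g h j) (map_mul σ g h)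
  -- the action of `g` on the support `X i` in terms of the coordinates of its image
  have hact : ∀ g j, ∀ x ∈ X₀, g.1 • (f ((σ g)⁻¹ j)).1 • x =
      (f j).1 • (e.symm (L g j)).1 • x := by
    intro g j x hx
    rw [MulEquiv.symm_apply_apply, hρ _ x hx]
    simp [c, mul_smul]
  refine ⟨Θ, fun g => rfl, fun g => ⟨fun hg i x hx => ?_, fun hg => ?_⟩, fun w => ?_⟩
  · have h1 : L g i = 1 := congrFun (congrArg SemidirectProduct.left hg) i
    have h2 : σ g = 1 := congrArg SemidirectProduct.right hg
    have := hact g i ((f i).1⁻¹ • x) (hfinv i ▸ Set.smul_mem_smul_set hx)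
    rw [h1, h2, map_one, inv_one, Equiv.Perm.one_apply, smul_inv_smul] at this
    rw [this]
    exact smul_inv_smul _ _
  · have h2 : σ g = 1 := by
      refine Equiv.ext fun i => hXinj _ _ ?_
      rw [← hσ, Equiv.Perm.one_apply]
      ext x
      constructor
      · rintro ⟨y, hy, rfl⟩
        change g.1 • y ∈ X i
        rwa [hg i y hy]
      · intro hx
        exact ⟨x, hx, hg i x hx⟩
    refine SemidirectProduct.ext (funext fun j => ?_) h2
    change L g j = 1
    refine (map_eq_one_iff e e.injective).2 (restrictedCentralizer_ext fun x hx => ?_)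
    rw [hρ _ x hx]
    have h3 : (f j).1 • x ∈ X j := hf j ▸ Set.smul_mem_smul_set hx
    simp only [c, h2, inv_one, Equiv.Perm.one_apply, Subgroup.coe_mul, mul_smul, hg j _ h3]
    exact inv_smul_smul _ _
  · obtain ⟨F, τ⟩ := w
    have hτ : ∀ i, τ (τ⁻¹ i) = i := τ.apply_symm_apply
    have hkX : ∀ (k : restrictedCentralizer α X₀), k.1 • X₀ = X₀ := by
      have h1 : ∀ (k : restrictedCentralizer α X₀), ∀ x ∈ X₀, k.1 • x ∈ X₀ := by
        intro k x hx
        by_contra hcon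
        have := k.2.2 _ hcon
        exact hcon (by rwa [smul_left_cancel k.1 this])
      intro k
      ext x
      constructor
      · rintro ⟨y, hy, rfl⟩; exact h1 k y hy
      · intro hx
        rw [Set.mem_smul_set_iff_inv_smul_mem]
        exact h1 k⁻¹ x hx
    -- the element of the centralizer that carries `X i` to `X (τ i)` with prescribed coordinate
    let G : Fin q → V n := fun i => (f (τ i)).1 * (e.symm (F (τ i))).1 * (f i).1⁻¹
    have hGX : ∀ i, G i • X i = X (τ i) := by
      intro i
      rw [mul_smul, mul_smul, hfinv, hkX, hf]
    have hGα : ∀ i, Commute (G i) α := fun i =>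
      ((commute_of_centralizer _).mul_left (mem_centralizer_iff.1 (e.symm (F (τ i))).2.1)).mul_left
        (commute_of_centralizer (f i)).inv_left
    let D : Option (Fin q) → Set (Cantor n) := fun o => o.elim (⋃ i, X i)ᶜ X
    let G' : Option (Fin q) → V n := fun o => o.elim 1 G
    have hnone : ∀ i x, x ∈ D none → x ∈ X i → False := fun i x h1 h2 =>
      h1 (Set.mem_iUnion.2 ⟨i, h2⟩)
    obtain ⟨g, hg⟩ := exists_glue (D := D) G' (by
        rintro (_ | i)
        · exact (isClosed_iUnion_of_finite fun i => (hXcl i).isClosed).isOpen_compl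
        · exact (hXcl i).isOpen)
      (fun x => by
        by_cases hx : x ∈ ⋃ i, X i
        · obtain ⟨i, hi⟩ := Set.mem_iUnion.1 hx
          exact ⟨some i, hi⟩
        · exact ⟨none, hx⟩)
      (by
        rintro (_ | i) (_ | j) x hx hy
        · rfl
        · exact (hnone j x hx hy).elim
        · exact (hnone i x hy hx).elim
        · rw [hdis i j x hx hy])
      (fun x => by
        by_cases hx : x ∈ ⋃ i, X i
        · obtain ⟨i, hi⟩ := Set.mem_iUnion.1 hx
          refine ⟨some (τ⁻¹ i), ?_⟩
          change x ∈ G (τ⁻¹ i) • X (τ⁻¹ i)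
          rwa [hGX, hτ]
        · refine ⟨none, ?_⟩
          change x ∈ (1 : V n) • D none
          rwa [one_smul])
      (by
        have h1 : ∀ x, x ∈ G' none • D none → x ∈ D none := fun x hx => by
          simpa [G'] using hx
        have h2 : ∀ i x, x ∈ G' (some i) • D (some i) → x ∈ X (τ i) := fun i x hx =>
          hGX i ▸ hx
        rintro (_ | i) (_ | j) x hx hy
        · rfl
        · exact (hnone _ x (h1 x hx) (h2 j x hy)).elim
        · exact (hnone _ x (h1 x hy) (h2 i x hx)).elim
        · rw [τ.injective (hdis _ _ x (h2 i x hx) (h2 j x hy))])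
    have hg1 : ∀ i, ∀ x ∈ X i, g • x = G i • x := fun i => hg (some i)
    have hg2 : ∀ x, x ∉ ⋃ i, X i → g • x = x := fun x hx =>
      (hg none x hx).trans (one_smul _ x)
    have hαX : ∀ i x, α • x ∈ X i ↔ x ∈ X i := by
      intro i x
      rw [← hf i, Set.mem_smul_set_iff_inv_smul_mem, Set.mem_smul_set_iff_inv_smul_mem,
        ← mul_smul, (commute_of_centralizer (f i)).inv_left.eq, mul_smul, hinv]
    have hgc : g ∈ centralizer α := by
      refine mem_centralizer_iff.2 (ext_smul fun x => ?_)
      rw [mul_smul, mul_smul]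
      by_cases hx : x ∈ ⋃ i, X i
      · obtain ⟨i, hi⟩ := Set.mem_iUnion.1 hx
        rw [hg1 i _ ((hαX i x).2 hi), hg1 i x hi, ← mul_smul, (hGα i).eq, mul_smul]
      · rw [hg2 x hx, hg2]
        intro h
        obtain ⟨i, hi⟩ := Set.mem_iUnion.1 h
        exact hx (Set.mem_iUnion.2 ⟨i, (hαX i x).1 hi⟩)
    refine ⟨⟨g, hgc⟩, ?_⟩
    have hστ : σ ⟨g, hgc⟩ = τ := by
      refine Equiv.ext fun i => hXinj _ _ ?_
      rw [← hσ, ← hGX]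
      exact Set.image_congr fun x hx => hg1 i x hx
    refine SemidirectProduct.ext (funext fun j => ?_) hστ
    change L ⟨g, hgc⟩ j = F j
    rw [← e.symm.injective.eq_iff]
    refine restrictedCentralizer_ext fun x hx => ?_
    have h1 := hact ⟨g, hgc⟩ j x hx
    rw [hστ] at h1
    refine smul_left_cancel (f j).1 (h1.symm.trans ?_)
    have h2 : (f (τ⁻¹ j)).1 • x ∈ X (τ⁻¹ j) := hf _ ▸ Set.smul_mem_smul_set hx
    change g • _ = _
    rw [hg1 _ _ h2]
    simp only [G, mul_smul, inv_smul_smul, hτ]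

end

/-! ### The cycles of periodic neutral leaves -/

section

variable {n : ℕ}

namespace TreePair

variable {P : TreePair n} {α : V n}

theorem Reach.split {k l : ℕ} {u w : Node n} (h : P.Reach (k + l) u w) :
    ∃ v, P.Reach k u v ∧ P.Reach l v w := by
  obtain ⟨c, rfl, rfl, h⟩ := h
  exact ⟨c k, ⟨c, rfl, rfl, fun j hj => h j (by omega)⟩, fun j => c (k + j), rfl, rfl,
    fun j hj => h _ (by omega)⟩

theorem reflTransGen_iff {u v : Node n} :
    Relation.ReflTransGen P.Step u v ↔ ∃ k, P.Reach k u v := by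
  rw [Relation.reflTransGen_iff_eq_or_transGen, transGen_iff]
  constructor
  · rintro (rfl | ⟨k, -, h⟩)
    · exact ⟨0, Reach.zero _⟩
    · exact ⟨k, h⟩
  · rintro ⟨k, h⟩
    rcases k.eq_zero_or_pos with rfl | hk
    · exact Or.inl (reach_zero.1 h).symm
    · exact Or.inr ⟨k, hk, h⟩

theorem IsPeriodicLeaf.reach_mul {m : ℕ} {u : Node n} (h : P.IsPeriodicLeaf m u) (t : ℕ) :
    P.Reach (m * t) u u := by
  induction t with
  | zero => exact Reach.zero u
  | succ t ih => exact ih.trans h.reach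

theorem IsPeriodicLeaf.reach_symm {m k : ℕ} {u v : Node n} (h : P.IsPeriodicLeaf m u)
    (hr : P.Reach k u v) : ∃ l, P.Reach l v u := by
  have h1 := h.reach_mul k
  have hk : k ≤ m * k := Nat.le_mul_of_pos_left k h.1
  rw [← Nat.add_sub_of_le hk] at h1
  obtain ⟨w, hw, hwu⟩ := h1.split
  obtain rfl := hr.right_unique hw
  exact ⟨_, hwu⟩

theorem IsPeriodicLeaf.not_reach {m k : ℕ} {u : Node n} (h : P.IsPeriodicLeaf m u) (hk : 0 < k)
    (hkm : k < m) : ¬ P.Reach k u u := fun hr => by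
  obtain ⟨-, c, h0, -, hne, hs⟩ := h
  exact hne k hk hkm (Reach.right_unique ⟨c, h0, rfl, fun j _ => hs j⟩ hr)

/-- A choice of one leaf on each cycle of length `m`. -/
theorem exists_cycle_leaves (P : TreePair n) (m : ℕ) :
    ∃ u : Fin (P.numCycles m) → Node n, (∀ i, P.IsPeriodicLeaf m (u i)) ∧
      (∀ v, P.IsPeriodicLeaf m v → ∃ i k, P.Reach k (u i) v) ∧
      ∀ i j k l v, P.Reach k (u i) v → P.Reach l (u j) v → i = j := by
  let S : Set (Set (Node n)) := {S | ∃ u, P.IsPeriodicLeaf m u ∧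
    S = {v | Relation.ReflTransGen P.Step u v}}
  have hS : S.Finite := by
    refine ((P.dom.leaves.finite_toSet).image
      fun u => {v | Relation.ReflTransGen P.Step u v}).subset ?_
    rintro _ ⟨u, hu, rfl⟩
    exact ⟨u, hu.mem_dom, rfl⟩
  have := hS.to_subtype
  have E : Fin (P.numCycles m) ≃ S := (Finite.equivFin S).symm
  choose u hu hu' using fun i => (E i).2
  refine ⟨u, hu, fun v hv => ?_, fun i j k l v hi hj => ?_⟩
  · refine ⟨E.symm ⟨_, v, hv, rfl⟩, reflTransGen_iff.1 ?_⟩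
    have h1 := hu' (E.symm ⟨_, v, hv, rfl⟩)
    rw [Equiv.apply_symm_apply] at h1
    have h2 : v ∈ {w | Relation.ReflTransGen P.Step v w} := Relation.ReflTransGen.refl
    have h1 : {w | Relation.ReflTransGen P.Step v w} = {w | Relation.ReflTransGen P.Step
      (u (E.symm ⟨_, v, hv, rfl⟩)) w} := h1
    rw [h1] at h2
    exact h2
  · obtain ⟨i', hi'⟩ := (hu i).reach_symm hi
    obtain ⟨j', hj'⟩ := (hu j).reach_symm hj
    have hij := reflTransGen_iff.2 ⟨_, hi.trans hj'⟩
    have hji := reflTransGen_iff.2 ⟨_, hj.trans hi'⟩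
    refine E.injective (Subtype.ext ((hu' i).trans (Eq.trans ?_ (hu' j).symm)))
    ext w
    exact ⟨fun h => hji.trans h, fun h => hij.trans h⟩

end TreePair

/-- Coordinates on the torsion part of period `m`: it is the disjoint union of the translates
under `α ^ k`, for `k` modulo `m`, of the `r` disjoint cones under the nodes `root i`. -/
structure TorsionChart (α : V n) (m r : ℕ) [NeZero m] where
  root : Fin r → Node n
  pre_root : ∀ i, Pre (α ^ m) (root i) (root i)
  inj : ∀ (k l : ZMod m) i j x y, α ^ k.val • append (root i) x = α ^ l.val • append (root j) y →
    k = l ∧ i = j ∧ x = y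
  mem_iff : ∀ x, x ∈ torsionSet α m ↔ ∃ (k : ZMod m) (i : Fin r) (y : Cantor n),
    x = α ^ k.val • append (root i) y

/-- The roots of a chart are leaves chosen on the cycles, one on each cycle of length `m`. -/
theorem TreePair.exists_torsionChart [Nontrivial (Fin n)] {P : TreePair n} {α : V n}
    (hP : P.IsRevealingFor α) (m : ℕ) [NeZero m] :
    Nonempty (TorsionChart α m (P.numCycles m)) := by
  obtain ⟨u, hu, hcov, hdis⟩ := P.exists_cycle_leaves m
  have hchain : ∀ i k, ∃ v, P.Reach k (u i) v ∧ v ∈ P.dom.leaves := by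
    intro i k
    obtain ⟨-, c, h0, -, -, hs⟩ := hu i
    exact ⟨c k, ⟨c, h0, rfl, fun j _ => hs j⟩, (hs k).dom⟩
  have hpow : ∀ i, Pre (α ^ m) (u i) (u i) := fun i => (hu i).reach.pre hP.2
  refine ⟨⟨u, hpow, ?_, fun x => ?_⟩⟩
  · intro k l i j x y h
    obtain ⟨v, hv, hvd⟩ := hchain i k.val
    obtain ⟨w, hw, hwd⟩ := hchain j l.val
    rw [hv.pre hP.2, hw.pre hP.2] at h
    obtain rfl := leaf_unique P.dom v hvd w hwd x y h
    obtain rfl := hdis i j _ _ v hv hw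
    have key : ∀ {k l : ZMod m}, P.Reach k.val (u i) v → P.Reach l.val (u i) v →
        ¬ k.val < l.val := by
      intro k l hk hl hlt
      have hl' : P.Reach ((l.val - k.val) + k.val) (u i) v := by
        rwa [Nat.sub_add_cancel hlt.le]
      obtain ⟨w, hw1, hw2⟩ := hl'.split
      obtain rfl := hk.left_unique hw2
      have := ZMod.val_lt l
      exact (hu i).not_reach (by omega) (by omega) hw1
    refine ⟨ZMod.val_injective m (le_antisymm (not_lt.1 (key hw hv)) (not_lt.1 (key hv hw))), rfl,
      append_injective _ h⟩
  · rw [← TreePair.torsionSupport_eq hP]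
    constructor
    · rintro ⟨v, y, hv, rfl⟩
      obtain ⟨i, k, hr⟩ := hcov v hv
      refine ⟨(k : ZMod m), i, y, ?_⟩
      rw [← hr.pre hP.2, ZMod.val_natCast]
      conv_lhs => rw [← Nat.mod_add_div k m, pow_add, mul_smul]
      congr 1
      have h1 : ∀ t : ℕ, (α ^ m) ^ t • append (u i) y = append (u i) y := fun t =>
        pow_mem (show α ^ m ∈ MulAction.stabilizer (V n) (append (u i) y) from hpow i y) t
      rw [pow_mul, h1]
    · rintro ⟨k, i, y, rfl⟩
      rw [TreePair.torsionSupport_eq hP, smul_mem_torsionSet (Commute.pow_left rfl _),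
        ← TreePair.torsionSupport_eq hP]
      exact ⟨u i, y, hu i, rfl⟩

/-! ### Prefix replacements on several copies of the Cantor set -/

/-- Below `u`, along any path, an element eventually replaces a prefix. -/
theorem exists_pre_extend (g : V n) (u : Node n) (y : Cantor n) :
    ∃ N, ∀ k, N ≤ k → ∃ v, Pre g (u ++ pre y k) v := by
  obtain ⟨p, q, hp, hpq⟩ := exists_pre g (append u y)
  refine ⟨p.length, fun k hk => ?_⟩
  have hmem : append u y ∈ cone (u ++ pre y k) :=
    ⟨fun i => y (i + k), by rw [append_append, append_pre]⟩
  obtain ⟨t, ht⟩ := prefix_of_mem_cone hp hmem (by rw [List.length_append, length_pre]; omega)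
  exact ⟨q ++ t, ht ▸ hpq.append t⟩

/-- If `g` carries a point below `u` to a point below `v`, it replaces the prefix of a descendant of
`u` by that of a descendant of `v`. -/
theorem exists_pre_of_mem_cone {g : V n} {u v : Node n} {x : Cantor n}
    (hv : g • append u x ∈ cone v) : ∃ s t, x ∈ cone s ∧ Pre g (u ++ s) (v ++ t) := by
  obtain ⟨N, hN⟩ := exists_pre_extend g u x
  obtain ⟨w, hw⟩ := hN N le_rfl
  have hmem : ∀ l, append u x ∈ cone (u ++ pre x N ++ pre (fun i => x (i + N)) l) := fun l =>
    ⟨fun i => x (i + l + N), by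
      rw [append_append, append_append, append_pre (fun i => x (i + N)) l, append_pre]⟩
  have h1 := hw.append (pre (fun i => x (i + N)) v.length)
  obtain ⟨t, ht⟩ := prefix_of_mem_cone hv (h1.smul_mem (hmem _))
    (by rw [List.length_append, length_pre]; omega)
  rw [List.append_assoc] at h1
  refine ⟨_, t, ?_, ht ▸ h1⟩
  obtain ⟨z, hz⟩ := hmem v.length
  rw [List.append_assoc, append_append] at hz
  exact ⟨z, append_injective u hz⟩

/-- A bijection of `r` copies of the Cantor set that locally replaces prefixes is an element of the
Higman–Thompson group. -/
theorem exists_higmanThompson_of_bijective {r : ℕ} {f : Fin r × Cantor n → Fin r × Cantor n}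
    (hb : Function.Bijective f)
    (hf : ∀ i z, ∃ u j v, z ∈ cone u ∧ ∀ x, f (i, append u x) = (j, append v x)) :
    ∃ h : HigmanThompson n r, ∀ z, h.1 z = f z := by
  have hcont : ∀ {f : Fin r × Cantor n → Fin r × Cantor n},
      (∀ i z, ∃ u j v, z ∈ cone u ∧ ∀ x, f (i, append u x) = (j, append v x)) → Continuous f := by
    intro f hf
    refine continuous_prod_of_discrete_left.2 fun i => continuous_iff_continuousAt.2 fun z => ?_
    obtain ⟨u, j, v, hz, h⟩ := hf i z
    have hc : ContinuousOn (fun x => f (i, x)) (cone u) := by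
      have : ∀ x ∈ cone u, f (i, x) = (j, append v fun k => x (u.length + k)) := by
        rintro _ ⟨y, rfl⟩
        simp only [append_apply_add]
        exact h y
      refine ContinuousOn.congr (Continuous.continuousOn ?_) this
      exact continuous_const.prodMk
        ((continuous_append v).comp (continuous_pi fun i => continuous_apply _))
    exact hc.continuousAt ((isClopen_cone u).isOpen.mem_nhds hz)
  let e := Equiv.ofBijective f hb
  have hinv : ∀ i z, ∃ u j v, z ∈ cone u ∧ ∀ x, e.symm (i, append u x) = (j, append v x) := by
    intro i z
    obtain ⟨⟨j, x⟩, hx⟩ := e.surjective (i, z)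
    obtain ⟨u, i', v, ⟨y, rfl⟩, h⟩ := hf j x
    obtain ⟨rfl, h2⟩ := Prod.ext_iff.1 ((h y).symm.trans hx)
    refine ⟨v, j, u, ⟨y, h2⟩, fun x => ?_⟩
    rw [Equiv.symm_apply_eq]
    exact (h x).symm
  let h : (Fin r × Cantor n) ≃ₜ (Fin r × Cantor n) :=
    { e with
      continuous_toFun := hcont hf
      continuous_invFun := hcont hinv }
  refine ⟨⟨h, (represents_iff_locallyPrefix _).2 fun i z => ?_⟩, fun _ => rfl⟩
  obtain ⟨u, j, v, ⟨y, rfl⟩, h⟩ := hf i z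
  exact ⟨u, y, j, v, rfl, h⟩

/-! ### The action of the centralizer on the torsion part -/

namespace TorsionChart

variable {α : V n} {m r : ℕ} [NeZero m] (T : TorsionChart α m r)

/-- The point with coordinates `k` and `(i, x)`. -/
def point (k : ZMod m) (z : Fin r × Cantor n) : Cantor n := α ^ k.val • append (T.root z.1) z.2

theorem point_injective {k l : ZMod m} {z w : Fin r × Cantor n} (h : T.point k z = T.point l w) :
    k = l ∧ z = w := by
  obtain ⟨h1, h2, h3⟩ := T.inj _ _ _ _ _ _ h
  exact ⟨h1, Prod.ext h2 h3⟩

theorem point_mem (k : ZMod m) (z : Fin r × Cantor n) : T.point k z ∈ torsionSet α m :=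
  (T.mem_iff _).2 ⟨k, z.1, z.2, rfl⟩

theorem exists_point {x : Cantor n} (hx : x ∈ torsionSet α m) : ∃ k z, x = T.point k z := by
  obtain ⟨k, i, y, h⟩ := (T.mem_iff x).1 hx
  exact ⟨k, (i, y), h⟩

theorem pow_smul_point (l : ℕ) (k : ZMod m) (z : Fin r × Cantor n) :
    α ^ l • T.point k z = T.point (k + l) z := by
  have h1 : ∀ t : ℕ, (α ^ m) ^ t • append (T.root z.1) z.2 = append (T.root z.1) z.2 := fun t =>
    pow_mem (show α ^ m ∈ MulAction.stabilizer (V n) (append (T.root z.1) z.2) from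
      T.pre_root z.1 z.2) t
  have h2 : ((k.val + l : ℕ) : ZMod m) = k + l := by
    push_cast; rw [ZMod.natCast_zmod_val]
  rw [point, point, ← h2, ZMod.val_natCast, ← mul_smul, ← pow_add, add_comm l]
  conv_lhs => rw [← Nat.mod_add_div (k.val + l) m, pow_add, mul_smul, pow_mul, h1]

theorem smul_point (k : ZMod m) (z : Fin r × Cantor n) : α • T.point k z = T.point (k + 1) z := by
  have := T.pow_smul_point 1 k z
  rwa [pow_one, Nat.cast_one] at this

theorem point_eq_pow_smul (k : ZMod m) (z : Fin r × Cantor n) :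
    T.point k z = α ^ k.val • T.point 0 z := by
  rw [pow_smul_point, zero_add, ZMod.natCast_zmod_val]

theorem point_zero (z : Fin r × Cantor n) : T.point 0 z = append (T.root z.1) z.2 := by
  rw [point, ZMod.val_zero, pow_zero, one_smul]

theorem exists_coord (g : centralizer α) (z : Fin r × Cantor n) :
    ∃ p : ZMod m × (Fin r × Cantor n), g.1 • T.point 0 z = T.point p.1 p.2 := by
  have h := (smul_mem_torsionSet (commute_of_centralizer g)).2 (T.point_mem 0 z)
  obtain ⟨k, w, hw⟩ := T.exists_point h
  exact ⟨(k, w), hw⟩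

/-- An element of the centralizer carries `point 0 z` to `point (shift g z) (base g z)`. -/
noncomputable def shift (g : centralizer α) (z : Fin r × Cantor n) : ZMod m :=
  (T.exists_coord g z).choose.1

/-- The map that an element of the centralizer induces on the orbits in the torsion part. -/
noncomputable def base (g : centralizer α) (z : Fin r × Cantor n) : Fin r × Cantor n :=
  (T.exists_coord g z).choose.2

theorem smul_point_eq (g : centralizer α) (k : ZMod m) (z : Fin r × Cantor n) :
    g.1 • T.point k z = T.point (k + T.shift g z) (T.base g z) := by
  have h : g.1 • T.point 0 z = T.point (T.shift g z) (T.base g z) :=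
    (T.exists_coord g z).choose_spec
  rw [point_eq_pow_smul, ← mul_smul, ((commute_of_centralizer g).pow_right _).eq, mul_smul, h,
    pow_smul_point, ZMod.natCast_zmod_val, add_comm]

theorem coord_unique {g : centralizer α} {k l : ZMod m} {z w : Fin r × Cantor n}
    (h : g.1 • T.point k z = T.point (k + l) w) : T.shift g z = l ∧ T.base g z = w := by
  rw [smul_point_eq] at h
  obtain ⟨h1, h2⟩ := T.point_injective h
  exact ⟨add_left_cancel h1, h2⟩

theorem coord_one (z : Fin r × Cantor n) : T.shift 1 z = 0 ∧ T.base 1 z = z :=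
  T.coord_unique (k := 0) (by rw [zero_add]; exact one_smul _ _)

theorem coord_mul (g h : centralizer α) (z : Fin r × Cantor n) :
    T.shift (g * h) z = T.shift h z + T.shift g (T.base h z) ∧
      T.base (g * h) z = T.base g (T.base h z) := by
  refine T.coord_unique (k := 0) ?_
  rw [Subgroup.coe_mul, mul_smul, smul_point_eq, smul_point_eq, add_assoc]

theorem base_inv_base (g : centralizer α) (z : Fin r × Cantor n) :
    T.base g⁻¹ (T.base g z) = z := by
  rw [← (T.coord_mul g⁻¹ g z).2, inv_mul_cancel, (T.coord_one z).2]

theorem base_base_inv (g : centralizer α) (z : Fin r × Cantor n) :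
    T.base g (T.base g⁻¹ z) = z := by
  rw [← (T.coord_mul g g⁻¹ z).2, mul_inv_cancel, (T.coord_one z).2]

theorem shift_inv (g : centralizer α) (z : Fin r × Cantor n) :
    - T.shift g⁻¹ z = T.shift g (T.base g⁻¹ z) := by
  have := (T.coord_mul g g⁻¹ z).1
  rw [mul_inv_cancel, (T.coord_one z).1] at this
  exact neg_eq_of_add_eq_zero_right this.symm

/-- Locally the induced map replaces a prefix and the shift is constant. -/
theorem exists_pre_base (g : centralizer α) (i : Fin r) (z : Cantor n) :
    ∃ u j v, z ∈ cone u ∧ ∀ x, T.base g (i, append u x) = (j, append v x) ∧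
      T.shift g (i, append u x) = T.shift g (i, z) := by
  have h := T.smul_point_eq g 0 (i, z)
  rw [zero_add, T.point_eq_pow_smul (T.shift g (i, z)), ← inv_smul_eq_iff, ← mul_smul] at h
  set k := T.shift g (i, z)
  set j := (T.base g (i, z)).1
  rw [point_zero, point_zero] at h
  obtain ⟨s, t, hs, hst⟩ := exists_pre_of_mem_cone (u := T.root i) (x := z)
    (h ▸ append_mem_cone (T.root j) _)
  refine ⟨s, j, t, hs, fun x => ?_⟩
  have h1 := hst x
  rw [append_append, append_append, mul_smul, inv_smul_eq_iff] at h1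
  have h2 : g.1 • T.point 0 (i, append s x) = T.point (0 + k) (j, append t x) := by
    rw [zero_add, point_eq_pow_smul _ k, point_zero, point_zero]
    exact h1
  exact (T.coord_unique h2).symm

/-- The induced maps are elements of the Higman–Thompson group. -/
theorem exists_baseHom : ∃ W : centralizer α → HigmanThompson n r,
    ∀ g z, (W g).1 z = T.base g z := by
  choose W hW using fun g : centralizer α => exists_higmanThompson_of_bijective
    (f := T.base g) ⟨Function.LeftInverse.injective (T.base_inv_base g),
      Function.RightInverse.surjective (T.base_base_inv g)⟩ (fun i z => by
        obtain ⟨u, j, v, hz, h⟩ := T.exists_pre_base g i z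
        exact ⟨u, j, v, hz, fun x => (h x).1⟩)
  exact ⟨W, hW⟩

theorem continuous_shift (g : centralizer α) (i : Fin r) :
    Continuous fun x => T.shift g (i, x) := by
  refine continuous_iff_continuousAt.2 fun z => ?_
  obtain ⟨u, j, v, hz, h⟩ := T.exists_pre_base g i z
  refine tendsto_nhds_of_eventually_eq ?_
  refine Filter.mem_of_superset ((isClopen_cone u).isOpen.mem_nhds hz) ?_
  rintro _ ⟨x, rfl⟩
  exact (h x).2

theorem isClosed_torsionSet (T : TorsionChart α m r) : IsClosed (torsionSet α m) := by
  have : torsionSet α m = ⋃ (k : ZMod m) (i : Fin r), α ^ k.val • cone (T.root i) := by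
    ext x
    simp only [T.mem_iff, Set.mem_iUnion]
    constructor
    · rintro ⟨k, i, y, rfl⟩
      exact ⟨k, i, Set.smul_mem_smul_set (append_mem_cone _ _)⟩
    · rintro ⟨k, i, _, ⟨y, rfl⟩, rfl⟩
      exact ⟨k, i, y, rfl⟩
  have hfin : Finite (ZMod m) := inferInstance
  rw [this]
  exact isClosed_iUnion_of_finite fun k => isClosed_iUnion_of_finite fun i =>
    (isClopen_cone _).isClosed.smul _

/-- Every pair of a continuous map `f` and an element `h` of the Higman–Thompson group comes from
an element of the centralizer. -/
theorem exists_centralizer (f : K n m r) (h : HigmanThompson n r) :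
    ∃ g : centralizer α, ∀ z, T.base g z = h.1 z ∧
      T.shift g z = (uncurryK f (h.1 z)).toAdd := by
  classical
  let c : Fin r × Cantor n → ZMod m := fun z => (uncurryK f z).toAdd
  -- the permutation with the prescribed effect in the coordinates of the chart
  let e : Equiv.Perm (ZMod m × (Fin r × Cantor n)) :=
    { toFun := fun p => (p.1 + c (h.1 p.2), h.1 p.2)
      invFun := fun p => (p.1 - c p.2, h.1.symm p.2)
      left_inv := fun p => Prod.ext (add_sub_cancel_right _ _) (h.1.symm_apply_apply _)
      right_inv := fun p => Prod.ext (by simp) (h.1.apply_symm_apply _) }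
  have hJ : Function.Injective fun p : ZMod m × (Fin r × Cantor n) => T.point p.1 p.2 :=
    fun p q hpq => Prod.ext (T.point_injective hpq).1 (T.point_injective hpq).2
  let E := Equiv.ofInjective _ hJ
  let F : Equiv.Perm (Cantor n) := e.extendDomain E
  have hF : ∀ k z, F (T.point k z) = T.point (k + c (h.1 z)) (h.1 z) := fun k z =>
    Equiv.Perm.extendDomain_apply_image e E (k, z)
  have hF' : ∀ x, x ∉ torsionSet α m → F x = x := fun x hx =>
    Equiv.Perm.extendDomain_apply_not_subtype e E (by
      rintro ⟨p, rfl⟩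
      exact hx (T.point_mem _ _))
  have hloc : LocPre F := by
    intro x
    by_cases hx : x ∈ torsionSet α m
    · obtain ⟨k, ⟨i, z⟩, rfl⟩ := T.exists_point hx
      obtain ⟨s, y, j, t, rfl, hst⟩ := (represents_iff_locallyPrefix _).1 h.2 i z
      have hO : IsOpen {x | c (j, append t x) = c (j, append t y)} := by
        have hcont : Continuous fun x => f j (append t x) :=
          (f j).continuous.comp (continuous_append t)
        exact (isOpen_discrete {f j (append t y)}).preimage hcont
      obtain ⟨N₀, hN₀⟩ := exists_cone_subset hO (x := y) rfl
      obtain ⟨N₁, hN₁⟩ := exists_pre_extend (α ^ k.val) (T.root i ++ s) y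
      obtain ⟨N₂, hN₂⟩ := exists_pre_extend (α ^ (k + c (j, append t y)).val) (T.root j ++ t) y
      set N := max N₀ (max N₁ N₂)
      obtain ⟨v, hv⟩ := hN₁ N (by omega)
      obtain ⟨v', hv'⟩ := hN₂ N (by omega)
      have hpt : ∀ x, T.point k (i, append s (append (pre y N) x)) = append v x := fun x => by
        rw [← hv x, append_append, append_append]; rfl
      refine ⟨v, v', ⟨fun l => y (l + N), ?_⟩, fun x => ?_⟩
      · rw [← hpt, append_pre]
      · have hc : c (j, append t (append (pre y N) x)) = c (j, append t y) := by
          refine hN₀ ?_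
          have := append_mem_cone (pre y N) x
          rw [mem_cone_pre_iff] at this ⊢
          exact fun i hi => this i (by omega)
        rw [← hpt, hF, hst, hc, ← hv' x, append_append, append_append]; rfl
    · obtain ⟨k, hk⟩ := exists_cone_subset T.isClosed_torsionSet.isOpen_compl hx
      exact ⟨_, _, mem_cone_pre x k, fun y => hF' _ (hk (append_mem_cone _ _))⟩
  obtain ⟨g, hg⟩ := exists_V_of_bijective F.bijective hloc
  have hgc : Commute g α := by
    refine ext_smul fun x => ?_
    rw [mul_smul, mul_smul, hg, hg]
    by_cases hx : x ∈ torsionSet α m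
    · obtain ⟨k, z, rfl⟩ := T.exists_point hx
      rw [smul_point, hF, hF, smul_point, add_right_comm]
    · rw [hF' x hx, hF' _ (fun h => hx ((smul_mem_torsionSet (Commute.refl α)).1 h))]
  refine ⟨⟨g, mem_centralizer_iff.2 hgc⟩, fun z => ?_⟩
  exact (T.coord_unique (k := 0) ((hg _).trans (hF 0 z))).symm

/-- The centralizer acts on the torsion part of period `m` through `K_m ⋊ G_{n,r}`: an element
permutes the orbits as an element of `G_{n,r}`, and the shifts along the orbits form a continuous map
to `ℤ_m`. -/
theorem exists_torsionHom (T : TorsionChart α m r) : ∃ Ψ : centralizer α →* TorsionFactor n m r,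
    Function.Surjective Ψ ∧ ∀ g, Ψ g = 1 ↔ ∀ x ∈ torsionSet α m, g.1 • x = x := by
  obtain ⟨W, hW⟩ := T.exists_baseHom
  have hWsymm : ∀ g z, (W g).1.symm z = T.base g⁻¹ z := by
    intro g z
    rw [Homeomorph.symm_apply_eq, hW, T.base_base_inv]
  -- the shift of `g` at the point that `g` carries to `(i, x)`, that is `(x ↦ shift g x) ∘ g⁻¹`,
  -- written through `shift_inv`
  let F : centralizer α → K n m r := fun g i =>
    ⟨fun x => Multiplicative.ofAdd (- T.shift g⁻¹ (i, x)),
      (continuous_of_discreteTopology (f := fun k : ZMod m => Multiplicative.ofAdd (-k))).comp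
        (T.continuous_shift g⁻¹ i)⟩
  have hWmul : ∀ g h, W (g * h) = W g * W h := fun g h => by
    refine Subtype.ext (Homeomorph.ext fun z => ?_)
    change (W (g * h)).1 z = (W g).1 ((W h).1 z)
    rw [hW, hW, hW, (T.coord_mul g h z).2]
  let Ψ : centralizer α →* TorsionFactor n m r := MonoidHom.mk' (fun g => ⟨F g, W g⟩) fun g h => by
    refine SemidirectProduct.ext (funext fun i => ContinuousMap.ext fun x => ?_) (hWmul g h)
    change Multiplicative.ofAdd (- T.shift (g * h)⁻¹ (i, x)) =
      Multiplicative.ofAdd (- T.shift g⁻¹ (i, x)) *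
        Multiplicative.ofAdd (- T.shift h⁻¹ ((W g).1.symm (i, x)))
    rw [mul_inv_rev, (T.coord_mul h⁻¹ g⁻¹ (i, x)).1, hWsymm, neg_add, ofAdd_add]
  refine ⟨Ψ, fun ⟨f, h⟩ => ?_, fun g => ⟨fun hg x hx => ?_, fun hg => ?_⟩⟩
  · obtain ⟨g, hg⟩ := T.exists_centralizer f h
    refine ⟨g, SemidirectProduct.ext (funext fun i => ContinuousMap.ext fun x => ?_)
      (Subtype.ext (Homeomorph.ext fun z => ?_))⟩
    · change Multiplicative.ofAdd (- T.shift g⁻¹ (i, x)) = f i x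
      rw [T.shift_inv, (hg _).2, ← (hg _).1, T.base_base_inv]; rfl
    · exact (hW g z).trans (hg z).1
  · obtain ⟨k, z, rfl⟩ := T.exists_point hx
    have h1 : ∀ z, T.base g z = z := fun z => by
      rw [← hW, show W g = 1 from congrArg SemidirectProduct.right hg]; rfl
    have h2 : T.shift g⁻¹ z = 0 := by
      have : F g z.1 z.2 = 1 := by
        rw [show F g = 1 from congrArg SemidirectProduct.left hg]; rfl
      exact neg_eq_zero.1 this
    have h3 : T.base g⁻¹ z = z := by
      conv_lhs => rw [← h1 z]
      exact T.base_inv_base g z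
    have h4 := T.shift_inv g z
    rw [h2, h3, neg_zero] at h4
    rw [T.smul_point_eq, ← h4, h1, add_zero]
  · have hginv : ∀ z, T.shift g⁻¹ z = 0 ∧ T.base g⁻¹ z = z := fun z => by
      refine T.coord_unique (k := 0) ?_
      rw [zero_add, Subgroup.coe_inv, inv_smul_eq_iff, hg _ (T.point_mem 0 z)]
    refine SemidirectProduct.ext (funext fun i => ContinuousMap.ext fun x => ?_)
      (Subtype.ext (Homeomorph.ext fun z => ?_))
    · change Multiplicative.ofAdd (- T.shift g⁻¹ (i, x)) = 1
      rw [(hginv _).1]; simp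
    · change (W g).1 z = z
      rw [hW]
      conv_lhs => rw [← (hginv z).2]
      exact T.base_base_inv g z

end TorsionChart

end

/-! ### Assembling the centralizer from its action on the invariant pieces -/

section

section

variable {n : ℕ} {α : V n}

/-- Elements of the centralizer can be prescribed independently on the members of an open
partition into sets invariant under the centralizer. -/
theorem exists_centralizer_glue {ι : Type*} {D : ι → Set (Cantor n)} (hD : ∀ i, IsOpen (D i))
    (hcov : ∀ x, ∃ i, x ∈ D i) (hdis : ∀ i j x, x ∈ D i → x ∈ D j → i = j)
    (hinv : ∀ i (g : centralizer α) x, g.1 • x ∈ D i ↔ x ∈ D i) (g : ι → centralizer α) :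
    ∃ f : centralizer α, ∀ i, ∀ x ∈ D i, f.1 • x = (g i).1 • x := by
  have himg : ∀ i, (g i).1 • D i = D i := fun i => by
    ext x
    rw [Set.mem_smul_set_iff_inv_smul_mem, ← hinv i (g i), smul_inv_smul]
  obtain ⟨f, hf⟩ := exists_glue (fun i => (g i).1) hD hcov hdis
    (fun x => (hcov x).imp fun i hi => by rwa [himg]) (fun i j x hi hj => by
      rw [himg] at hi hj
      exact hdis i j x hi hj)
  refine ⟨⟨f, mem_centralizer_iff.2 (ext_smul fun x => ?_)⟩, hf⟩
  obtain ⟨i, hi⟩ := hcov x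
  have hα : α • x ∈ D i := (hinv i ⟨α, mem_centralizer_iff.2 (Commute.refl α)⟩ x).2 hi
  rw [mul_smul, mul_smul, hf i x hi, hf i _ hα, ← mul_smul, (commute_of_centralizer (g i)).eq,
    mul_smul]

/-- If the action of the centralizer on each member of an open invariant partition factors
faithfully through a surjection onto a group, then the centralizer is the product of these
groups. -/
theorem exists_mulEquiv_prod {ι κ : Type*} {D : ι → Set (Cantor n)} {E : κ → Set (Cantor n)}
    (hD : ∀ i, IsOpen (D i)) (hE : ∀ j, IsOpen (E j))
    (hcov : ∀ x, (∃ i, x ∈ D i) ∨ ∃ j, x ∈ E j)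
    (hDD : ∀ i i' x, x ∈ D i → x ∈ D i' → i = i') (hEE : ∀ j j' x, x ∈ E j → x ∈ E j' → j = j')
    (hDE : ∀ i j x, x ∈ D i → x ∉ E j)
    (hDinv : ∀ i (g : centralizer α) x, g.1 • x ∈ D i ↔ x ∈ D i)
    (hEinv : ∀ j (g : centralizer α) x, g.1 • x ∈ E j ↔ x ∈ E j)
    {G : ι → Type*} {H : κ → Type*} [∀ i, Group (G i)] [∀ j, Group (H j)]
    (Ψ : ∀ i, centralizer α →* G i) (Θ : ∀ j, centralizer α →* H j)
    (hΨs : ∀ i, Function.Surjective (Ψ i)) (hΘs : ∀ j, Function.Surjective (Θ j))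
    (hΨ : ∀ i g, Ψ i g = 1 ↔ ∀ x ∈ D i, g.1 • x = x)
    (hΘ : ∀ j g, Θ j g = 1 ↔ ∀ x ∈ E j, g.1 • x = x) :
    ∃ Φ : centralizer α ≃* (∀ i, G i) × (∀ j, H j),
      (∀ g i, (Φ g).1 i = Ψ i g) ∧ ∀ g j, (Φ g).2 j = Θ j g := by
  let F : centralizer α →* (∀ i, G i) × (∀ j, H j) := (MonoidHom.pi Ψ).prod (MonoidHom.pi Θ)
  have hF : Function.Bijective F := by
    constructor
    · refine (injective_iff_map_eq_one F).2 fun g hg => Subtype.ext (ext_smul fun x => ?_)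
      rcases hcov x with ⟨i, hi⟩ | ⟨j, hj⟩
      · exact (hΨ i g).1 (congrFun (congrArg Prod.fst hg) i) x hi
      · exact (hΘ j g).1 (congrFun (congrArg Prod.snd hg) j) x hj
    · rintro ⟨a, b⟩
      choose gD hgD using fun i => hΨs i (a i)
      choose gE hgE using fun j => hΘs j (b j)
      obtain ⟨f, hf⟩ := exists_centralizer_glue (D := Sum.elim D E)
        (by rintro (i | j); exacts [hD i, hE j])
        (fun x => by
          rcases hcov x with ⟨i, hi⟩ | ⟨j, hj⟩
          · exact ⟨Sum.inl i, hi⟩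
          · exact ⟨Sum.inr j, hj⟩)
        (by
          rintro (i | j) (i' | j') x h h'
          · exact congrArg _ (hDD i i' x h h')
          · exact absurd h' (hDE i j' x h)
          · exact absurd h (hDE i' j x h')
          · exact congrArg _ (hEE j j' x h h'))
        (by rintro (i | j); exacts [hDinv i, hEinv j]) (Sum.elim gD gE)
      refine ⟨f, Prod.ext (funext fun i => ?_) (funext fun j => ?_)⟩
      · have : Ψ i ((gD i)⁻¹ * f) = 1 := (hΨ i _).2 fun x hx => by
          have h1 : f.1 • x = (gD i).1 • x := hf (Sum.inl i) x hx
          rw [Subgroup.coe_mul, Subgroup.coe_inv, mul_smul, h1, inv_smul_smul]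
        rw [map_mul, map_inv, inv_mul_eq_one, hgD] at this
        exact this.symm
      · have : Θ j ((gE j)⁻¹ * f) = 1 := (hΘ j _).2 fun x hx => by
          have h1 : f.1 • x = (gE j).1 • x := hf (Sum.inr j) x hx
          rw [Subgroup.coe_mul, Subgroup.coe_inv, mul_smul, h1, inv_smul_smul]
        rw [map_mul, map_inv, inv_mul_eq_one, hgE] at this
        exact this.symm
  exact ⟨MulEquiv.ofBijective F hF, fun _ _ => rfl, fun _ _ => rfl⟩

/-- A group acts by permutations on an enumerated invariant subset. -/
theorem exists_permHom {G X : Type*} [Group G] [MulAction G X] {p : X → Prop}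
    (hp : ∀ (g : G) x, p x → p (g • x)) {q : ℕ} (enum : Fin q ≃ {x // p x}) :
    ∃ σ : G →* Equiv.Perm (Fin q), ∀ g i, (enum (σ g i)).1 = g • (enum i).1 := by
  let F : G →* Function.End (Fin q) :=
    { toFun := fun g i => enum.symm ⟨g • (enum i).1, hp g _ (enum i).2⟩
      map_one' := funext fun i => by simp; rfl
      map_mul' := fun g h => funext fun i => by
        change _ = enum.symm _
        simp [mul_smul] }
  refine ⟨F.toHomPerm, fun g i => ?_⟩
  change (enum (enum.symm _)).1 = _
  rw [Equiv.apply_symm_apply]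

/-- The centralizer permutes the atoms. -/
instance : MulAction (centralizer α) {X // IsInvAtom α X} where
  smul g X := ⟨g.1 • X.1, X.2.smul (commute_of_centralizer g)⟩
  one_smul X := Subtype.ext (one_smul (V n) X.1)
  mul_smul g h X := Subtype.ext (mul_smul g.1 h.1 X.1)

variable [Nontrivial (Fin n)]

instance : Finite {X // IsInvAtom α X} := (IsInvAtom.finite α).to_subtype

/-- Conjugating to `γ * α * γ⁻¹` makes the number of cycles in any revealing pair for a conjugate
available as the rank of a Higman–Thompson group for `α` itself. -/
theorem TreePair.exists_torsionHom {γ : V n} {Q : TreePair n}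
    (hQ : Q.IsRevealingFor (γ * α * γ⁻¹)) {m : ℕ} (hm : 0 < m) :
    ∃ Ψ : centralizer α →* TorsionFactor n m (Q.numCycles m),
      Function.Surjective Ψ ∧ ∀ g, Ψ g = 1 ↔ ∀ x ∈ torsionSet α m, g.1 • x = x := by
  have : NeZero m := ⟨hm.ne'⟩
  obtain ⟨T⟩ := TreePair.exists_torsionChart hQ m
  obtain ⟨Ψ, hΨs, hΨ⟩ := T.exists_torsionHom
  have hconj : ∀ {δ β g : V n}, Commute g β → Commute (δ * g * δ⁻¹) (δ * β * δ⁻¹) :=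
    fun {δ β g} h => by
      have := h.map (MulAut.conj δ)
      simpa using this
  let c : centralizer α →* centralizer (γ * α * γ⁻¹) :=
    ((MulAut.conj γ).toMonoidHom.comp (centralizer α).subtype).codRestrict _ fun g =>
      mem_centralizer_iff.2 (hconj (commute_of_centralizer g))
  have hc : ∀ g, (c g).1 = γ * g.1 * γ⁻¹ := fun _ => rfl
  refine ⟨Ψ.comp c, hΨs.comp fun g => ?_, fun g => ?_⟩
  · have h := hconj (δ := γ⁻¹) (commute_of_centralizer g)
    refine ⟨⟨γ⁻¹ * g.1 * γ⁻¹⁻¹, mem_centralizer_iff.2 ?_⟩, Subtype.ext ?_⟩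
    · simpa [mul_assoc] using h
    · rw [hc]; group
  · rw [MonoidHom.comp_apply, hΨ]
    constructor
    · intro h x hx
      have := h _ (smul_mem_torsionSet_conj.2 hx)
      rw [hc, mul_smul, mul_smul, inv_smul_smul] at this
      exact smul_left_cancel γ this
    · intro h x hx
      obtain ⟨y, rfl⟩ : ∃ y, γ • y = x := ⟨γ⁻¹ • x, smul_inv_smul _ _⟩
      rw [hc, mul_smul, mul_smul, inv_smul_smul, h y (smul_mem_torsionSet_conj.1 hx)]

theorem TreePair.finite_cycleLengths {P : TreePair n} (hP : P.IsRevealingFor α) :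
    P.cycleLengths.Finite := by
  obtain ⟨a, -⟩ := exists_pair_ne (Fin n)
  have h : ∀ m : P.cycleLengths, ∃ u : P.dom.leaves, P.IsPeriodicLeaf m u := fun m => by
    obtain ⟨u, hu⟩ := m.2
    exact ⟨⟨u, hu.mem_dom⟩, hu⟩
  choose u hu using h
  have hinj : Function.Injective u := fun m l hml => by
    have hmem : ∀ k : P.cycleLengths, append (u k) (fun _ => a) ∈ torsionSet α k :=
      fun k => by
        rw [← TreePair.torsionSupport_eq hP]
        exact ⟨_, _, hu k, rfl⟩
    have h2 := hmem l
    rw [← hml] at h2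
    exact Subtype.ext (torsionSet_unique (hmem m) h2)
  exact Set.finite_coe_iff.1 (Finite.of_injective u hinj)

/-- The supports of the non-torsion components of a revealing pair are exactly the atoms. -/
theorem TreePair.exists_equiv_atoms {P : TreePair n} (hP : P.IsRevealingFor α) :
    ∃ E : P.NonTorsionComponent ≃ {X // IsInvAtom α X},
      ∀ c, (E c).1 = P.componentSupport α c :=
  ⟨Equiv.ofBijective (fun c => ⟨P.componentSupport α c, IsInvAtom.of_componentSupport hP c⟩)
    ⟨fun _ _ h => IsInvAtom.componentSupport_injective hP (congrArg Subtype.val h),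
      fun X => (IsInvAtom.exists_component hP X.2).imp fun _ h => Subtype.ext h⟩, fun _ => rfl⟩

end

section

variable {n : ℕ} [Nontrivial (Fin n)] (α : V n)

/-- The orbits of the centralizer on the atoms, numbered, with their enumerations and the
resulting homomorphisms to wreath products. -/
theorem exists_atomClasses : ∃ (t : ℕ) (q : Fin t → ℕ) (A : Fin t → Type)
    (_ : ∀ j, Group (A j)) (_ : ∀ j, Finite (A j)) (φ : ∀ j, Multiplicative ℤ →* MulAut (A j))
    (cls : {X // IsInvAtom α X} → Fin t) (enum : ∀ j, Fin (q j) ≃ {X // cls X = j})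
    (Θ : ∀ j, centralizer α →* Wreath (ByInt (A j) (φ j)) (q j)),
    Function.Surjective cls ∧
    (∀ X X', cls X = cls X' ↔ ∃ f : centralizer α, f • X = X') ∧
    (∀ X, ∃ e : restrictedCentralizer α X.1 ≃* ByInt (A (cls X)) (φ (cls X)),
      ∀ g, IsOfFinOrder g ↔ (e g).right = 1) ∧
    (∀ j, Function.Surjective (Θ j)) ∧
    (∀ j g, Θ j g = 1 ↔ ∀ X, cls X = j → ∀ x ∈ X.1, g.1 • x = x) ∧
    ∀ j g i, g • (enum j i).1 = (enum j ((Θ j g).right i)).1 := by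
  have hfin : Finite (MulAction.orbitRel.Quotient (centralizer α) {X // IsInvAtom α X}) :=
    Quotient.finite _
  let num := Finite.equivFin (MulAction.orbitRel.Quotient (centralizer α) {X // IsInvAtom α X})
  let cls : {X // IsInvAtom α X} → Fin _ := fun X => num (Quotient.mk _ X)
  have hsurj : Function.Surjective cls := num.surjective.comp Quotient.mk_surjective
  have hcls : ∀ X X', cls X = cls X' ↔ ∃ f : centralizer α, f • X = X' := fun X X' => by
    rw [eq_comm, num.apply_eq_iff_eq, Quotient.eq]; rfl
  have hclsmul : ∀ (g : centralizer α) X, cls (g • X) = cls X := fun g X =>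
    ((hcls X _).2 ⟨g, rfl⟩).symm
  let enum : ∀ j, Fin (Nat.card {X // cls X = j}) ≃ {X // cls X = j} := fun j =>
    (Finite.equivFin _).symm
  choose σ hσ using fun j => exists_permHom (G := centralizer α) (p := fun X => cls X = j)
    (fun g X h => (hclsmul g X).trans h) (enum j)
  choose base hbase using hsurj
  choose A iA fA φ e he using fun j => (base j).2.exists_mulEquiv_byInt
  have hf : ∀ j i, ∃ f : centralizer α, f • base j = (enum j i).1 := fun j i =>
    (hcls _ _).1 ((hbase j).trans (enum j i).2.symm)
  choose f hf using hf
  choose Θ hΘσ hΘ hΘs using fun j => exists_wreathHom (σ j) (X := fun i => (enum j i).1.1)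
    (base j).2.nonempty (base j).2.isClopen (base j).2.smul_mem_iff
    (fun i i' x hx hx' => (enum j).injective (Subtype.ext (Subtype.ext
      (IsInvAtom.eq_of_mem (enum j i).1.2 (enum j i').1.2 hx hx'))))
    (fun g i => (congrArg Subtype.val (hσ j g i)).symm) (f j)
    (fun i => congrArg Subtype.val (hf j i)) (e j)
  refine ⟨_, _, A, iA, fA, φ, cls, enum, Θ, fun j => ⟨base j, hbase j⟩, hcls, fun X => ?_, hΘs,
    fun j g => (hΘ j g).trans ⟨fun h X hX x hx => ?_, fun h i x hx => h _ (enum j i).2 x hx⟩,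
    fun j g i => ?_⟩
  · obtain ⟨f, hf⟩ := (hcls X (base (cls X))).1 (hbase _).symm
    obtain ⟨E⟩ := exists_conj_restrictedCentralizer (commute_of_centralizer f)
      (congrArg Subtype.val hf)
    refine ⟨E.trans (e (cls X)), fun g => ?_⟩
    rw [MulEquiv.trans_apply, ← he]
    exact (E.injective.isOfFinOrder_iff (f := E.toMonoidHom)).symm
  · obtain ⟨i, hi⟩ := (enum j).surjective ⟨X, hX⟩
    exact h i x (by rw [hi]; exact hx)
  · rw [hΘσ, hσ]

/-- The structure of the centralizer, with all choices made from the torsion sets and the atoms,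
which depend on `α` alone, so that they are compatible with every revealing pair. -/
theorem exists_centralizer_mulEquiv :
    (∃ P : TreePair n, P.IsRevealingFor α) ∧
    ∃ (s t : ℕ) (m r : Fin s → ℕ) (q : Fin t → ℕ)
      (A : Fin t → Type) (_ : ∀ j, Group (A j)) (_ : ∀ j, Finite (A j))
      (φ : ∀ j, Multiplicative ℤ →* MulAut (A j))
      (Φ : centralizer α ≃*
        (∀ i, TorsionFactor n (m i) (r i)) × (∀ j, Wreath (ByInt (A j) (φ j)) (q j))),
      Function.Injective m ∧
      (∀ i, IsLeast {c : ℕ | ∃ (γ : V n) (Q : TreePair n),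
        Q.IsRevealingFor (γ * α * γ⁻¹) ∧ Q.numCycles (m i) = c} (r i)) ∧
      ∀ P : TreePair n, P.IsRevealingFor α →
        Set.range m = P.cycleLengths ∧
        (∀ i g, (Φ g).1 i = 1 ↔ ∀ x ∈ P.torsionSupport (m i), g.1.1 x = x) ∧
        ∃ (cls : P.NonTorsionComponent → Fin t) (enum : ∀ j, Fin (q j) ≃ {c // cls c = j}),
          Function.Surjective cls ∧
          (∀ c c', cls c = cls c' ↔ ∃ f ∈ centralizer α,
            f.1 '' P.componentSupport α c = P.componentSupport α c') ∧
          (∀ c, ∃ e : restrictedCentralizer α (P.componentSupport α c) ≃*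
              ByInt (A (cls c)) (φ (cls c)),
            ∀ g, IsOfFinOrder g ↔ (e g).right = 1) ∧
          (∀ j g, (Φ g).2 j = 1 ↔
            ∀ c, cls c = j → ∀ x ∈ P.componentSupport α c, g.1.1 x = x) ∧
          (∀ j g i, g.1.1 '' P.componentSupport α (enum j i).1 =
            P.componentSupport α (enum j (((Φ g).2 j).right i)).1) := by
  obtain ⟨P₀, hP₀⟩ := TreePair.exists_isRevealingFor α
  refine ⟨⟨P₀, hP₀⟩, ?_⟩
  have hfin : Finite P₀.cycleLengths := (TreePair.finite_cycleLengths hP₀).to_subtype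
  let num := (Finite.equivFin P₀.cycleLengths).symm
  let m : Fin (Nat.card P₀.cycleLengths) → ℕ := fun i => (num i).1
  have hminj : Function.Injective m := Subtype.val_injective.comp num.injective
  have hrange : ∀ l, l ∈ Set.range m ↔ (torsionSet α l).Nonempty := fun l => by
    rw [← TreePair.mem_cycleLengths_iff hP₀]
    constructor
    · rintro ⟨i, rfl⟩
      exact (num i).2
    · intro hl
      exact ⟨num.symm ⟨l, hl⟩, congrArg Subtype.val (num.apply_symm_apply _)⟩
  have hpos : ∀ i, 0 < m i := fun i => by
    obtain ⟨x, hx⟩ := (hrange _).1 ⟨i, rfl⟩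
    exact hx.1
  -- the numbers of cycles of length `l` in revealing pairs for conjugates of `α`
  let R : ℕ → Set ℕ := fun l => {c | ∃ (γ : V n) (Q : TreePair n),
    Q.IsRevealingFor (γ * α * γ⁻¹) ∧ Q.numCycles l = c}
  have hR : ∀ l, (R l).Nonempty := fun l => ⟨_, 1, P₀, by simpa using hP₀, rfl⟩
  have hΨ : ∀ i, ∃ Ψ : centralizer α →* TorsionFactor n (m i) (sInf (R (m i))),
      Function.Surjective Ψ ∧ ∀ g, Ψ g = 1 ↔ ∀ x ∈ torsionSet α (m i), g.1 • x = x := fun i => by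
    obtain ⟨γ, Q, hQ, hr⟩ := Nat.sInf_mem (hR (m i))
    rw [← hr]
    exact TreePair.exists_torsionHom hQ (hpos i)
  choose Ψ hΨs hΨ using hΨ
  obtain ⟨t, q, A, iA, fA, φ, cls, enum, Θ, hsurj, hcls, hbyInt, hΘs, hΘ, henum⟩ :=
    exists_atomClasses α
  obtain ⟨Φ, hΦ₁, hΦ₂⟩ := exists_mulEquiv_prod
    (D := fun i => torsionSet α (m i)) (E := fun j => ⋃ X : {X // cls X = j}, X.1.1)
    (fun i => by
      rw [← TreePair.torsionSupport_eq hP₀]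
      exact TreePair.isOpen_torsionSupport P₀ (m i))
    (fun j => isOpen_iUnion fun X => X.1.2.isClopen.isOpen)
    (fun x => by
      by_cases hx : ∃ l, x ∈ torsionSet α l
      · obtain ⟨l, hl⟩ := hx
        obtain ⟨i, rfl⟩ := (hrange l).2 ⟨x, hl⟩
        exact Or.inl ⟨i, hl⟩
      · obtain ⟨X, hX, hxX⟩ := IsInvAtom.exists_mem (not_exists.1 hx)
        exact Or.inr ⟨cls ⟨X, hX⟩, Set.mem_iUnion.2 ⟨⟨⟨X, hX⟩, rfl⟩, hxX⟩⟩)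
    (fun i i' x hi hi' => hminj (torsionSet_unique hi hi'))
    (fun j j' x hj hj' => by
      obtain ⟨⟨X, rfl⟩, hX⟩ := Set.mem_iUnion.1 hj
      obtain ⟨⟨X', rfl⟩, hX'⟩ := Set.mem_iUnion.1 hj'
      exact congrArg cls (Subtype.ext (IsInvAtom.eq_of_mem X.2 X'.2 hX hX')))
    (fun i j x hi hj => by
      obtain ⟨X, hX⟩ := Set.mem_iUnion.1 hj
      exact X.1.2.not_torsion x hX _ hi)
    (fun i g x => smul_mem_torsionSet (commute_of_centralizer g))
    (fun j g x => by
      have key : ∀ (g : centralizer α) x, x ∈ ⋃ X : {X // cls X = j}, X.1.1 →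
          g.1 • x ∈ ⋃ X : {X // cls X = j}, X.1.1 := fun g x hx => by
        obtain ⟨X, hX⟩ := Set.mem_iUnion.1 hx
        exact Set.mem_iUnion.2 ⟨⟨g • X.1, ((hcls X.1 _).2 ⟨g, rfl⟩).symm.trans X.2⟩,
          Set.smul_mem_smul_set hX⟩
      refine ⟨fun h => ?_, key g x⟩
      have := key g⁻¹ _ h
      rwa [Subgroup.coe_inv, inv_smul_smul] at this)
    Ψ Θ hΨs hΘs hΨ
    (fun j g => (hΘ j g).trans ⟨fun h x hx => by
      obtain ⟨X, hX⟩ := Set.mem_iUnion.1 hx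
      exact h X.1 X.2 x hX, fun h X hX x hx => h x (Set.mem_iUnion.2 ⟨⟨X, hX⟩, hx⟩)⟩)
  refine ⟨_, t, m, fun i => sInf (R (m i)), q, A, iA, fA, φ, Φ, hminj,
    fun i => ⟨Nat.sInf_mem (hR _), fun c hc => Nat.sInf_le hc⟩, fun P hP => ⟨?_, fun i g => ?_, ?_⟩⟩
  · ext l
    rw [hrange, TreePair.mem_cycleLengths_iff hP]
  · rw [hΦ₁, hΨ, TreePair.torsionSupport_eq hP]; rfl
  · obtain ⟨E, hE⟩ := TreePair.exists_equiv_atoms hP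
    refine ⟨fun c => cls (E c), fun j => (enum j).trans
      (E.subtypeEquiv fun c => Iff.rfl).symm, hsurj.comp E.surjective, fun c c' => ?_, fun c => ?_,
      fun j g => ?_, fun j g i => ?_⟩
    · rw [hcls]
      constructor
      · rintro ⟨f, hf⟩
        refine ⟨f.1, f.2, ?_⟩
        rw [← hE, ← hE, ← hf]; rfl
      · rintro ⟨f, hf, h⟩
        refine ⟨⟨f, hf⟩, Subtype.ext ?_⟩
        rw [← hE, ← hE] at h
        exact h
    · rw [← hE]
      exact hbyInt (E c)
    · rw [hΦ₂, hΘ]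
      constructor
      · intro h c hc x hx
        exact h (E c) hc x (by rwa [hE])
      · intro h X hX x hx
        refine h (E.symm X) ((congrArg cls (E.apply_symm_apply X)).trans hX) x ?_
        rwa [← hE, E.apply_symm_apply]
    · rw [hΦ₂, ← hE, ← hE]
      have h1 : ∀ k, E ((((enum j).trans (E.subtypeEquiv fun c => Iff.rfl).symm) k).1) =
          (enum j k).1 := fun k => E.apply_symm_apply _
      rw [h1, h1, ← henum]; rfl

end

end

end HT

theorem theorem1p1 (n : ℕ) (hn : 1 < n) (α : HT.V n) :
    (∃ P : HT.TreePair n, P.IsRevealingFor α) ∧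
    ∃ (s t : ℕ) (m r : Fin s → ℕ) (q : Fin t → ℕ)
      (A : Fin t → Type) (_ : ∀ j, Group (A j)) (_ : ∀ j, Finite (A j))
      (φ : ∀ j, Multiplicative ℤ →* MulAut (A j))
      (Φ : HT.centralizer α ≃*
        (∀ i, HT.TorsionFactor n (m i) (r i)) × (∀ j, HT.Wreath (HT.ByInt (A j) (φ j)) (q j))),
      Function.Injective m ∧
      (∀ i, IsLeast {c : ℕ | ∃ (γ : HT.V n) (Q : HT.TreePair n),
        Q.IsRevealingFor (γ * α * γ⁻¹) ∧ Q.numCycles (m i) = c} (r i)) ∧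
      ∀ P : HT.TreePair n, P.IsRevealingFor α →
        Set.range m = P.cycleLengths ∧
        (∀ i g, (Φ g).1 i = 1 ↔ ∀ x ∈ P.torsionSupport (m i), g.1.1 x = x) ∧
        ∃ (cls : P.NonTorsionComponent → Fin t) (enum : ∀ j, Fin (q j) ≃ {c // cls c = j}),
          Function.Surjective cls ∧
          (∀ c c', cls c = cls c' ↔ ∃ f ∈ HT.centralizer α,
            f.1 '' P.componentSupport α c = P.componentSupport α c') ∧
          (∀ c, ∃ e : HT.restrictedCentralizer α (P.componentSupport α c) ≃*
              HT.ByInt (A (cls c)) (φ (cls c)),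
            ∀ g, IsOfFinOrder g ↔ (e g).right = 1) ∧
          (∀ j g, (Φ g).2 j = 1 ↔
            ∀ c, cls c = j → ∀ x ∈ P.componentSupport α c, g.1.1 x = x) ∧
          (∀ j g i, g.1.1 '' P.componentSupport α (enum j i).1 =
            P.componentSupport α (enum j (((Φ g).2 j).right i)).1) := by
  have : Nontrivial (Fin n) := Fin.nontrivial_iff_two_le.2 hn
  exact HT.exists_centralizer_mulEquiv α
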